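/- Let $d\ge 2$ and let $(\tau_e)$ be i.i.d. nonnegative random variables with law $\mu$, indexed by the nearest-neighbour edges $e$ of $\mathbb Z^d$. Assume that $\mu(\{\lambda\})<p_c(d)$, where $\lambda$ is the infimum of the support of $\mu$ and $p_c(d)$ is the critical probability of bond percolation on $\mathbb Z^d$. For $v\in\mathbb Z^d$ let $\tau(0,v)$ be the infimum, over all finite nearest-neighbour paths $\gamma$ from $0$ to $v$, of $\tau(\gamma)=\sum_{e\in\gamma}\tau_e$ (edges counted with multiplicity; paths need not be self-avoiding). A geodesic from $0$ to $v$ is a path attaining this infimum, and $D(0,v)\in[0,\infty]$ is the supremum of the Euclidean distances between points on geodesics from $0$ to $v$ and the line segment joining $0$ to $v$. Write $|v|$ for the Euclidean norm of $v$. Assume that the model has global exponents in the sense of Chatterjee, that is, $\chi_a,\chi_b,\xi_a,\xi_b$ are real numbers such that: 1. for all $\chi'>\chi_a$ and $\xi'>\xi_a$ there is $\alpha>0$ with $$\sup_{v\in\mathbb Z^d\setminus\{0\}}\mathbb E\exp\Big(\alpha\frac{|\tau(0,v)-\mathbb E\tau(0,v)|}{|v|^{\chi'}}\Big)<\infty\quad\text{and}\quad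 \sup_{v\in\mathbb Z^d\setminus\{0\}}\mathbb E\exp\Big(\alpha\frac{D(0,v)}{|v|^{\xi'}}\Big)<\infty;$$ 2. for all $\chi''<\chi_b$ and $\xi''<\xi_b$, $$\inf_{v\in\mathbb Z^d\setminus\{0\}}\frac{\operatorname{Var}(\tau(0,v))}{|v|^{2\chi''}}>0\quad\text{and}\quad \inf_{v\in\mathbb Z^d\setminus\{0\}}\frac{\mathbb E\,D(0,v)}{|v|^{\xi''}}>0.$$ If moreover $\chi:=\chi_a=\chi_b>0$, then $$\chi\le 2\xi_a-1 .$$ -/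

import Mathlib

open MeasureTheory ProbabilityTheory
open scoped ENNReal unitInterval

noncomputable section

namespace FPP

/-- The nearest-neighbour graph on `ℤ^d`: two points are adjacent iff their `ℓ¹` distance is `1`. -/
def lattice (d : ℕ) : SimpleGraph (Fin d → ℤ) where
  Adj x y := ∑ i, |x i - y i| = 1
  symm := ⟨fun x y h => by simpa only [abs_sub_comm] using h⟩
  loopless := ⟨fun x h => by simp at h⟩

/-- A lattice point, seen as a point of Euclidean space `ℝ^d`. -/
def toEuc {d : ℕ} (x : Fin d → ℤ) : EuclideanSpace ℝ (Fin d) :=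
  WithLp.toLp 2 (fun i => (x i : ℝ))

/-! ### The critical probability of bond percolation -/

/-- The probability that the open cluster of the origin is infinite, in Bernoulli bond percolation
on `ℤ^d` where every edge is open with probability `p`, independently of the others. -/
def percolationProb (d : ℕ) (p : I) : ℝ≥0∞ :=
  setBernoulli (lattice d).edgeSet p
    {S | {x | (SimpleGraph.fromEdgeSet S).Reachable 0 x}.Infinite}

/-- The critical probability `p_c(d)` of bond percolation on `ℤ^d`. -/
def criticalProb (d : ℕ) : ℝ :=
  sSup {p : ℝ | ∃ h : p ∈ I, percolationProb d ⟨p, h⟩ = 0}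

/-! ### First-passage percolation -/

/-- An assignment of a weight to every edge of `ℤ^d`. -/
abbrev Weights (d : ℕ) : Type := (lattice d).edgeSet → ℝ

/-- The passage time of a finite lattice path: the sum of the weights along its edges. -/
def pathTime {d : ℕ} (w : Weights d) {x y : Fin d → ℤ} (γ : (lattice d).Walk x y) : ℝ :=
  (γ.darts.map fun a => w ⟨a.edge, a.edge_mem⟩).sum

/-- The passage time `τ(x, y)`: the infimum of the passage times of finite paths joining
`x` and `y`. -/
def passageTime {d : ℕ} (w : Weights d) (x y : Fin d → ℤ) : ℝ :=
  ⨅ γ : (lattice d).Walk x y, pathTime w γ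

/-- A geodesic is a path which realises the passage time between its endpoints. -/
def IsGeodesic {d : ℕ} (w : Weights d) {x y : Fin d → ℤ} (γ : (lattice d).Walk x y) : Prop :=
  pathTime w γ = passageTime w x y

/-- `D(x, y)`: the largest Euclidean distance of a point on a geodesic from `x` to `y` to the
line segment joining `x` and `y`. The distance to a segment is a convex function, so that on each
edge its maximum is attained at an endpoint, and it is enough to look at the vertices. -/
def deviation {d : ℕ} (w : Weights d) (x y : Fin d → ℤ) : ℝ≥0∞ :=
  ⨆ (γ : (lattice d).Walk x y) (_ : IsGeodesic w γ) (z : Fin d → ℤ) (_ : z ∈ γ.support),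
    Metric.infEDist (toEuc z) (segment ℝ (toEuc x) (toEuc y))

/-- The random weights `t e`, for `e` an edge of `ℤ^d`, are nonnegative, independent, and
identically distributed with law `μ`. -/
structure IsIIDWeights {d : ℕ} {Ω : Type*} [MeasurableSpace Ω] (P : Measure Ω)
    (μ : Measure ℝ) (t : (lattice d).edgeSet → Ω → ℝ) : Prop where
  measurable : ∀ e, Measurable (t e)
  nonneg : ∀ e ω, 0 ≤ t e ω
  indep : iIndepFun t P
  law : ∀ e, P.map (t e) = μ

section Exponents

variable {d : ℕ} {Ω : Type*} [MeasurableSpace Ω]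

/-- The random variable `τ(0, v)`. -/
def tau (t : (lattice d).edgeSet → Ω → ℝ) (v : Fin d → ℤ) (ω : Ω) : ℝ :=
  passageTime (fun e => t e ω) 0 v

/-- The random variable `D(0, v)`. -/
def dev (t : (lattice d).edgeSet → Ω → ℝ) (v : Fin d → ℤ) (ω : Ω) : ℝ≥0∞ :=
  deviation (fun e => t e ω) 0 v

/-- The model has global exponents `χa`, `χb`, `ξa`, `ξb` in the sense of Chatterjee.
All suprema, infima, expectations and variances are taken in `[0, ∞]`. -/
structure HasGlobalExponents (P : Measure Ω) (t : (lattice d).edgeSet → Ω → ℝ)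
    (χa χb ξa ξb : ℝ) : Prop where
  /-- the upper exponents -/
  above : ∀ χ' > χa, ∀ ξ' > ξa, ∃ α : ℝ, 0 < α ∧
    (⨆ v : {v : Fin d → ℤ // v ≠ 0}, ∫⁻ ω, ENNReal.ofReal
        (Real.exp (α * (|tau t v ω - ∫ ω', tau t v ω' ∂P| / ‖toEuc v.1‖ ^ χ'))) ∂P) < ∞ ∧
    (⨆ v : {v : Fin d → ℤ // v ≠ 0}, ∫⁻ ω, EReal.exp
        ((ENNReal.ofReal α * (dev t v ω / ENNReal.ofReal (‖toEuc v.1‖ ^ ξ')) : ℝ≥0∞) : EReal)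
          ∂P) < ∞
  /-- the lower exponents -/
  below : ∀ χ'' < χb, ∀ ξ'' < ξb,
    0 < (⨅ v : {v : Fin d → ℤ // v ≠ 0},
        evariance (tau t v) P / ENNReal.ofReal (‖toEuc v.1‖ ^ (2 * χ''))) ∧
    0 < (⨅ v : {v : Fin d → ℤ // v ≠ 0},
        (∫⁻ ω, dev t v ω ∂P) / ENNReal.ofReal (‖toEuc v.1‖ ^ ξ''))

end Exponents

end FPP

end

/-! ### Geometry of the lattice inside Euclidean space. -/

namespace FPP

variable {d : ℕ}

/-! Write `h` for the mean passage time from the origin, `g = asymp h` for its homogeneous limit,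
and `χ` for `χa`. Assuming `χ > 2 ξa - 1`, directions are found in which the variance is too small
(`HasGlobalExponents.variance_upper`), contradicting the lower exponent.

Take `v` of length about `n`, and `z` orthogonal to `v` up to rounding, of length about `n ^ ξ₂`
with `ξ₂ > ξa`. With high probability the geodesics from `0` to `v` and from `z` to `z + v` stay so
close to their segments that they lie in disjoint half-spaces, so the two passage times coincide
with independent variables. They are also close to each other: follow one geodesic except near its
two ends, where it is left at distance about `n ^ β` from the endpoints, `β < 1`, to reach the
endpoints of the other. This costs the fluctuations of passage times at scale `n ^ β`, of order `n ^
(ν β)` with `ν` slightly above `χ`, and the change of `h` under a transverse displacement `z` at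
distance `n ^ β`, which is shown to be at most of order `n ^ (2 ξ₂ - β) + n ^ (ν β)`. For suitable
exponents all this is `n ^ η` with `η < χ`. Since independent variables satisfy `Var X ≤ Var (X -
Y)`, the variance is at most of order `n ^ (2 η)` (`variance_le_of_nearly_indep`).

The change of `h` is controlled by two facts. First, `g` is nearly flat transversally to a direction
that almost maximises `g(x) / |x|`, with supremum `A`: a point `y` at height `s` and transverse
distance `p`, and its mirror image in the axis, add up to `2 s` times the direction, so their
`g`-values sum to about `2 A s` at least, while each is at most about `A (s + p² / (2 s))`. Hence
`g(y) = A s + O(p² / s) + O(1)`, with no curvature assumption (`exists_near_maximal`,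
`abs_asymp_sub_le`). Second, `h - g` is at most of order `|x| ^ ν`
(`HasGlobalExponents.nonrandom_fluctuation`): a geodesic from `0` to `2 X` is cut into short steps,
Carathéodory's theorem extracts half of them with boundedly many fractional ones, and the resulting
bound of `h(X)` by `h(2 X) / 2` plus an error is summed over dyadic scales. Repeating this lowers
the error exponent from `1` to `ν`.

Bounds on `deviation` say nothing if there are no geodesics; these exist almost surely because the
edges of small weight do not percolate (`IsIIDWeights.ae_exists_isGeodesic`). -/

@[simp] lemma toEuc_apply (x : Fin d → ℤ) (i : Fin d) : toEuc x i = (x i : ℝ) := rfl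

lemma toEuc_add (x y : Fin d → ℤ) : toEuc (x + y) = toEuc x + toEuc y := by
  ext i; simp

lemma toEuc_sub (x y : Fin d → ℤ) : toEuc (x - y) = toEuc x - toEuc y := by
  ext i; simp

@[simp] lemma toEuc_zero : toEuc (0 : Fin d → ℤ) = 0 := by
  ext i; simp

lemma toEuc_nsmul (n : ℕ) (x : Fin d → ℤ) : toEuc (n • x) = (n : ℝ) • toEuc x := by
  ext i; simp

lemma toEuc_list_sum (l : List (Fin d → ℤ)) : toEuc l.sum = (l.map toEuc).sum := by
  induction l with
  | nil => simp
  | cons a l ih => simp [toEuc_add, ih]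

lemma toEuc_finset_sum {ι : Type*} (s : Finset ι) (f : ι → Fin d → ℤ) :
    toEuc (∑ i ∈ s, f i) = ∑ i ∈ s, toEuc (f i) := by
  classical
  induction s using Finset.induction_on with
  | empty => simp
  | insert a s ha ih => simp [Finset.sum_insert ha, toEuc_add, ih]

lemma abs_coord_le_norm_toEuc (x : Fin d → ℤ) (i : Fin d) : |(x i : ℝ)| ≤ ‖toEuc x‖ := by
  simpa using PiLp.norm_apply_le (toEuc x) i

lemma one_le_norm_toEuc {x : Fin d → ℤ} (hx : x ≠ 0) : 1 ≤ ‖toEuc x‖ := by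
  obtain ⟨i, hi⟩ : ∃ i, x i ≠ 0 := by
    by_contra! h
    exact hx (funext h)
  refine le_trans ?_ (abs_coord_le_norm_toEuc x i)
  exact_mod_cast Int.one_le_abs hi

lemma norm_le_sum_abs (p : EuclideanSpace ℝ (Fin d)) : ‖p‖ ≤ ∑ i, |p i| := by
  rw [EuclideanSpace.norm_eq]
  apply Real.sqrt_le_iff.2
  refine ⟨Finset.sum_nonneg fun _ _ => abs_nonneg _, ?_⟩
  simpa using Finset.sum_sq_le_sq_sum_of_nonneg (s := Finset.univ) (f := fun i => |p i|)
    (fun i _ => abs_nonneg _)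

lemma sum_abs_le_mul_norm_toEuc (x : Fin d → ℤ) : ∑ i, |(x i : ℝ)| ≤ d * ‖toEuc x‖ := by
  calc ∑ i, |(x i : ℝ)| ≤ ∑ _i : Fin d, ‖toEuc x‖ :=
        Finset.sum_le_sum fun i _ => abs_coord_le_norm_toEuc x i
    _ = d * ‖toEuc x‖ := by simp

lemma norm_toEuc_sub_le_one_of_adj {x y : Fin d → ℤ} (h : (lattice d).Adj x y) :
    ‖toEuc y - toEuc x‖ ≤ 1 := by
  refine (norm_le_sum_abs _).trans ?_
  have h' : ∑ i, |x i - y i| = 1 := h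
  have : ((∑ i, |x i - y i| : ℤ) : ℝ) = 1 := by rw [h']; simp
  push_cast at this
  simpa [abs_sub_comm] using this.le

/-- A lattice point close to a given point of Euclidean space. -/
noncomputable def nearest (p : EuclideanSpace ℝ (Fin d)) : Fin d → ℤ := fun i => round (p i)

lemma norm_toEuc_nearest_sub_le (p : EuclideanSpace ℝ (Fin d)) :
    ‖toEuc (nearest p) - p‖ ≤ d := by
  refine (norm_le_sum_abs _).trans ?_
  calc ∑ i, |(toEuc (nearest p) - p) i| ≤ ∑ _i : Fin d, (1 : ℝ) := by
        refine Finset.sum_le_sum fun i _ => ?_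
        have := abs_sub_round (p i)
        simp only [PiLp.sub_apply, toEuc_apply, nearest]
        rw [abs_sub_comm]
        linarith
    _ = d := by simp

/-- The polynomial cardinality is what the union bound over pairs of points needs. -/
lemma exists_finset_ball (d : ℕ) (r : ℝ) (hr : 0 ≤ r) :
    ∃ F : Finset (Fin d → ℤ), (∀ x, ‖toEuc x‖ ≤ r → x ∈ F) ∧ (F.card : ℝ) ≤ (2 * r + 1) ^ d := by
  refine ⟨Fintype.piFinset fun _ => Finset.Icc (-⌊r⌋) ⌊r⌋, fun x hx => ?_, ?_⟩
  · rw [Fintype.mem_piFinset]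
    intro i
    have h := abs_le.1 ((abs_coord_le_norm_toEuc x i).trans hx)
    rw [Finset.mem_Icc]
    refine ⟨?_, Int.le_floor.2 h.2⟩
    have : -(x i) ≤ ⌊r⌋ := Int.le_floor.2 (by push_cast; linarith [h.1])
    linarith
  · simp only [Fintype.card_piFinset, Int.card_Icc, Finset.prod_const, Finset.card_univ,
      Fintype.card_fin]
    push_cast
    have h0 : 0 ≤ ⌊r⌋ := Int.floor_nonneg.2 hr
    have h1 : (((⌊r⌋ + 1 - -⌊r⌋).toNat : ℕ) : ℝ) ≤ 2 * r + 1 := by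
      have : (((⌊r⌋ + 1 - -⌊r⌋).toNat : ℕ) : ℤ) = 2 * ⌊r⌋ + 1 := by
        rw [Int.toNat_of_nonneg (by linarith)]; ring
      have h2 : (((⌊r⌋ + 1 - -⌊r⌋).toNat : ℕ) : ℝ) = 2 * (⌊r⌋ : ℝ) + 1 := by exact_mod_cast this
      rw [h2]; linarith [Int.floor_le r]
    gcongr

lemma lattice_adj_add_right (a x y : Fin d → ℤ) :
    (lattice d).Adj (x + a) (y + a) ↔ (lattice d).Adj x y := by
  simp [lattice]

lemma lattice_adj_add_single (x : Fin d → ℤ) (i : Fin d) {c : ℤ} (hc : |c| = 1) :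
    (lattice d).Adj x (x + Pi.single i c) := by
  have h : ∑ j, |x j - (x + (Pi.single i c : Fin d → ℤ)) j| = 1 := by
    rw [Finset.sum_eq_single i]
    · simpa using hc
    · intro j _ hj; simp [hj]
    · simp
  exact h

lemma lattice_reachable_add_single (x : Fin d → ℤ) (i : Fin d) (c : ℤ) :
    (lattice d).Reachable x (x + Pi.single i c) := by
  induction c using Int.induction_on with
  | zero => simp
  | succ n ih =>
    refine ih.trans (SimpleGraph.Adj.reachable ?_)
    rw [Pi.single_add, ← add_assoc]
    exact lattice_adj_add_single _ i (by simp)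
  | pred n ih =>
    refine ih.trans (SimpleGraph.Adj.reachable ?_)
    rw [sub_eq_add_neg, Pi.single_add, ← add_assoc]
    exact lattice_adj_add_single _ i (by simp)

lemma lattice_reachable (x y : Fin d → ℤ) : (lattice d).Reachable x y := by
  have key : ∀ s : Finset (Fin d), (lattice d).Reachable x
      (x + ∑ i ∈ s, Pi.single i ((y - x) i)) := by
    intro s
    induction s using Finset.induction_on with
    | empty => simp
    | insert a s ha ih =>
      rw [Finset.sum_insert ha, add_comm (Pi.single a _), ← add_assoc]
      exact ih.trans (lattice_reachable_add_single _ _ _)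
  have h := key Finset.univ
  rwa [Finset.univ_sum_single, add_sub_cancel] at h

/-- Ensures that `passageTime` is a genuine infimum and not the default value `0` of an empty one.
-/
instance (x y : Fin d → ℤ) : Nonempty ((lattice d).Walk x y) := lattice_reachable x y

/-- Countability makes the infima and suprema over walks measurable. -/
instance walk_countable {V : Type*} [Countable V] (G : SimpleGraph V) (x y : V) :
    Countable (G.Walk x y) :=
  Function.Injective.countable (f := fun p : G.Walk x y => p.support)
    fun _ _ h => SimpleGraph.Walk.ext_support h

/-- Translation by `a`, as an automorphism of the lattice. -/
def shift (a : Fin d → ℤ) : lattice d ≃g lattice d where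
  toEquiv := Equiv.addRight a
  map_rel_iff' := by intro x y; exact lattice_adj_add_right a x y

@[simp] lemma shift_apply (a x : Fin d → ℤ) : shift a x = x + a := rfl

end FPP

/-! ### Deterministic properties of passage times and geodesics. -/

namespace FPP

variable {d : ℕ} {w : Weights d} {x y z : Fin d → ℤ}

@[simp] lemma pathTime_nil : pathTime w (SimpleGraph.Walk.nil : (lattice d).Walk x x) = 0 := by
  simp [pathTime]

lemma pathTime_cons (h : (lattice d).Adj x y) (γ : (lattice d).Walk y z) :
    pathTime w (SimpleGraph.Walk.cons h γ) = w ⟨s(x, y), h⟩ + pathTime w γ := by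
  simp [pathTime, SimpleGraph.Dart.edge]

lemma pathTime_append (γ : (lattice d).Walk x y) (γ' : (lattice d).Walk y z) :
    pathTime w (γ.append γ') = pathTime w γ + pathTime w γ' := by
  simp [pathTime]

lemma pathTime_nonneg (hw : ∀ e, 0 ≤ w e) (γ : (lattice d).Walk x y) : 0 ≤ pathTime w γ := by
  apply List.sum_nonneg
  intro a ha
  obtain ⟨b, _, rfl⟩ := List.mem_map.1 ha
  exact hw _

lemma pathTime_bypass_le (hw : ∀ e, 0 ≤ w e) (γ : (lattice d).Walk x y) :
    pathTime w γ.bypass ≤ pathTime w γ := by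
  apply List.Sublist.sum_le_sum (γ.darts_bypass_sublist_darts.map _)
  intro a ha
  obtain ⟨b, _, rfl⟩ := List.mem_map.1 ha
  exact hw _

lemma passageTime_le (hw : ∀ e, 0 ≤ w e) (γ : (lattice d).Walk x y) :
    passageTime w x y ≤ pathTime w γ :=
  ciInf_le ⟨0, by rintro _ ⟨γ, rfl⟩; exact pathTime_nonneg hw γ⟩ γ

lemma passageTime_nonneg (hw : ∀ e, 0 ≤ w e) : 0 ≤ passageTime w x y :=
  le_ciInf fun γ => pathTime_nonneg hw γ

lemma passageTime_self (hw : ∀ e, 0 ≤ w e) : passageTime w x x = 0 :=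
  le_antisymm ((passageTime_le hw .nil).trans (by simp)) (passageTime_nonneg hw)

lemma passageTime_triangle (hw : ∀ e, 0 ≤ w e) (x y z : Fin d → ℤ) :
    passageTime w x z ≤ passageTime w x y + passageTime w y z := by
  refine le_ciInf_add_ciInf fun γ γ' => ?_
  rw [← pathTime_append]
  exact passageTime_le hw _

lemma IsGeodesic.of_append (hw : ∀ e, 0 ≤ w e) {γ : (lattice d).Walk x y}
    {γ' : (lattice d).Walk y z} (h : IsGeodesic w (γ.append γ')) :
    IsGeodesic w γ ∧ IsGeodesic w γ' ∧
      passageTime w x z = passageTime w x y + passageTime w y z := by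
  have h1 := passageTime_le hw γ
  have h2 := passageTime_le hw γ'
  have h3 := passageTime_triangle hw x y z
  rw [IsGeodesic, pathTime_append] at h
  refine ⟨?_, ?_, by linarith⟩
  · change pathTime w γ = _
    linarith
  · change pathTime w γ' = _
    linarith

/-- A discrete intermediate value theorem: the first vertex at level at least `c` overshoots by at
most `1`, unless it is the starting point, where the level is exactly `c`. -/
lemma exists_mem_support_level {V : Type*} {G : SimpleGraph V} {l : V → ℝ}
    (hl : ∀ x y, G.Adj x y → l y ≤ l x + 1) {a b : V} (γ : G.Walk a b) {c : ℝ}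
    (ha : l a ≤ c) (hb : c ≤ l b) : ∃ y ∈ γ.support, c ≤ l y ∧ l y ≤ c + 1 := by
  induction γ with
  | nil => exact ⟨_, by simp, hb, by linarith⟩
  | @cons u v z h p ih =>
    by_cases hc : c ≤ l v
    · refine ⟨v, by simp, hc, ?_⟩
      linarith [hl _ _ h]
    · obtain ⟨y, hy, h1⟩ := ih (not_le.1 hc).le hb
      exact ⟨y, by simp [hy], h1⟩

/-- A geodesic may be split at a level of a function which increases by at most `1` along edges. -/
lemma IsGeodesic.exists_split (hw : ∀ e, 0 ≤ w e) {l : (Fin d → ℤ) → ℝ}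
    (hl : ∀ x y, (lattice d).Adj x y → l y ≤ l x + 1) {a b : Fin d → ℤ}
    {γ : (lattice d).Walk a b} (hγ : IsGeodesic w γ) {c : ℝ} (ha : l a ≤ c) (hb : c ≤ l b) :
    ∃ y, c ≤ l y ∧ l y ≤ c + 1 ∧ y ∈ γ.support ∧
      passageTime w a b = passageTime w a y + passageTime w y b ∧
      ∃ γ' : (lattice d).Walk y b, IsGeodesic w γ' ∧ γ'.support ⊆ γ.support := by
  obtain ⟨y, hy, h1, h2⟩ := exists_mem_support_level hl γ ha hb
  have h := hγ
  rw [← γ.take_spec hy] at h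
  obtain ⟨_, h4, h5⟩ := h.of_append hw
  exact ⟨y, h1, h2, hy, h5, _, h4, γ.support_dropUntil_subset_support hy⟩

/-! ### Passage times inside a set of vertices -/

/-- The infimum of the passage times of the paths which stay in a set `C` of vertices. -/
noncomputable def passageTimeIn (C : Set (Fin d → ℤ)) (w : Weights d) (x y : Fin d → ℤ) : ℝ :=
  ⨅ γ : {γ : (lattice d).Walk x y // ∀ z ∈ γ.support, z ∈ C}, pathTime w γ.1

/-- This is how independence enters: the right side involves all weights, the left side only those
of edges inside `C`. -/
lemma IsGeodesic.passageTimeIn_eq (hw : ∀ e, 0 ≤ w e) {C : Set (Fin d → ℤ)}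
    {γ : (lattice d).Walk x y} (hγ : IsGeodesic w γ) (hC : ∀ z ∈ γ.support, z ∈ C) :
    passageTimeIn C w x y = passageTime w x y := by
  apply le_antisymm
  · rw [← hγ]
    exact ciInf_le (f := fun γ : {γ : (lattice d).Walk x y // ∀ z ∈ γ.support, z ∈ C} =>
      pathTime w γ.1) ⟨0, by rintro _ ⟨γ, rfl⟩; exact pathTime_nonneg hw γ.1⟩ ⟨γ, hC⟩
  · have : Nonempty {γ : (lattice d).Walk x y // ∀ z ∈ γ.support, z ∈ C} := ⟨⟨γ, hC⟩⟩
    exact le_ciInf fun γ => passageTime_le hw γ.1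

/-! ### Deviations -/

lemma IsGeodesic.exists_mem_segment {γ : (lattice d).Walk x y} (hγ : IsGeodesic w γ) {r : ℝ}
    (hr : deviation w x y < ENNReal.ofReal r) (hz : z ∈ γ.support) :
    ∃ q ∈ segment ℝ (toEuc x) (toEuc y), dist (toEuc z) q < r := by
  have h : Metric.infEDist (toEuc z) (segment ℝ (toEuc x) (toEuc y)) < ENNReal.ofReal r := by
    refine lt_of_le_of_lt ?_ hr
    unfold deviation
    refine le_iSup_of_le γ (le_iSup_of_le hγ (le_iSup_of_le z (le_iSup_of_le hz le_rfl)))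
  obtain ⟨q, hq, h⟩ := Metric.infEDist_lt_iff.1 h
  refine ⟨q, hq, ?_⟩
  rw [edist_dist] at h
  exact (ENNReal.ofReal_lt_ofReal_iff_of_nonneg dist_nonneg).1 h

/-! ### Translations -/

/-- Translation by `a`, acting on edges. -/
def shiftEdge (a : Fin d → ℤ) : (lattice d).edgeSet ≃ (lattice d).edgeSet := (shift a).mapEdgeSet

lemma shiftEdge_mk (a : Fin d → ℤ) (h : (lattice d).Adj x y) :
    shiftEdge a ⟨s(x, y), h⟩ = ⟨s(x + a, y + a), (lattice_adj_add_right a x y).2 h⟩ := rfl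

lemma exists_walk_shift (w : Weights d) (a : Fin d → ℤ) (γ : (lattice d).Walk x y) :
    ∃ γ' : (lattice d).Walk (x + a) (y + a),
      pathTime w γ' = pathTime (fun e => w (shiftEdge a e)) γ ∧
      γ'.support = γ.support.map (· + a) := by
  induction γ with
  | nil => exact ⟨.nil, by simp, by simp⟩
  | cons h p ih =>
    obtain ⟨p', h1, h2⟩ := ih
    refine ⟨.cons ((lattice_adj_add_right a _ _).2 h) p', ?_, ?_⟩
    · rw [pathTime_cons, pathTime_cons, h1, shiftEdge_mk]
    · simp [h2]

/-- The endpoints are variables subject to equations, so that induction on the walk applies and no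
transport along `x + a - a = x` is needed. -/
lemma exists_walk_unshift (w : Weights d) (a : Fin d → ℤ) {u v : Fin d → ℤ}
    (γ : (lattice d).Walk u v) (x y : Fin d → ℤ) (hx : u = x + a) (hy : v = y + a) :
    ∃ γ' : (lattice d).Walk x y,
      pathTime w γ = pathTime (fun e => w (shiftEdge a e)) γ' ∧
      γ.support = γ'.support.map (· + a) := by
  induction γ generalizing x with
  | nil =>
    obtain rfl : x = y := add_right_cancel (hx.symm.trans hy)
    exact ⟨.nil, by simp, by simp [hx]⟩
  | @cons u' v' _ h p ih =>
    subst hx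
    obtain ⟨p', h1, h2⟩ := ih (v' - a) (by simp) hy
    have h' : (lattice d).Adj x (v' - a) := (lattice_adj_add_right a _ _).1 (by simpa using h)
    refine ⟨.cons h' p', ?_, by simp [h2]⟩
    rw [pathTime_cons, pathTime_cons, h1, shiftEdge_mk]
    simp

lemma passageTime_shift (w : Weights d) (a x y : Fin d → ℤ) :
    passageTime (fun e => w (shiftEdge a e)) x y = passageTime w (x + a) (y + a) := by
  have : Set.range (fun γ : (lattice d).Walk x y => pathTime (fun e => w (shiftEdge a e)) γ) =
      Set.range (fun γ : (lattice d).Walk (x + a) (y + a) => pathTime w γ) := by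
    ext s
    constructor
    · rintro ⟨γ, rfl⟩
      obtain ⟨γ', h, _⟩ := exists_walk_shift w a γ
      exact ⟨γ', h⟩
    · rintro ⟨γ, rfl⟩
      obtain ⟨γ', h, _⟩ := exists_walk_unshift w a γ x y rfl rfl
      exact ⟨γ', h.symm⟩
  simp only [passageTime, iInf, this]

lemma infEDist_segment_add (a x y z : Fin d → ℤ) :
    Metric.infEDist (toEuc (z + a)) (segment ℝ (toEuc (x + a)) (toEuc (y + a))) =
      Metric.infEDist (toEuc z) (segment ℝ (toEuc x) (toEuc y)) := by
  simp only [toEuc_add, add_comm _ (toEuc a)]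
  rw [← segment_translate_image]
  exact Metric.infEDist_image (isometry_add_left (toEuc a))

lemma deviation_shift (w : Weights d) (a x y : Fin d → ℤ) :
    deviation (fun e => w (shiftEdge a e)) x y = deviation w (x + a) (y + a) := by
  apply le_antisymm
  · refine iSup_le fun γ => iSup_le fun hγ => iSup_le fun z => iSup_le fun hz => ?_
    obtain ⟨γ', h, hs⟩ := exists_walk_shift w a γ
    refine le_iSup_of_le γ' (le_iSup_of_le ?_ (le_iSup_of_le (z + a) (le_iSup_of_le ?_ ?_)))
    · rw [IsGeodesic, h, hγ, passageTime_shift]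
    · rw [hs]; exact List.mem_map_of_mem hz
    · rw [infEDist_segment_add]
  · refine iSup_le fun γ => iSup_le fun hγ => iSup_le fun z => iSup_le fun hz => ?_
    obtain ⟨γ', h, hs⟩ := exists_walk_unshift w a γ x y rfl rfl
    rw [hs] at hz
    obtain ⟨z, hz', rfl⟩ := List.mem_map.1 hz
    refine le_iSup_of_le γ' (le_iSup_of_le ?_ (le_iSup_of_le z (le_iSup_of_le hz' ?_)))
    · rw [IsGeodesic, ← h, hγ, passageTime_shift]
    · rw [infEDist_segment_add]

/-! ### Existence of geodesics -/

/-- The graph of the edges of weight at most `δ`. -/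
def lowGraph (w : Weights d) (δ : ℝ) : SimpleGraph (Fin d → ℤ) :=
  SimpleGraph.fromEdgeSet {e | ∃ h : e ∈ (lattice d).edgeSet, w ⟨e, h⟩ ≤ δ}

lemma finite_neighbors (x : Fin d → ℤ) : {y | (lattice d).Adj x y}.Finite := by
  obtain ⟨F, hF, _⟩ := exists_finset_ball d (‖toEuc x‖ + 1) (by positivity)
  refine F.finite_toSet.subset fun y hy => hF y ?_
  have h1 := norm_toEuc_sub_le_one_of_adj hy
  have h2 := norm_sub_norm_le (toEuc y) (toEuc x)
  linarith

/-- Induction on `k`: up to its first edge heavier than `δ` the path stays in one finite low-weight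
cluster; that edge uses up more than `δ`, and the rest has time less than `k * δ` and starts at one
of finitely many neighbours. -/
lemma exists_finite_of_pathTime_lt (hw : ∀ e, 0 ≤ w e) {δ : ℝ}
    (hfin : ∀ x, {y | (lowGraph w δ).Reachable x y}.Finite) (k : ℕ) (a : Fin d → ℤ) :
    ∃ F : Set (Fin d → ℤ), F.Finite ∧ ∀ b (γ : (lattice d).Walk a b), pathTime w γ < k * δ →
      ∀ z ∈ γ.support, z ∈ F := by
  induction k generalizing a with
  | zero =>
    refine ⟨∅, Set.finite_empty, fun b γ h => ?_⟩
    have := pathTime_nonneg hw γ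
    simp at h
    linarith
  | succ k ih =>
    choose F hF hF' using ih
    refine ⟨⋃ x ∈ {y | (lowGraph w δ).Reachable a y},
      ({x} ∪ ⋃ u ∈ {u | (lattice d).Adj x u}, F u), ?_, ?_⟩
    · refine (hfin a).biUnion fun x _ => (Set.finite_singleton x).union ?_
      exact (finite_neighbors x).biUnion fun u _ => hF u
    · have key : ∀ x b (γ : (lattice d).Walk x b), (lowGraph w δ).Reachable a x →
          pathTime w γ < (k + 1) * δ → ∀ z ∈ γ.support,
          z ∈ ⋃ x ∈ {y | (lowGraph w δ).Reachable a y},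
            ({x} ∪ ⋃ u ∈ {u | (lattice d).Adj x u}, F u) := by
        intro x b γ
        induction γ with
        | nil =>
          intro hx _ z hz
          simp only [SimpleGraph.Walk.support_nil, List.mem_singleton] at hz
          subst hz
          exact Set.mem_biUnion hx (Or.inl rfl)
        | @cons x u b h p ih' =>
          intro hx ht z hz
          rw [pathTime_cons] at ht
          rw [SimpleGraph.Walk.support_cons, List.mem_cons] at hz
          rcases hz with rfl | hz
          · exact Set.mem_biUnion hx (Or.inl rfl)
          by_cases hδ : w ⟨s(x, u), h⟩ ≤ δ
          · refine ih' (hx.trans (SimpleGraph.Adj.reachable ?_)) ?_ z hz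
            · rw [lowGraph, SimpleGraph.fromEdgeSet_adj]
              exact ⟨⟨h, hδ⟩, h.ne⟩
            · linarith [hw ⟨s(x, u), h⟩]
          · refine Set.mem_biUnion hx (Or.inr (Set.mem_biUnion (x := u) h ?_))
            exact hF' u b p (by linarith) z hz
      intro b γ hγ z hz
      exact key a b γ (SimpleGraph.Reachable.refl _) (by exact_mod_cast hγ) z hz

lemma finite_paths_in {V : Type*} {G : SimpleGraph V} {F : Set V} (hF : F.Finite) (a b : V) :
    {γ : G.Walk a b | γ.IsPath ∧ ∀ z ∈ γ.support, z ∈ F}.Finite := by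
  classical
  have := hF.fintype
  have h1 : (((fun l : List F => l.map Subtype.val)) ''
      {l : List F | l.length ≤ Fintype.card F}).Finite :=
    (List.finite_length_le F _).image _
  refine Set.Finite.of_finite_image (f := fun γ => γ.support) (h1.subset ?_)
    fun _ _ _ _ h => SimpleGraph.Walk.ext_support h
  rintro _ ⟨γ, ⟨hp, hs⟩, rfl⟩
  refine ⟨γ.support.attach.map fun z => ⟨z.1, hs z.1 z.2⟩, ?_, by simp⟩
  refine List.Nodup.length_le_card (List.Nodup.map ?_ (List.nodup_attach.2 hp.support_nodup))
  intro z z' h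
  exact Subtype.ext (congrArg (fun u : F => u.1) h)

/-- Nearly optimal walks stay in a finite set, and removing loops does not increase the time, so the
infimum is a minimum over finitely many self-avoiding paths. -/
lemma exists_isGeodesic (hw : ∀ e, 0 ≤ w e) {δ : ℝ} (hδ : 0 < δ)
    (hfin : ∀ x, {y | (lowGraph w δ).Reachable x y}.Finite) (a b : Fin d → ℤ) :
    ∃ γ : (lattice d).Walk a b, IsGeodesic w γ := by
  classical
  obtain ⟨k, hk⟩ := exists_nat_gt ((passageTime w a b + 1) / δ)
  rw [div_lt_iff₀ hδ] at hk
  obtain ⟨F, hF, hF'⟩ := exists_finite_of_pathTime_lt hw hfin k a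
  have hmem : ∀ γ : (lattice d).Walk a b, pathTime w γ < passageTime w a b + 1 →
      γ.bypass ∈ {γ : (lattice d).Walk a b | γ.IsPath ∧ ∀ z ∈ γ.support, z ∈ F} := fun γ hγ =>
    ⟨γ.bypass_isPath, fun z hz => hF' b γ (hγ.trans hk) z (γ.support_bypass_subset_support hz)⟩
  obtain ⟨γ₁, h₁⟩ := exists_lt_of_ciInf_lt (show passageTime w a b < passageTime w a b + 1 by simp)
  obtain ⟨γ₀, _, hmin⟩ := Set.exists_min_image _ (pathTime w) (finite_paths_in hF a b)
    ⟨_, hmem γ₁ h₁⟩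
  refine ⟨γ₀, le_antisymm (le_ciInf fun γ => ?_) (passageTime_le hw γ₀)⟩
  by_cases h : pathTime w γ < passageTime w a b + 1
  · exact (hmin _ (hmem γ h)).trans (pathTime_bypass_le hw γ)
  · have := (hmin _ (hmem γ₁ h₁)).trans (pathTime_bypass_le hw γ₁)
    linarith

end FPP

/-! ### Subcritical percolation and almost sure existence of geodesics. -/

namespace FPP

variable {d : ℕ}

open unitInterval (toNNReal)

section Percolation

variable {V : Type*}

/-- Walks in the complete graph do not depend on `S`; reachability becomes a countable union of
conditions on finitely many edges, hence measurable. -/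
lemma reachable_fromEdgeSet_iff (S : Set (Sym2 V)) (x y : V) :
    (SimpleGraph.fromEdgeSet S).Reachable x y ↔
      ∃ p : (⊤ : SimpleGraph V).Walk x y, ∀ e ∈ p.edges, e ∈ S := by
  constructor
  · rintro ⟨p⟩
    refine ⟨p.mapLe le_top, fun e he => ?_⟩
    rw [SimpleGraph.Walk.edges_mapLe_eq_edges] at he
    have := p.edges_subset_edgeSet he
    rw [SimpleGraph.edgeSet_fromEdgeSet] at this
    exact this.1
  · rintro ⟨p, hp⟩
    refine ⟨p.transfer _ fun e he => ?_⟩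
    rw [SimpleGraph.edgeSet_fromEdgeSet]
    exact ⟨hp e he, SimpleGraph.not_isDiag_of_mem_edgeSet _ (p.edges_subset_edgeSet he)⟩

lemma measurableSet_infinite_cluster [Countable V] (x : V) :
    MeasurableSet {S : Set (Sym2 V) |
      {y | (SimpleGraph.fromEdgeSet S).Reachable x y}.Infinite} := by
  have h : Measurable fun S : Set (Sym2 V) =>
      {y | (SimpleGraph.fromEdgeSet S).Reachable x y} := by
    refine measurable_set_iff.2 fun y => measurableSet_setOfPred.1 ?_
    simp only [Set.mem_ofPred_eq, reachable_fromEdgeSet_iff, Set.ofPred_exists]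
    refine MeasurableSet.iUnion fun p => ?_
    have : {S : Set (Sym2 V) | ∀ e ∈ p.edges, e ∈ S} = ⋂ e ∈ {e | e ∈ p.edges}, {S | e ∈ S} := by
      ext S; simp
    rw [this]
    exact MeasurableSet.biInter (List.finite_toSet p.edges).countable fun e _ => measurableSet_mem e
  exact h .setOfPred_infinite

lemma infinite_cluster_mono {S S' : Set (Sym2 V)} (h : S ⊆ S') {x : V}
    (hS : {y | (SimpleGraph.fromEdgeSet S).Reachable x y}.Infinite) :
    {y | (SimpleGraph.fromEdgeSet S').Reachable x y}.Infinite :=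
  hS.mono fun _ hy => SimpleGraph.Reachable.mono (SimpleGraph.fromEdgeSet_mono h) hy

/-- Increasing events of probability zero stay of probability zero when `p` decreases. -/
lemma setBernoulli_mul_eq_zero {ι : Type*} (u : Set ι) (p q : I) {A : Set (Set ι)}
    (hA : MeasurableSet A) (hmono : ∀ S S', S ⊆ S' → S ∈ A → S' ∈ A)
    (h0 : setBernoulli u p A = 0) : setBernoulli u (p * q) A = 0 := by
  -- Coupling by thinning: the second coordinate is open with probability `p`, and the first keeps
  -- it with probability `q`, so that the first configuration is contained in the second.
  let c : ι → Measure (Prop × Prop) := fun i =>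
    toNNReal p • (toNNReal q • Measure.dirac (i ∈ u, i ∈ u) +
      toNNReal (σ q) • Measure.dirac (False, i ∈ u)) + toNNReal (σ p) • Measure.dirac (False, False)
  have hm : Measurable fun z : Prop × Prop => z.1 ∧ z.2 := .of_discrete
  have hc1 : ∀ i, (c i).map (fun z => z.1 ∧ z.2) = toNNReal (p * q) • Measure.dirac (i ∈ u) +
      toNNReal (σ (p * q)) • Measure.dirac False := by
    intro i
    have h1 : toNNReal (σ (p * q)) = toNNReal p * toNNReal (σ q) + toNNReal (σ p) := by
      ext; simp; ring
    have h2 : toNNReal (p * q) = toNNReal p * toNNReal q := by ext; simp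
    simp only [c, Measure.map_add _ _ hm, Measure.map_smul,
      Measure.map_dirac' hm, h1, h2, and_self, false_and, smul_add, add_smul, mul_smul, add_assoc]
  have hc2 : ∀ i, (c i).map Prod.snd = toNNReal p • Measure.dirac (i ∈ u) +
      toNNReal (σ p) • Measure.dirac False := by
    intro i
    have h1 : toNNReal q + toNNReal (σ q) = 1 := by ext; simp
    simp only [c, Measure.map_add _ _ measurable_snd, Measure.map_smul,
      Measure.map_dirac' measurable_snd, ← add_smul, h1, one_smul]
  have hA' : MeasurableSet ((fun f : ι → Prop => {i | f i}) ⁻¹' A) := measurable_setOfPred hA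
  rw [setBernoulli_apply'] at h0 ⊢
  have e1 := Measure.infinitePi_map_pi c (f := fun _ z => z.1 ∧ z.2) fun _ => hm
  have e2 := Measure.infinitePi_map_pi c (f := fun _ => Prod.snd) fun _ => measurable_snd
  simp only [hc1, hc2] at e1 e2
  rw [← e2, Measure.map_apply (by fun_prop) hA'] at h0
  have hm' : Measurable fun (x : ι → Prop × Prop) i => (x i).1 ∧ (x i).2 :=
    measurable_pi_iff.2 fun i => hm.comp (measurable_pi_apply i)
  rw [← e1, Measure.map_apply hm' hA']
  exact measure_mono_null (fun z hz => hmono _ _ (fun i hi => hi.2) hz) h0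

end Percolation

lemma percolationProb_eq_zero_of_lt {p : I} (hp : (p : ℝ) < criticalProb d) :
    percolationProb d p = 0 := by
  -- If the set were empty, `sSup` would be `0` by convention and no `p` could lie below it.
  have hne : {p : ℝ | ∃ h : p ∈ I, percolationProb d ⟨p, h⟩ = 0}.Nonempty := by
    by_contra h
    rw [Set.not_nonempty_iff_eq_empty] at h
    rw [criticalProb, h, Real.sSup_empty] at hp
    linarith [p.2.1]
  obtain ⟨p', ⟨h, h0⟩, hlt⟩ := exists_lt_of_lt_csSup hne hp
  have hp' : 0 < p' := p.2.1.trans_lt hlt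
  let q : I := ⟨p / p', div_nonneg p.2.1 hp'.le, (div_le_one hp').2 hlt.le⟩
  have : p = ⟨p', h⟩ * q := by
    ext
    simp only [q, Set.Icc.coe_mul]
    field_simp
  rw [this]
  exact setBernoulli_mul_eq_zero _ _ _ (measurableSet_infinite_cluster 0)
    (fun S S' hS h => infinite_cluster_mono hS h) h0

/-- With `λ` the infimum of the support: if `λ > 0`, half of `λ` works since there is no mass below
`λ`; if `λ = 0`, the mass of `[0, δ]` decreases to that of `{0}`. -/
lemma exists_pos_measure_Iic_lt {μ : Measure ℝ} [IsProbabilityMeasure μ] (h0 : μ (Set.Iio 0) = 0)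
    {c : ℝ≥0∞} (hμ : μ {sInf μ.support} < c) : ∃ δ : ℝ, 0 < δ ∧ μ (Set.Iic δ) < c := by
  have hsupp : μ.support ⊆ Set.Ici 0 := by
    intro x hx
    by_contra hx0
    have := (Measure.mem_support_iff_forall x).1 hx (Set.Iio 0) (Iio_mem_nhds (not_le.1 hx0))
    simp [h0] at this
  have hne : μ.support.Nonempty := by
    by_contra h
    have h1 : μ μ.supportᶜ = 0 := Measure.measure_compl_support
    rw [Set.not_nonempty_iff_eq_empty.1 h] at h1
    simp at h1
  have hl : 0 ≤ sInf μ.support := le_csInf hne fun x hx => hsupp hx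
  rcases hl.eq_or_lt with hl | hl
  · rw [← hl] at hμ
    have ht : Filter.Tendsto (fun n : ℕ => μ (Set.Iic (1 / ((n : ℝ) + 1)))) Filter.atTop
        (nhds (μ (⋂ n : ℕ, Set.Iic (1 / ((n : ℝ) + 1))))) := by
      refine tendsto_measure_iInter_atTop (fun n => measurableSet_Iic.nullMeasurableSet) ?_
        ⟨0, measure_ne_top _ _⟩
      intro m n hmn
      exact Set.Iic_subset_Iic.2 (Nat.one_div_le_one_div hmn)
    have hlt : μ (⋂ n : ℕ, Set.Iic (1 / ((n : ℝ) + 1))) < c := by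
      refine lt_of_le_of_lt ?_ hμ
      calc μ (⋂ n : ℕ, Set.Iic (1 / ((n : ℝ) + 1))) ≤ μ (Set.Iio 0 ∪ {0}) := by
            refine measure_mono fun x hx => ?_
            have hx' : x ≤ 0 := ge_of_tendsto' tendsto_one_div_add_atTop_nhds_zero_nat
              fun n => Set.mem_iInter.1 hx n
            rcases hx'.lt_or_eq with h | h
            · exact Or.inl h
            · exact Or.inr h
        _ ≤ μ (Set.Iio 0) + μ {0} := measure_union_le _ _
        _ = μ {0} := by rw [h0, zero_add]
    obtain ⟨n, hn⟩ := (ht.eventually_lt_const hlt).exists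
    exact ⟨_, by positivity, hn⟩
  · refine ⟨sInf μ.support / 2, by positivity, ?_⟩
    have : μ (Set.Iic (sInf μ.support / 2)) = 0 := by
      refine measure_mono_null (t := μ.supportᶜ) (fun x hx hx' => ?_)
        Measure.measure_compl_support
      have h1 := csInf_le ⟨0, fun y hy => hsupp hy⟩ hx'
      have h2 : x ≤ sInf μ.support / 2 := hx
      linarith
    rw [this]
    exact (zero_le).trans_lt hμ

section Weights

set_option linter.unusedSectionVars false

variable {Ω : Type*} [MeasurableSpace Ω] {P : Measure Ω} [IsProbabilityMeasure P] {μ : Measure ℝ}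
  [IsProbabilityMeasure μ] {t : (lattice d).edgeSet → Ω → ℝ}

lemma IsIIDWeights.map_eq_infinitePi (ht : IsIIDWeights P μ t) :
    P.map (fun ω e => t e ω) = Measure.infinitePi fun _ => μ := by
  rw [ht.indep.map_fun_eq_infinitePi_map ht.measurable]
  congr 1
  funext e
  exact ht.law e

lemma IsIIDWeights.identDistrib_shift (ht : IsIIDWeights P μ t) (a : Fin d → ℤ) :
    IdentDistrib (fun ω e => t (shiftEdge a e) ω) (fun ω e => t e ω) P P where
  aemeasurable_fst := (measurable_pi_iff.2 fun e => ht.measurable _).aemeasurable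
  aemeasurable_snd := (measurable_pi_iff.2 fun e => ht.measurable _).aemeasurable
  map_eq := by
    have h : (fun ω e => t (shiftEdge a e) ω) =
        (fun (w : Weights d) e => w (shiftEdge a e)) ∘ fun ω e => t e ω := rfl
    rw [h, ← Measure.map_map (by fun_prop) (measurable_pi_iff.2 fun e => ht.measurable _),
      ht.map_eq_infinitePi]
    exact Measure.map_infinitePi_infinitePi_of_inj (P := fun _ : (lattice d).edgeSet => μ)
      (shiftEdge a).injective

lemma map_and_le_eq (p : I) {δ : ℝ} (hp : μ (Set.Iic δ) = unitInterval.toNNReal p) (b : Prop) :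
    μ.map (fun s => b ∧ s ≤ δ) = unitInterval.toNNReal p • Measure.dirac b +
      unitInterval.toNNReal (σ p) • Measure.dirac False := by
  have hm : Measurable fun s : ℝ => b ∧ s ≤ δ := by
    refine (measurable_const).and ?_
    exact measurableSet_setOfPred.1 measurableSet_Iic
  have hc : μ (Set.Iic δ)ᶜ = unitInterval.toNNReal (σ p) := by
    rw [prob_compl_eq_one_sub measurableSet_Iic, hp, ← ENNReal.coe_one, ← ENNReal.coe_sub]
    congr 1
    ext
    rw [NNReal.coe_sub (by exact p.2.2)]
    rfl
  have hsum : (unitInterval.toNNReal p : ℝ≥0∞) + unitInterval.toNNReal (σ p) = 1 := by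
    rw [← hp, ← hc, measure_add_measure_compl measurableSet_Iic, measure_univ]
  ext s hs
  rw [Measure.map_apply hm hs]
  simp only [Measure.add_apply, Measure.smul_apply, Measure.dirac_apply' _ hs, Set.indicator,
    Pi.one_apply]
  by_cases hb : b
  · have h1 : (fun x => b ∧ x ≤ δ) ⁻¹' s =
        {x | (x ≤ δ ∧ True ∈ s) ∨ (¬ x ≤ δ ∧ False ∈ s)} := by
      ext x
      by_cases hx : x ≤ δ <;> simp [hx, hb, -not_le]
    have h2 : {x : ℝ | ¬ x ≤ δ} = (Set.Iic δ)ᶜ := rfl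
    have h3 : {x : ℝ | x ≤ δ} = Set.Iic δ := rfl
    rw [h1]
    by_cases hT : True ∈ s <;> by_cases hF : False ∈ s <;>
      simp only [hT, hF, hb, and_true, and_false, or_false, false_or, if_true, if_false, h2, h3,
        hc, hp, ENNReal.smul_def, smul_eq_mul, mul_one, mul_zero, add_zero, zero_add]
    · rw [hsum, show {x : ℝ | x ≤ δ ∨ ¬ x ≤ δ} = Set.univ from Set.eq_univ_of_forall fun x => em _,
        measure_univ]
    · simp
  · have h1 : (fun x => b ∧ x ≤ δ) ⁻¹' s = {x | False ∈ s} := by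
      ext x; simp [hb]
    rw [h1]
    by_cases hF : False ∈ s <;> simp [hF, hb, ENNReal.smul_def, hsum]

/-- The law of the set of edges of small weight is that of Bernoulli percolation. -/
lemma infinitePi_low_eq_setBernoulli (p : I) {δ : ℝ}
    (hp : μ (Set.Iic δ) = unitInterval.toNNReal p) {A : Set (Set (Sym2 (Fin d → ℤ)))}
    (hA : MeasurableSet A) :
    (Measure.infinitePi fun _ : (lattice d).edgeSet => μ)
        {w | {e | ∃ h : e ∈ (lattice d).edgeSet, w ⟨e, h⟩ ≤ δ} ∈ A} =
      setBernoulli (lattice d).edgeSet p A := by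
  have hm1 : Measurable fun w : Weights d =>
      {e | ∃ h : e ∈ (lattice d).edgeSet, w ⟨e, h⟩ ≤ δ} := by
    refine measurable_set_iff.2 fun e => measurableSet_setOfPred.1 ?_
    by_cases h : e ∈ (lattice d).edgeSet
    · have : {w : Weights d | e ∈ {e | ∃ h : e ∈ (lattice d).edgeSet, w ⟨e, h⟩ ≤ δ}} =
          (fun w => w ⟨e, h⟩) ⁻¹' Set.Iic δ := by
        ext w; simp [h]
      rw [this]
      exact (measurable_pi_apply _) measurableSet_Iic
    · simp [h]
  have e1 := Measure.map_infinitePi_infinitePi_of_inj (P := fun _ : Sym2 (Fin d → ℤ) => μ)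
    (f := ((↑) : (lattice d).edgeSet → Sym2 (Fin d → ℤ))) Subtype.val_injective
  have hm : ∀ b : Prop, Measurable fun s : ℝ => b ∧ s ≤ δ := fun b =>
    measurable_const.and (measurableSet_setOfPred.1 measurableSet_Iic)
  have e2 := Measure.infinitePi_map_pi (fun _ : Sym2 (Fin d → ℤ) => μ)
    (f := fun e s => e ∈ (lattice d).edgeSet ∧ s ≤ δ) fun e => hm _
  simp only [map_and_le_eq p hp] at e2
  have hm2 : Measurable fun (w : Sym2 (Fin d → ℤ) → ℝ) e =>
      e ∈ (lattice d).edgeSet ∧ w e ≤ δ :=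
    measurable_pi_iff.2 fun e => (hm _).comp (measurable_pi_apply e)
  rw [setBernoulli_apply', ← e2, Measure.map_apply hm2 (measurable_setOfPred hA), ← e1]
  change Measure.map _ _ (_ ⁻¹' A) = _
  rw [Measure.map_apply (by fun_prop) (hm1 hA)]
  congr 1
  ext w
  simp

lemma finite_cluster_of_shift {w : Weights d} {δ : ℝ} {x : Fin d → ℤ}
    (h : {y | (lowGraph (fun e => w (shiftEdge x e)) δ).Reachable 0 y}.Finite) :
    {y | (lowGraph w δ).Reachable x y}.Finite := by
  let f : lowGraph w δ →g lowGraph (fun e => w (shiftEdge x e)) δ :=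
    { toFun := fun y => y - x
      map_rel' := by
        intro u v huv
        rw [lowGraph, SimpleGraph.fromEdgeSet_adj] at huv ⊢
        obtain ⟨⟨h1, h2⟩, h3⟩ := huv
        have h4 : (lattice d).Adj (u - x) (v - x) :=
          (lattice_adj_add_right x _ _).1 (by simpa using h1)
        refine ⟨⟨h4, ?_⟩, fun h => h3 (sub_left_injective h)⟩
        rw [shiftEdge_mk]
        simpa using h2 }
  refine Set.Finite.of_finite_image (f := fun y => y - x) (h.subset ?_)
    sub_left_injective.injOn
  rintro _ ⟨y, hy, rfl⟩
  have := SimpleGraph.Reachable.map f hy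
  simpa [f] using this

/-- By stationarity it suffices to treat the cluster of the origin, whose law is that of Bernoulli
percolation with parameter `μ (Set.Iic δ)`, below the critical one. -/
lemma IsIIDWeights.ae_finite_cluster (ht : IsIIDWeights P μ t) {δ : ℝ}
    (hδ : μ (Set.Iic δ) < ENNReal.ofReal (criticalProb d)) :
    ∀ᵐ ω ∂P, ∀ x, {y | (lowGraph (fun e => t e ω) δ).Reachable x y}.Finite := by
  rw [ae_all_iff]
  intro x
  let p : I := ⟨(μ (Set.Iic δ)).toReal, ENNReal.toReal_nonneg,
    ENNReal.toReal_le_of_le_ofReal zero_le_one (by simpa using prob_le_one)⟩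
  have hp : μ (Set.Iic δ) = unitInterval.toNNReal p := (ENNReal.coe_toNNReal (measure_ne_top _ _)).symm
  have hp' : (p : ℝ) < criticalProb d := by
    have := (ENNReal.lt_ofReal_iff_toReal_lt (measure_ne_top _ _)).1 hδ
    exact this
  have h0 := percolationProb_eq_zero_of_lt hp'
  have hA := measurableSet_infinite_cluster (0 : Fin d → ℤ)
  rw [percolationProb, ← infinitePi_low_eq_setBernoulli p hp hA, ← ht.map_eq_infinitePi,
    ← (ht.identDistrib_shift x).map_eq] at h0
  have h1 := measure_eq_zero_iff_ae_notMem.1 h0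
  filter_upwards [ae_of_ae_map (measurable_pi_iff.2 fun e => ht.measurable _).aemeasurable h1]
    with ω hω
  refine finite_cluster_of_shift ?_
  simpa [lowGraph] using hω

lemma IsIIDWeights.ae_exists_isGeodesic (ht : IsIIDWeights P μ t)
    (h0 : μ (Set.Iio 0) = 0)
    (hμ : μ {sInf μ.support} < ENNReal.ofReal (criticalProb d)) :
    ∀ᵐ ω ∂P, ∀ a b, ∃ γ : (lattice d).Walk a b, IsGeodesic (fun e => t e ω) γ := by
  obtain ⟨δ, hδ, h⟩ := exists_pos_measure_Iic_lt h0 hμ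
  filter_upwards [ht.ae_finite_cluster h] with ω hω a b
  exact exists_isGeodesic (fun e => ht.nonneg e ω) hδ hω a b

end Weights
end FPP

/-! ### Random passage times: measurability, independence, stationarity, tails and moments. -/

namespace FPP

variable {d : ℕ}

/-! ### Measurability -/

lemma measurable_pathTime {x y : Fin d → ℤ} (γ : (lattice d).Walk x y) :
    Measurable fun w : Weights d => pathTime w γ := by
  induction γ with
  | nil => simp
  | cons h p ih =>
    simp only [pathTime_cons]
    exact (measurable_pi_apply _).add ih

lemma measurable_passageTime (x y : Fin d → ℤ) :
    Measurable fun w : Weights d => passageTime w x y :=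
  Measurable.iInf fun γ => measurable_pathTime γ

lemma measurable_deviation (x y : Fin d → ℤ) :
    Measurable fun w : Weights d => deviation w x y := by
  refine Measurable.iSup fun γ => ?_
  have hS : MeasurableSet {w : Weights d | IsGeodesic w γ} :=
    measurableSet_eq_fun (measurable_pathTime γ) (measurable_passageTime x y)
  have h : (fun w : Weights d => ⨆ (_ : IsGeodesic w γ) (z : Fin d → ℤ) (_ : z ∈ γ.support),
      Metric.infEDist (toEuc z) (segment ℝ (toEuc x) (toEuc y))) =
      {w | IsGeodesic w γ}.indicator fun _ => ⨆ (z : Fin d → ℤ) (_ : z ∈ γ.support),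
        Metric.infEDist (toEuc z) (segment ℝ (toEuc x) (toEuc y)) := by
    funext w
    by_cases hw : IsGeodesic w γ <;> simp [hw]
  rw [h]
  exact measurable_const.indicator hS

/-- The passage time between two points, as a random variable. -/
noncomputable def time {Ω : Type*} (t : (lattice d).edgeSet → Ω → ℝ) (a b : Fin d → ℤ) (ω : Ω) : ℝ :=
  passageTime (fun e => t e ω) a b

/-- The expected passage time from the origin. -/
noncomputable def meanTime {Ω : Type*} [MeasurableSpace Ω] (P : Measure Ω)
    (t : (lattice d).edgeSet → Ω → ℝ) (v : Fin d → ℤ) : ℝ := ∫ ω, tau t v ω ∂P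

section Weights

variable {Ω : Type*} [MeasurableSpace Ω] {P : Measure Ω} {μ : Measure ℝ}
  {t : (lattice d).edgeSet → Ω → ℝ}

lemma IsIIDWeights.measurable_weights (ht : IsIIDWeights P μ t) :
    Measurable fun ω e => t e ω := measurable_pi_iff.2 ht.measurable

lemma IsIIDWeights.measurable_time (ht : IsIIDWeights P μ t) (a b : Fin d → ℤ) :
    Measurable (time t a b) := (measurable_passageTime a b).comp ht.measurable_weights

lemma IsIIDWeights.measurable_dev (ht : IsIIDWeights P μ t) (v : Fin d → ℤ) :
    Measurable (dev t v) := (measurable_deviation 0 v).comp ht.measurable_weights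

lemma IsIIDWeights.time_nonneg (ht : IsIIDWeights P μ t) (a b : Fin d → ℤ) (ω : Ω) :
    0 ≤ time t a b ω := passageTime_nonneg fun e => ht.nonneg e ω

lemma IsIIDWeights.time_triangle (ht : IsIIDWeights P μ t) (a b c : Fin d → ℤ) (ω : Ω) :
    time t a c ω ≤ time t a b ω + time t b c ω :=
  passageTime_triangle (fun e => ht.nonneg e ω) a b c

lemma IsIIDWeights.time_self (ht : IsIIDWeights P μ t) (a : Fin d → ℤ) (ω : Ω) :
    time t a a ω = 0 := passageTime_self fun e => ht.nonneg e ω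

lemma IsIIDWeights.meanTime_zero (ht : IsIIDWeights P μ t) : meanTime P t 0 = 0 := by
  have : tau t 0 = fun _ => (0 : ℝ) := funext fun ω => ht.time_self 0 ω
  simp [meanTime, this]

lemma IsIIDWeights.meanTime_nonneg (ht : IsIIDWeights P μ t) (v : Fin d → ℤ) :
    0 ≤ meanTime P t v := integral_nonneg fun ω => ht.time_nonneg 0 v ω

/-! ### Independence -/

-- Measurability is with respect to the weights of edges with both endpoints in `C`; such families
-- of edges are disjoint for disjoint sets of vertices, which yields independence.
set_option linter.unusedSectionVars false in
lemma measurable_passageTimeIn (C : Set (Fin d → ℤ)) (x y : Fin d → ℤ) :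
    Measurable[⨆ e ∈ {e : (lattice d).edgeSet | ∀ z ∈ e.1, z ∈ C},
      MeasurableSpace.comap (t e) inferInstance]
      fun ω => passageTimeIn C (fun e => t e ω) x y := by
  refine @Measurable.iInf _ _ _ _ _ (_) _ _ _ _ _ _ fun γ => ?_
  obtain ⟨γ, hγ⟩ := γ
  simp only
  induction γ with
  | nil => simp only [pathTime_nil]; exact @measurable_const _ _ _ (_) _
  | @cons u v z h p ih =>
    simp only [pathTime_cons]
    have h1 : ∀ z ∈ p.support, z ∈ C := fun z hz => hγ z (by simp [hz])
    refine @Measurable.add _ _ _ _ _ (_) _ _ ?_ (ih h1)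
    have he : (⟨s(u, v), h⟩ : (lattice d).edgeSet) ∈
        {e : (lattice d).edgeSet | ∀ z ∈ e.1, z ∈ C} := by
      intro z hz
      rcases Sym2.mem_iff.1 hz with rfl | rfl
      · exact hγ _ (by simp)
      · exact h1 _ (by simp)
    exact (comap_measurable (t ⟨s(u, v), h⟩)).mono
      (le_iSup₂_of_le (f := fun e (_ : e ∈ {e : (lattice d).edgeSet | ∀ z ∈ e.1, z ∈ C}) =>
        MeasurableSpace.comap (t e) inferInstance) _ he le_rfl) le_rfl

lemma IsIIDWeights.indepFun_passageTimeIn (ht : IsIIDWeights P μ t) {C C' : Set (Fin d → ℤ)}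
    (hC : Disjoint C C') (x y x' y' : Fin d → ℤ) :
    IndepFun (fun ω => passageTimeIn C (fun e => t e ω) x y)
      (fun ω => passageTimeIn C' (fun e => t e ω) x' y') P := by
  have h := indep_iSup_of_disjoint (fun e => (ht.measurable e).comap_le) ht.indep.iIndep
    (S := {e : (lattice d).edgeSet | ∀ z ∈ e.1, z ∈ C})
    (T := {e : (lattice d).edgeSet | ∀ z ∈ e.1, z ∈ C'}) (by
      rw [Set.disjoint_left]
      rintro ⟨e, he⟩ h1 h2
      induction e with
      | _ x y => exact Set.disjoint_left.1 hC (h1 x (by simp)) (h2 x (by simp)))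
  rw [IndepFun_iff_Indep]
  exact indep_of_indep_of_le_left (indep_of_indep_of_le_right h
    (measurable_passageTimeIn C' x' y').comap_le) (measurable_passageTimeIn C x y).comap_le

lemma IsIIDWeights.measurable_timeIn (ht : IsIIDWeights P μ t) (C : Set (Fin d → ℤ))
    (x y : Fin d → ℤ) : Measurable fun ω => passageTimeIn C (fun e => t e ω) x y :=
  (measurable_passageTimeIn C x y).mono
    (iSup₂_le fun e _ => (ht.measurable e).comap_le) le_rfl

/-! ### Stationarity -/

variable [IsProbabilityMeasure P] [IsProbabilityMeasure μ]

lemma IsIIDWeights.identDistrib_time (ht : IsIIDWeights P μ t) (a b : Fin d → ℤ) :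
    IdentDistrib (time t a b) (tau t (b - a)) P P := by
  have h := (ht.identDistrib_shift a).comp (measurable_passageTime 0 (b - a))
  convert h using 1
  · funext ω
    simp [time, Function.comp, passageTime_shift (fun e => t e ω)]
  · rfl

lemma IsIIDWeights.identDistrib_deviation (ht : IsIIDWeights P μ t) (a b : Fin d → ℤ) :
    IdentDistrib (fun ω => deviation (fun e => t e ω) a b) (dev t (b - a)) P P := by
  have h := (ht.identDistrib_shift a).comp (measurable_deviation 0 (b - a))
  convert h using 1
  · funext ω
    simp [Function.comp, deviation_shift (fun e => t e ω)]
  · rfl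

end Weights

/-! ### Markov inequalities -/

lemma exists_exp_neg_le (α ε : ℝ) (hα : 0 < α) (hε : 0 < ε) (K : ℝ) :
    ∃ C : ℝ, 0 < C ∧ ∀ M : ℝ, 1 ≤ M → Real.exp (-(α * M ^ ε)) ≤ C * M ^ (-K) := by
  obtain ⟨n, hn⟩ := exists_nat_gt (K / ε)
  rw [div_lt_iff₀ hε] at hn
  refine ⟨n.factorial / α ^ n, by positivity, fun M hM => ?_⟩
  have hM0 : 0 < M := by linarith
  have h1 := Real.pow_div_factorial_le_exp (α * M ^ ε) (by positivity) n
  have h2 : M ^ K ≤ (M ^ ε) ^ n := by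
    rw [← Real.rpow_natCast, ← Real.rpow_mul hM0.le]
    exact Real.rpow_le_rpow_of_exponent_le hM (by linarith)
  rw [Real.exp_neg, Real.rpow_neg hM0.le, ← div_eq_mul_inv, div_div, inv_eq_one_div,
    div_le_div_iff₀ (Real.exp_pos _) (by positivity), one_mul]
  rw [div_le_iff₀ (by positivity), mul_pow] at h1
  calc α ^ n * M ^ K ≤ α ^ n * (M ^ ε) ^ n := by gcongr
    _ ≤ _ := by rw [mul_comm (n.factorial : ℝ)]; exact h1

lemma measureReal_le_of_lintegral_le {Ω : Type*} [MeasurableSpace Ω] {P : Measure Ω}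
    {F : Ω → ℝ≥0∞} (hF : Measurable F) {B : ℝ≥0∞} (hB : B ≠ ∞) (hFB : ∫⁻ ω, F ω ∂P ≤ B) {s : ℝ}
    {S : Set Ω} (hS : ∀ ω ∈ S, ENNReal.ofReal (Real.exp s) ≤ F ω) :
    P.real S ≤ B.toReal * Real.exp (-s) := by
  have h1 : ENNReal.ofReal (Real.exp s) * P S ≤ B :=
    le_trans (by gcongr; exact hS) ((mul_meas_ge_le_lintegral hF _).trans hFB)
  have h2 := ENNReal.toReal_mono hB h1
  rw [ENNReal.toReal_mul, ENNReal.toReal_ofReal (Real.exp_pos _).le] at h2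
  rw [Real.exp_neg, ← div_eq_mul_inv, le_div_iff₀ (Real.exp_pos _), mul_comm]
  exact h2

section Exponents

set_option linter.unusedSectionVars false

variable {Ω : Type*} [MeasurableSpace Ω] {P : Measure Ω} {μ : Measure ℝ}
  {t : (lattice d).edgeSet → Ω → ℝ} {χa χb ξa ξb : ℝ}

/-- The two exponential bounds share one `α`; whoever needs only one of them may take any admissible
exponent for the other, such as `ξa + 1` or `χa + 1`. -/
lemma HasGlobalExponents.exists_exp_bound (hexp : HasGlobalExponents P t χa χb ξa ξb)
    {χ' ξ' : ℝ} (hχ : χa < χ') (hξ : ξa < ξ') :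
    ∃ α : ℝ, 0 < α ∧ ∃ B : ℝ≥0∞, B ≠ ∞ ∧ ∀ v : Fin d → ℤ, v ≠ 0 →
      ∫⁻ ω, ENNReal.ofReal (Real.exp (α * (|tau t v ω - meanTime P t v| / ‖toEuc v‖ ^ χ'))) ∂P ≤ B ∧
      ∫⁻ ω, EReal.exp ((ENNReal.ofReal α * (dev t v ω / ENNReal.ofReal (‖toEuc v‖ ^ ξ')) : ℝ≥0∞)
        : EReal) ∂P ≤ B := by
  obtain ⟨α, hα, h1, h2⟩ := hexp.above χ' hχ ξ' hξ
  refine ⟨α, hα, max _ _, (max_lt h1 h2).ne, fun v hv => ⟨le_max_of_le_left ?_, le_max_of_le_right ?_⟩⟩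
  · exact le_iSup (fun v : {v : Fin d → ℤ // v ≠ 0} => ∫⁻ ω, ENNReal.ofReal
        (Real.exp (α * (|tau t v ω - ∫ ω', tau t v ω' ∂P| / ‖toEuc v.1‖ ^ χ'))) ∂P) ⟨v, hv⟩
  · exact le_iSup (fun v : {v : Fin d → ℤ // v ≠ 0} => ∫⁻ ω, EReal.exp
        ((ENNReal.ofReal α * (dev t v ω / ENNReal.ofReal (‖toEuc v.1‖ ^ ξ')) : ℝ≥0∞) : EReal)
          ∂P) ⟨v, hv⟩

variable [IsProbabilityMeasure P] [IsProbabilityMeasure μ]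

/-- The slack between `χ'` and an intermediate `χ₁` turns the exponential moment into a bound `exp
(-α M ^ (χ' - χ₁))`, smaller than any power of `M`. The scale `M` may exceed the distance, which
gives uniformity over all pairs at distance at most `M`. -/
lemma HasGlobalExponents.time_tail (hexp : HasGlobalExponents P t χa χb ξa ξb)
    (ht : IsIIDWeights P μ t) {χ' : ℝ} (h0 : 0 < χa) (hχ : χa < χ') (K : ℝ) :
    ∃ C : ℝ, 0 < C ∧ ∀ M : ℝ, 1 ≤ M → ∀ a b : Fin d → ℤ, ‖toEuc (b - a)‖ ≤ M →
      P.real {ω | M ^ χ' ≤ |time t a b ω - meanTime P t (b - a)|} ≤ C * M ^ (-K) := by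
  obtain ⟨χ₁, h1, h2⟩ := exists_between hχ
  obtain ⟨α, hα, B, hB, hb⟩ := hexp.exists_exp_bound h1 (lt_add_one ξa)
  obtain ⟨C, hC, hC'⟩ := exists_exp_neg_le α (χ' - χ₁) hα (sub_pos.2 h2) K
  refine ⟨(B.toReal + 1) * C, by positivity, fun M hM a b hab => ?_⟩
  have hM0 : 0 < M := by linarith
  have hid := ((ht.identDistrib_time a b).comp (u := fun s => |s - meanTime P t (b - a)|)
    (by fun_prop)).measure_mem_eq (measurableSet_Ici (a := M ^ χ'))
  have hid' : P.real {ω | M ^ χ' ≤ |time t a b ω - meanTime P t (b - a)|} =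
      P.real {ω | M ^ χ' ≤ |tau t (b - a) ω - meanTime P t (b - a)|} :=
    congrArg ENNReal.toReal hid
  rw [hid']
  by_cases hv : b - a = 0
  · have : {ω | M ^ χ' ≤ |tau t (b - a) ω - meanTime P t (b - a)|} = ∅ := by
      rw [hv, Set.eq_empty_iff_forall_notMem]
      intro ω hω
      have e : tau t 0 ω = 0 := ht.time_self 0 ω
      simp only [e, ht.meanTime_zero, sub_self, abs_zero, Set.mem_ofPred_eq] at hω
      linarith [Real.rpow_pos_of_pos hM0 χ']
    rw [this]
    simp only [measureReal_empty]
    positivity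
  have hv1 := one_le_norm_toEuc hv
  have hm := ht.measurable_time 0 (b - a)
  have h3 := measureReal_le_of_lintegral_le
    (F := fun ω => ENNReal.ofReal (Real.exp (α * (|tau t (b - a) ω - meanTime P t (b - a)| /
      ‖toEuc (b - a)‖ ^ χ₁))))
    (by
      have : Measurable (tau t (b - a)) := hm
      fun_prop) hB (hb _ hv).1
    (s := α * M ^ (χ' - χ₁))
    (S := {ω | M ^ χ' ≤ |tau t (b - a) ω - meanTime P t (b - a)|}) (by
      intro ω hω
      apply ENNReal.ofReal_le_ofReal
      apply Real.exp_le_exp.2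
      gcongr
      rw [Real.rpow_sub hM0]
      apply div_le_div₀ (abs_nonneg _) hω (by positivity)
      exact Real.rpow_le_rpow (by positivity) hab (by linarith))
  calc _ ≤ _ := h3
    _ ≤ (B.toReal + 1) * (C * M ^ (-K)) := by
        gcongr
        · linarith
        · exact hC' M hM
    _ = _ := by ring

lemma HasGlobalExponents.deviation_tail (hexp : HasGlobalExponents P t χa χb ξa ξb)
    (ht : IsIIDWeights P μ t) {ξ' : ℝ} (h0 : 0 < ξ') (hξ : ξa < ξ') (K : ℝ) :
    ∃ C : ℝ, 0 < C ∧ ∀ M : ℝ, 1 ≤ M → ∀ a b : Fin d → ℤ, ‖toEuc (b - a)‖ ≤ M → a ≠ b →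
      P.real {ω | ENNReal.ofReal (M ^ ξ') ≤ deviation (fun e => t e ω) a b} ≤ C * M ^ (-K) := by
  -- The intermediate exponent is also taken positive, so that `‖toEuc (b - a)‖ ^ ξ₁ ≤ M ^ ξ₁`.
  obtain ⟨ξ₁, h1, h2⟩ := exists_between (max_lt h0 hξ)
  rw [max_lt_iff] at h1
  obtain ⟨α, hα, B, hB, hb⟩ := hexp.exists_exp_bound (lt_add_one χa) h1.2
  obtain ⟨C, hC, hC'⟩ := exists_exp_neg_le α (ξ' - ξ₁) hα (sub_pos.2 h2) K
  refine ⟨(B.toReal + 1) * C, by positivity, fun M hM a b hab hne => ?_⟩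
  have hM0 : 0 < M := by linarith
  have hid := (ht.identDistrib_deviation a b).measure_mem_eq
    (measurableSet_Ici (a := ENNReal.ofReal (M ^ ξ')))
  have hid' : P.real {ω | ENNReal.ofReal (M ^ ξ') ≤ deviation (fun e => t e ω) a b} =
      P.real {ω | ENNReal.ofReal (M ^ ξ') ≤ dev t (b - a) ω} := congrArg ENNReal.toReal hid
  rw [hid']
  have hv : b - a ≠ 0 := sub_ne_zero.2 hne.symm
  have hv1 := one_le_norm_toEuc hv
  have hm := ht.measurable_dev (b - a)
  have h3 := measureReal_le_of_lintegral_le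
    (F := fun ω => EReal.exp ((ENNReal.ofReal α * (dev t (b - a) ω /
      ENNReal.ofReal (‖toEuc (b - a)‖ ^ ξ₁)) : ℝ≥0∞) : EReal))
    (by
      refine EReal.exp_monotone.measurable.comp (measurable_coe_ennreal_ereal.comp ?_)
      exact (hm.div_const _).const_mul _) hB (hb _ hv).2
    (s := α * M ^ (ξ' - ξ₁))
    (S := {ω | ENNReal.ofReal (M ^ ξ') ≤ dev t (b - a) ω}) (by
      intro ω hω
      rw [← EReal.exp_coe]
      apply EReal.exp_monotone
      have e1 : ((α * M ^ (ξ' - ξ₁) : ℝ) : EReal) =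
          ((ENNReal.ofReal (α * M ^ (ξ' - ξ₁)) : ℝ≥0∞) : EReal) := by
        rw [EReal.coe_ennreal_ofReal, max_eq_left (by positivity)]
      rw [e1, EReal.coe_ennreal_le_coe_ennreal_iff, ENNReal.ofReal_mul hα.le]
      gcongr
      rw [Real.rpow_sub hM0, ENNReal.ofReal_div_of_pos (by positivity)]
      exact ENNReal.div_le_div hω (ENNReal.ofReal_le_ofReal
        (Real.rpow_le_rpow (by positivity) hab h1.1.le)))
  calc _ ≤ _ := h3
    _ ≤ (B.toReal + 1) * (C * M ^ (-K)) := by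
        gcongr
        · linarith
        · exact hC' M hM
    _ = _ := by ring

lemma HasGlobalExponents.fourth_moment (hexp : HasGlobalExponents P t χa χb ξa ξb)
    (ht : IsIIDWeights P μ t) {χ' : ℝ} (hχ : χa < χ') :
    ∃ C : ℝ, 0 < C ∧ ∀ v : Fin d → ℤ, v ≠ 0 →
      Integrable (fun ω => (tau t v ω - meanTime P t v) ^ 4) P ∧
      ∫ ω, (tau t v ω - meanTime P t v) ^ 4 ∂P ≤ C * ‖toEuc v‖ ^ (4 * χ') := by
  obtain ⟨α, hα, B, hB, hb⟩ := hexp.exists_exp_bound hχ (lt_add_one ξa)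
  refine ⟨24 / α ^ 4 * (B.toReal + 1), by positivity, fun v hv => ?_⟩
  have hv1 := one_le_norm_toEuc hv
  have hv0 : 0 < ‖toEuc v‖ := by linarith
  have hm : Measurable (tau t v) := ht.measurable_time 0 v
  have hpt : ∀ ω, ENNReal.ofReal ((tau t v ω - meanTime P t v) ^ 4) ≤
      ENNReal.ofReal (24 / α ^ 4 * ‖toEuc v‖ ^ (4 * χ')) * ENNReal.ofReal
        (Real.exp (α * (|tau t v ω - meanTime P t v| / ‖toEuc v‖ ^ χ'))) := by
    intro ω
    rw [← ENNReal.ofReal_mul (by positivity)]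
    apply ENNReal.ofReal_le_ofReal
    have h1 := Real.pow_div_factorial_le_exp
      (α * (|tau t v ω - meanTime P t v| / ‖toEuc v‖ ^ χ')) (by positivity) 4
    have h2 : ‖toEuc v‖ ^ (4 * χ') = (‖toEuc v‖ ^ χ') ^ 4 := by
      rw [← Real.rpow_natCast, ← Real.rpow_mul hv0.le]
      congr 1; push_cast; ring
    have h3 : 0 < ‖toEuc v‖ ^ χ' := Real.rpow_pos_of_pos hv0 _
    have h4 : |tau t v ω - meanTime P t v| ^ 4 = (tau t v ω - meanTime P t v) ^ 4 :=
      Even.pow_abs (by decide) _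
    rw [h2]
    calc (tau t v ω - meanTime P t v) ^ 4 = 24 / α ^ 4 * (‖toEuc v‖ ^ χ') ^ 4 *
          ((α * (|tau t v ω - meanTime P t v| / ‖toEuc v‖ ^ χ')) ^ 4 / Nat.factorial 4) := by
            rw [← h4]
            simp only [Nat.factorial]
            push_cast
            field_simp
      _ ≤ _ := by gcongr
  have hle : ∫⁻ ω, ENNReal.ofReal ((tau t v ω - meanTime P t v) ^ 4) ∂P ≤
      ENNReal.ofReal (24 / α ^ 4 * ‖toEuc v‖ ^ (4 * χ')) * B := by
    refine (lintegral_mono hpt).trans ?_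
    rw [lintegral_const_mul _ (by fun_prop)]
    gcongr
    exact (hb v hv).1
  have hfin : ENNReal.ofReal (24 / α ^ 4 * ‖toEuc v‖ ^ (4 * χ')) * B ≠ ∞ :=
    ENNReal.mul_ne_top ENNReal.ofReal_ne_top hB
  have hnn : ∀ ω, 0 ≤ (tau t v ω - meanTime P t v) ^ 4 := fun ω => by positivity
  refine ⟨⟨by fun_prop, ?_⟩, ?_⟩
  · rw [hasFiniteIntegral_iff_ofReal (Filter.Eventually.of_forall hnn)]
    exact hle.trans_lt hfin.lt_top
  · rw [integral_eq_lintegral_of_nonneg_ae (Filter.Eventually.of_forall hnn) (by fun_prop)]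
    refine (ENNReal.toReal_mono hfin hle).trans ?_
    rw [ENNReal.toReal_mul, ENNReal.toReal_ofReal (by positivity)]
    calc 24 / α ^ 4 * ‖toEuc v‖ ^ (4 * χ') * B.toReal
        ≤ 24 / α ^ 4 * ‖toEuc v‖ ^ (4 * χ') * (B.toReal + 1) := by gcongr; linarith
      _ = _ := by ring

/-- `meanTime` is a Bochner integral, a priori possibly the default value `0`; an exponential moment
around any constant already gives square integrability, so it is a true mean. -/
lemma HasGlobalExponents.memLp_tau (hexp : HasGlobalExponents P t χa χb ξa ξb)
    (ht : IsIIDWeights P μ t) (v : Fin d → ℤ) : MemLp (tau t v) 2 P := by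
  have hm : Measurable (tau t v) := ht.measurable_time 0 v
  by_cases hv : v = 0
  · have : tau t 0 = fun _ => (0 : ℝ) := funext fun ω => ht.time_self 0 ω
    rw [hv, this]
    exact memLp_const 0
  obtain ⟨C, hC, h⟩ := hexp.fourth_moment ht (lt_add_one χa)
  have h1 : MemLp (fun ω => tau t v ω - meanTime P t v) 2 P := by
    rw [memLp_two_iff_integrable_sq (by fun_prop)]
    refine ((h v hv).1.add (integrable_const (1 : ℝ))).mono' (by fun_prop) ?_
    refine Filter.Eventually.of_forall fun ω => ?_
    rw [Real.norm_of_nonneg (by positivity), Pi.add_apply]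
    nlinarith [sq_nonneg ((tau t v ω - meanTime P t v) ^ 2 - 1)]
  have h2 := h1.add (memLp_const (meanTime P t v))
  convert h2 using 1
  funext ω
  simp

lemma HasGlobalExponents.memLp_time (hexp : HasGlobalExponents P t χa χb ξa ξb)
    (ht : IsIIDWeights P μ t) (a b : Fin d → ℤ) : MemLp (time t a b) 2 P :=
  (ht.identDistrib_time a b).memLp_iff.2 (hexp.memLp_tau ht _)

lemma HasGlobalExponents.meanTime_add_le (hexp : HasGlobalExponents P t χa χb ξa ξb)
    (ht : IsIIDWeights P μ t) (x y : Fin d → ℤ) :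
    meanTime P t (x + y) ≤ meanTime P t x + meanTime P t y := by
  have i1 := (hexp.memLp_time ht 0 x).integrable (by norm_num)
  have i2 := (hexp.memLp_time ht x (x + y)).integrable (by norm_num)
  have e : ∫ ω, time t x (x + y) ω ∂P = meanTime P t y := by
    rw [(ht.identDistrib_time x (x + y)).integral_eq, add_sub_cancel_left]; rfl
  rw [← e, meanTime, meanTime]
  change _ ≤ ∫ ω, time t 0 x ω ∂P + _
  rw [← integral_add i1 i2]
  exact integral_mono ((hexp.memLp_time ht 0 (x + y)).integrable (by norm_num)) (i1.add i2)
    fun ω => ht.time_triangle _ _ _ ω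

/-- Triangle inequality, stationarity and Minkowski: the `L²` norm is subadditive in the endpoint,
hence grows at most linearly. -/
lemma HasGlobalExponents.eLpNorm_tau_add_le (hexp : HasGlobalExponents P t χa χb ξa ξb)
    (ht : IsIIDWeights P μ t) (x y : Fin d → ℤ) :
    (eLpNorm (tau t (x + y)) 2 P).toReal ≤
      (eLpNorm (tau t x) 2 P).toReal + (eLpNorm (tau t y) 2 P).toReal := by
  have i1 := hexp.memLp_time ht 0 x
  have i2 := hexp.memLp_time ht x (x + y)
  have e : eLpNorm (time t x (x + y)) 2 P = eLpNorm (tau t y) 2 P := by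
    rw [(ht.identDistrib_time x (x + y)).eLpNorm_eq, add_sub_cancel_left]
  have f1 := (hexp.memLp_tau ht x).eLpNorm_ne_top
  have f2 := (hexp.memLp_tau ht y).eLpNorm_ne_top
  rw [← ENNReal.toReal_add f1 f2]
  refine ENNReal.toReal_mono (ENNReal.add_ne_top.2 ⟨f1, f2⟩) ?_
  rw [← e]
  refine le_trans (eLpNorm_mono_real (g := time t 0 x + time t x (x + y)) fun ω => ?_)
    (eLpNorm_add_le i1.1 i2.1 (by norm_num))
  change ‖time t 0 (x + y) ω‖ ≤ _
  rw [Real.norm_of_nonneg (ht.time_nonneg _ _ _)]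
  exact ht.time_triangle _ _ _ ω

end Exponents

/-- Subadditive functions grow at most linearly. -/
lemma exists_le_mul_norm_of_subadditive {f : (Fin d → ℤ) → ℝ} (h0 : f 0 = 0) (hf : ∀ x, 0 ≤ f x)
    (hadd : ∀ x y, f (x + y) ≤ f x + f y) : ∃ C : ℝ, 0 ≤ C ∧ ∀ x, f x ≤ C * ‖toEuc x‖ := by
  set K : ℝ := ∑ i, (f (Pi.single i 1) + f (Pi.single i (-1))) with hK
  have hKi : ∀ i, f (Pi.single i 1) + f (Pi.single i (-1)) ≤ K := fun i =>
    Finset.single_le_sum (f := fun i => f (Pi.single i 1) + f (Pi.single i (-1)))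
      (fun j _ => add_nonneg (hf _) (hf _)) (Finset.mem_univ i)
  have hK0 : 0 ≤ K := Finset.sum_nonneg fun j _ => add_nonneg (hf _) (hf _)
  have hsingle : ∀ (i : Fin d) (c : ℤ), f (Pi.single i c) ≤ K * |(c : ℝ)| := by
    intro i c
    have hn : ∀ (s : ℤ), |s| = 1 → ∀ n : ℕ, f (Pi.single i (n * s)) ≤ K * n := by
      intro s hs n
      induction n with
      | zero => simp [h0]
      | succ n ih =>
        have e : (Pi.single i (((n + 1 : ℕ) : ℤ) * s) : Fin d → ℤ) =
            Pi.single i (n * s) + Pi.single i s := by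
          rw [← Pi.single_add]; congr 1; push_cast; ring
        rw [e]
        have h1 : f (Pi.single i s) ≤ K := by
          have := hKi i
          rcases abs_eq (zero_le_one) |>.1 hs with rfl | rfl
          · linarith [hf (Pi.single i (-1))]
          · linarith [hf (Pi.single i 1)]
        push_cast
        linarith [hadd (Pi.single i (n * s)) (Pi.single i s)]
    rcases Int.natAbs_eq c with h | h
    · have := hn 1 (by simp) c.natAbs
      rw [mul_one, ← h] at this
      rwa [Nat.cast_natAbs, Int.cast_abs] at this
    · have := hn (-1) (by simp) c.natAbs
      rw [mul_neg_one, ← h] at this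
      rwa [Nat.cast_natAbs, Int.cast_abs] at this
  refine ⟨K * d, by positivity, fun x => ?_⟩
  have hsum : ∀ s : Finset (Fin d), f (∑ i ∈ s, Pi.single i (x i)) ≤ ∑ i ∈ s, K * |(x i : ℝ)| := by
    intro s
    induction s using Finset.induction_on with
    | empty => simp [h0]
    | insert a s ha ih =>
      rw [Finset.sum_insert ha, Finset.sum_insert ha]
      linarith [hadd (Pi.single a (x a)) (∑ i ∈ s, Pi.single i (x i)), hsingle a (x a)]
  have h1 := hsum Finset.univ
  rw [Finset.univ_sum_single, ← Finset.mul_sum] at h1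
  calc f x ≤ K * ∑ i, |(x i : ℝ)| := h1
    _ ≤ K * (d * ‖toEuc x‖) := by gcongr; exact sum_abs_le_mul_norm_toEuc x
    _ = _ := by ring

/-! ### Lower bound on the variance and its consequence for the exponent. -/

section Exponents

variable {Ω : Type*} [MeasurableSpace Ω] {P : Measure Ω} {μ : Measure ℝ}
  {t : (lattice d).edgeSet → Ω → ℝ} {χa χb ξa ξb : ℝ}
variable [IsProbabilityMeasure P] [IsProbabilityMeasure μ]

lemma HasGlobalExponents.variance_lower (hexp : HasGlobalExponents P t χa χb ξa ξb)
    (ht : IsIIDWeights P μ t) {χ' : ℝ} (hχ : χ' < χb) :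
    ∃ c : ℝ, 0 < c ∧ ∀ v : Fin d → ℤ, v ≠ 0 →
      c * ‖toEuc v‖ ^ (2 * χ') ≤ variance (tau t v) P := by
  -- Only the variance bound is used; `ξb - 1` is an arbitrary exponent below `ξb`.
  have h := (hexp.below χ' hχ (ξb - 1) (sub_one_lt _)).1
  obtain ⟨c, hc, hc'⟩ := ENNReal.lt_iff_exists_nnreal_btwn.1 h
  refine ⟨c, by simpa using hc, fun v hv => ?_⟩
  have h1 := hc'.le.trans (iInf_le (fun v : {v : Fin d → ℤ // v ≠ 0} =>
        evariance (tau t v) P / ENNReal.ofReal (‖toEuc v.1‖ ^ (2 * χ'))) ⟨v, hv⟩)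
  have hv0 : 0 < ‖toEuc v‖ := by linarith [one_le_norm_toEuc hv]
  simp only at h1
  rw [ENNReal.le_div_iff_mul_le (Or.inl (by simpa using Real.rpow_pos_of_pos hv0 _))
    (Or.inl ENNReal.ofReal_ne_top), ← ofReal_variance (hexp.memLp_tau ht v),
    ← ENNReal.ofReal_coe_nnreal, ← ENNReal.ofReal_mul (by positivity)] at h1
  exact (ENNReal.ofReal_le_ofReal_iff (variance_nonneg _ _)).1 h1

/-- Along a coordinate axis the variance is at most the squared `L²` norm, of order `n ^ 2`, which
excludes a lower bound `n ^ (2 * χ')` with `χ' > 1`. -/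
lemma HasGlobalExponents.below_le_one (hexp : HasGlobalExponents P t χa χb ξa ξb)
    (ht : IsIIDWeights P μ t) (hd : 0 < d) : χb ≤ 1 := by
  by_contra! hχ
  obtain ⟨χ', h1, h2⟩ := exists_between hχ
  obtain ⟨c, hc, hv⟩ := hexp.variance_lower ht h2
  have h0 : (eLpNorm (tau t 0) 2 P).toReal = 0 := by
    have : tau t 0 = fun _ => (0 : ℝ) := funext fun ω => ht.time_self 0 ω
    rw [this]
    simp
  obtain ⟨C, hC, hle⟩ := exists_le_mul_norm_of_subadditive
    (f := fun v => (eLpNorm (tau t v) 2 P).toReal) h0 (fun _ => ENNReal.toReal_nonneg)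
    (hexp.eLpNorm_tau_add_le ht)
  have key : ∀ n : ℕ, 1 ≤ n → c * (n : ℝ) ^ (2 * χ') ≤ C ^ 2 * (n : ℝ) ^ (2 : ℝ) := by
    intro n hn
    have hne : (Pi.single ⟨0, hd⟩ (n : ℤ) : Fin d → ℤ) ≠ 0 := by
      intro h
      have := congrFun h ⟨0, hd⟩
      simp at this
      omega
    have hnorm : ‖toEuc (Pi.single ⟨0, hd⟩ (n : ℤ) : Fin d → ℤ)‖ = n := by
      have : toEuc (Pi.single ⟨0, hd⟩ (n : ℤ) : Fin d → ℤ) =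
          EuclideanSpace.single ⟨0, hd⟩ (n : ℝ) := by
        ext i
        by_cases hi : i = ⟨0, hd⟩
        · subst hi; simp
        · simp [hi]
      rw [this]; simp
    set v : Fin d → ℤ := Pi.single ⟨0, hd⟩ (n : ℤ)
    have h3 := hv v hne
    have h4 := hle v
    rw [hnorm] at h3 h4
    have h5 : variance (tau t v) P ≤ ((eLpNorm (tau t v) 2 P).toReal) ^ 2 := by
      refine (variance_le_expectation_sq (hexp.memLp_tau ht v).1).trans (le_of_eq ?_)
      rw [(hexp.memLp_tau ht v).eLpNorm_eq_integral_rpow_norm (by norm_num) (by norm_num)]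
      have hnn : 0 ≤ ∫ ω, (tau t v ^ 2) ω ∂P := integral_nonneg fun ω => by
        simp only [Pi.pow_apply]; positivity
      rw [ENNReal.toReal_ofReal (by positivity)]
      simp only [ENNReal.toReal_ofNat, Real.norm_eq_abs, Real.rpow_ofNat, sq_abs, Pi.pow_apply]
        at hnn ⊢
      rw [← Real.rpow_natCast, ← Real.rpow_mul hnn]
      norm_num
    have h6 : ((eLpNorm (tau t v) 2 P).toReal) ^ 2 ≤ (C * n) ^ 2 := by
      gcongr
    rw [mul_pow] at h6
    rw [Real.rpow_ofNat]
    linarith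
  have ht' : Filter.Tendsto (fun n : ℕ => (n : ℝ) ^ (2 * χ' - 2)) Filter.atTop Filter.atTop :=
    (tendsto_rpow_atTop (by linarith)).comp tendsto_natCast_atTop_atTop
  obtain ⟨n, hn, hn1⟩ := ((ht'.eventually_gt_atTop (C ^ 2 / c)).and
    (Filter.eventually_ge_atTop 1)).exists
  have hn0 : (0 : ℝ) < n := by exact_mod_cast hn1
  rw [Real.rpow_sub hn0, div_lt_div_iff₀ hc (by positivity)] at hn
  linarith [key n hn1]

end Exponents
end FPP

namespace FPP

variable {d : ℕ}

/-! ### Subadditive functions on the lattice -/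

/-- The homogeneous limit `lim h (n x) / n` of a subadditive function `h` on the lattice. -/
noncomputable def asymp (h : (Fin d → ℤ) → ℝ) (x : Fin d → ℤ) : ℝ :=
  sInf ((fun n : ℕ => h (n • x) / n) '' Set.Ici 1)

section Subadditive

variable {h : (Fin d → ℤ) → ℝ}

lemma tendsto_asymp (hnn : ∀ x, 0 ≤ h x) (hadd : ∀ x y, h (x + y) ≤ h x + h y) (x : Fin d → ℤ) :
    Filter.Tendsto (fun n : ℕ => h (n • x) / n) Filter.atTop (nhds (asymp h x)) := by
  have hs : Subadditive fun n : ℕ => h (n • x) := fun m n => by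
    simpa [add_smul] using hadd (m • x) (n • x)
  have := hs.tendsto_lim ⟨0, by rintro _ ⟨n, rfl⟩; exact div_nonneg (hnn _) (Nat.cast_nonneg _)⟩
  rwa [Subadditive.lim] at this

lemma asymp_nonneg (hnn : ∀ x, 0 ≤ h x) (hadd : ∀ x y, h (x + y) ≤ h x + h y) (x : Fin d → ℤ) :
    0 ≤ asymp h x :=
  ge_of_tendsto' (tendsto_asymp hnn hadd x) fun _ => div_nonneg (hnn _) (Nat.cast_nonneg _)

lemma asymp_le (hnn : ∀ x, 0 ≤ h x) (x : Fin d → ℤ) : asymp h x ≤ h x := by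
  refine csInf_le ⟨0, ?_⟩ ⟨1, by simp, by simp⟩
  rintro _ ⟨n, _, rfl⟩
  exact div_nonneg (hnn _) (Nat.cast_nonneg _)

lemma asymp_add_le (hnn : ∀ x, 0 ≤ h x) (hadd : ∀ x y, h (x + y) ≤ h x + h y)
    (x y : Fin d → ℤ) : asymp h (x + y) ≤ asymp h x + asymp h y := by
  refine le_of_tendsto_of_tendsto' (tendsto_asymp hnn hadd (x + y))
    ((tendsto_asymp hnn hadd x).add (tendsto_asymp hnn hadd y)) fun n => ?_
  rw [← add_div, smul_add]
  gcongr
  exact hadd _ _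

/-- Substitute for real homogeneity and Lipschitz continuity of the limit norm, which is only
defined on lattice points: compare `n • u` with `⌊f * n⌋₊ • y` and let `n` tend to infinity. -/
lemma asymp_le_smul_add (hnn : ∀ x, 0 ≤ h x) (hadd : ∀ x y, h (x + y) ≤ h x + h y) {C : ℝ}
    (hC : 0 ≤ C) (hle : ∀ x, h x ≤ C * ‖toEuc x‖) {f : ℝ} (hf : 0 ≤ f) (u y : Fin d → ℤ) :
    asymp h u ≤ f * asymp h y + C * ‖toEuc u - f • toEuc y‖ := by
  rcases hf.eq_or_lt with rfl | hf
  · simpa using (asymp_le hnn u).trans (hle u)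
  have hfl : Filter.Tendsto (fun n : ℕ => ⌊f * (n : ℝ)⌋₊) Filter.atTop Filter.atTop :=
    tendsto_nat_floor_atTop.comp (tendsto_natCast_atTop_atTop.const_mul_atTop hf)
  have h1 : Filter.Tendsto (fun n : ℕ => (⌊f * (n : ℝ)⌋₊ : ℝ) / n) Filter.atTop (nhds f) :=
    (tendsto_nat_floor_mul_div_atTop hf.le).comp tendsto_natCast_atTop_atTop
  have h2 := h1.mul ((tendsto_asymp hnn hadd y).comp hfl)
  have h3 : Filter.Tendsto (fun n : ℕ => C * ‖toEuc u - f • toEuc y‖ + C * ‖toEuc y‖ / n)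
      Filter.atTop (nhds (C * ‖toEuc u - f • toEuc y‖ + 0)) :=
    tendsto_const_nhds.add (tendsto_const_div_atTop_nhds_zero_nat _)
  rw [add_zero] at h3
  refine le_of_tendsto_of_tendsto (tendsto_asymp hnn hadd u) (h2.add h3) ?_
  filter_upwards [hfl.eventually_ge_atTop 1, Filter.eventually_ge_atTop 1] with n hn hn1
  set k := ⌊f * (n : ℝ)⌋₊ with hk
  have hk0 : (0 : ℝ) < k := by exact_mod_cast hn
  have hn0 : (0 : ℝ) < n := by exact_mod_cast hn1
  have e : n • u = k • y + (n • u - k • y) := by abel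
  have h4 : ‖toEuc (n • u - k • y)‖ ≤ n * ‖toEuc u - f • toEuc y‖ + ‖toEuc y‖ := by
    have e1 : toEuc (n • u - k • y) = (n : ℝ) • (toEuc u - f • toEuc y) +
        (f * n - k) • toEuc y := by
      rw [toEuc_sub, toEuc_nsmul, toEuc_nsmul]; module
    rw [e1]
    refine (norm_add_le _ _).trans ?_
    rw [norm_smul, norm_smul, Real.norm_of_nonneg hn0.le]
    have h5 : ‖f * n - k‖ ≤ 1 := by
      rw [Real.norm_eq_abs, abs_le]
      constructor
      · linarith [Nat.floor_le (show 0 ≤ f * (n : ℝ) by positivity)]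
      · linarith [Nat.lt_floor_add_one (f * (n : ℝ))]
    have := mul_le_mul_of_nonneg_right h5 (norm_nonneg (toEuc y))
    linarith
  have h6 : h (n • u) ≤ h (k • y) + C * (n * ‖toEuc u - f • toEuc y‖ + ‖toEuc y‖) := by
    rw [e]
    refine (hadd _ _).trans ?_
    gcongr
    exact (hle _).trans (by gcongr)
  rw [div_le_iff₀ hn0]
  refine h6.trans (le_of_eq ?_)
  simp only [Function.comp]
  rw [← hk]
  field_simp

/-- The supremum `A` of `asymp h x / ‖toEuc x‖` need not be attained. A point with ratio within `1 /
n` of `A`, rescaled to length `n` and rounded, loses only a bounded amount, uniformly in `n`. -/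
lemma exists_near_maximal (hd : 0 < d) (hnn : ∀ x, 0 ≤ h x)
    (hadd : ∀ x y, h (x + y) ≤ h x + h y) {C : ℝ}
    (hC : 0 ≤ C) (hle : ∀ x, h x ≤ C * ‖toEuc x‖) :
    ∃ A : ℝ, 0 ≤ A ∧ (∀ x, asymp h x ≤ A * ‖toEuc x‖) ∧ ∃ C₁ : ℝ, 0 ≤ C₁ ∧ ∀ n : ℝ, 1 ≤ n →
      ∃ v : Fin d → ℤ, |‖toEuc v‖ - n| ≤ d ∧ A * ‖toEuc v‖ - C₁ ≤ asymp h v := by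
  set S : Set ℝ := (fun x => asymp h x / ‖toEuc x‖) '' {x : Fin d → ℤ | x ≠ 0} with hS
  have hne : S.Nonempty := by
    refine ⟨_, fun _ => 1, ?_, rfl⟩
    intro h'
    have := congrFun h' ⟨0, hd⟩
    simp at this
  have hbdd : BddAbove S := by
    refine ⟨C, ?_⟩
    rintro _ ⟨x, hx, rfl⟩
    have := one_le_norm_toEuc hx
    exact (div_le_iff₀ (by linarith)).2 ((asymp_le hnn x).trans (hle x))
  have hA : 0 ≤ sSup S := by
    refine Real.sSup_nonneg ?_
    rintro _ ⟨x, hx, rfl⟩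
    exact div_nonneg (asymp_nonneg hnn hadd x) (norm_nonneg _)
  refine ⟨sSup S, hA, fun x => ?_, sSup S * d + 1 + C * d, by positivity, fun n hn => ?_⟩
  · by_cases hx : x = 0
    · subst hx
      simpa using (asymp_le hnn 0).trans (hle 0)
    · have h1 := one_le_norm_toEuc hx
      exact (div_le_iff₀ (by linarith)).1 (le_csSup hbdd ⟨x, hx, rfl⟩)
  · have hn0 : 0 < n := by linarith
    obtain ⟨_, ⟨x, hx, rfl⟩, hlt⟩ := exists_lt_of_lt_csSup hne
      (show sSup S - 1 / n < sSup S by simp; positivity)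
    have hx1 := one_le_norm_toEuc hx
    have hx0 : 0 < ‖toEuc x‖ := by linarith
    simp only [lt_div_iff₀ hx0] at hlt
    have hv := norm_toEuc_nearest_sub_le ((n / ‖toEuc x‖) • toEuc x)
    set v := nearest ((n / ‖toEuc x‖) • toEuc x)
    have hnv : |‖toEuc v‖ - n| ≤ d := by
      have e : ‖(n / ‖toEuc x‖) • toEuc x‖ = n := by
        rw [norm_smul, Real.norm_of_nonneg (by positivity)]; field_simp
      have := abs_norm_sub_norm_le (toEuc v) ((n / ‖toEuc x‖) • toEuc x)
      rw [e] at this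
      exact this.trans hv
    refine ⟨v, hnv, ?_⟩
    have h2 := asymp_le_smul_add hnn hadd hC hle (f := ‖toEuc x‖ / n) (by positivity) x v
    have h3 : ‖toEuc x - (‖toEuc x‖ / n) • toEuc v‖ ≤ ‖toEuc x‖ / n * d := by
      have e : toEuc x - (‖toEuc x‖ / n) • toEuc v =
          -(‖toEuc x‖ / n) • (toEuc v - (n / ‖toEuc x‖) • toEuc x) := by
        rw [smul_sub, smul_smul]
        have : -(‖toEuc x‖ / n) * (n / ‖toEuc x‖) = -1 := by field_simp
        rw [this]; module
      rw [e, norm_smul, norm_neg, Real.norm_of_nonneg (by positivity)]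
      gcongr
    have h4 : (sSup S - 1 / n) * ‖toEuc x‖ ≤
        ‖toEuc x‖ / n * asymp h v + C * (‖toEuc x‖ / n * d) :=
      hlt.le.trans (h2.trans (by gcongr))
    have h5 : (sSup S - 1 / n) * ‖toEuc x‖ = ‖toEuc x‖ / n * (sSup S * n - 1) := by
      field_simp
    have h6 : ‖toEuc x‖ / n * asymp h v + C * (‖toEuc x‖ / n * d) =
        ‖toEuc x‖ / n * (asymp h v + C * d) := by ring
    rw [h5, h6] at h4
    have h7 := le_of_mul_le_mul_left h4 (by positivity)
    have h8 : sSup S * ‖toEuc v‖ ≤ sSup S * (n + d) := by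
      gcongr
      linarith [(abs_le.1 hnv).2]
    linarith

/-- Pythagoras and `√(s² + p²) ≤ s + p² / (2 s)`: the source of the quadratic transverse error. -/
lemma norm_le_of_orthogonal {E : Type*} [NormedAddCommGroup E] [InnerProductSpace ℝ E] {e r : E}
    (he : ‖e‖ = 1) (hr : inner ℝ e r = 0) {s p : ℝ} (hs : 0 < s) (hp : ‖r‖ ≤ p) :
    ‖s • e + r‖ ≤ s + p ^ 2 / (2 * s) := by
  have h1 : ‖s • e + r‖ * ‖s • e + r‖ = s * s + ‖r‖ * ‖r‖ := by
    rw [norm_add_sq_eq_norm_sq_add_norm_sq_real (by rw [inner_smul_left, hr, mul_zero]),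
      norm_smul, he, Real.norm_of_nonneg hs.le, mul_one]
  have h2 : ‖r‖ * ‖r‖ ≤ p * p := mul_self_le_mul_self (norm_nonneg r) hp
  have h3 : 0 ≤ p ^ 2 / (2 * s) := by positivity
  have h4 : s * (p ^ 2 / (2 * s)) = p ^ 2 / 2 := by field_simp
  refine abs_le_of_sq_le_sq' ?_ (by positivity) |>.2
  nlinarith [sq_nonneg (p ^ 2 / (2 * s))]

/-- Near a direction of maximal growth, the limit norm is almost constant on transverse
hyperplanes. -/
lemma abs_asymp_sub_le (hnn : ∀ x, 0 ≤ h x) (hadd : ∀ x y, h (x + y) ≤ h x + h y) {C : ℝ}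
    (hC : 0 ≤ C) (hle : ∀ x, h x ≤ C * ‖toEuc x‖) {A C₁ : ℝ} (hA : 0 ≤ A) (hC₁ : 0 ≤ C₁)
    (hmax : ∀ x, asymp h x ≤ A * ‖toEuc x‖) {v y : Fin d → ℤ}
    (hv : A * ‖toEuc v‖ - C₁ ≤ asymp h v) {e : EuclideanSpace ℝ (Fin d)} (he : ‖e‖ = 1)
    (hve : toEuc v = ‖toEuc v‖ • e) {s p : ℝ} (hs : 0 < s) (hsv : s ≤ ‖toEuc v‖)
    (hys : inner ℝ e (toEuc y) = s) (hp : ‖toEuc y - s • e‖ ≤ p) :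
    |asymp h y - A * s| ≤ A * (p ^ 2 / (2 * s)) + (2 * C₁ + C * d + A * d) := by
  set r := toEuc y - s • e with hr
  have hv0 : 0 < ‖toEuc v‖ := by linarith
  have hre : inner ℝ e r = 0 := by
    rw [hr, inner_sub_right, inner_smul_right, hys, real_inner_self_eq_norm_sq, he]; ring
  have hy : toEuc y = s • e + r := by rw [hr]; abel
  have h1 : ‖toEuc y‖ ≤ s + p ^ 2 / (2 * s) := by
    rw [hy]; exact norm_le_of_orthogonal he hre hs hp
  have hq := norm_toEuc_nearest_sub_le ((2 * s) • e - toEuc y)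
  -- The mirror image of `y` in the axis, rounded: `y + q` is within `d` of `(2 * s) • e`.
  set q := nearest ((2 * s) • e - toEuc y)
  have h2 : ‖(2 * s) • e - toEuc y‖ ≤ s + p ^ 2 / (2 * s) := by
    have : (2 * s) • e - toEuc y = s • e + -r := by rw [hy]; module
    rw [this]
    exact norm_le_of_orthogonal he (by rw [inner_neg_right, hre, neg_zero]) hs (by rwa [norm_neg])
  have h3 : ‖toEuc q‖ ≤ s + p ^ 2 / (2 * s) + d := by
    have := norm_le_norm_add_norm_sub ((2 * s) • e - toEuc y) (toEuc q)
    rw [norm_sub_rev _ (toEuc q)] at this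
    linarith
  have h4 := asymp_add_le hnn hadd y q
  have h5 := asymp_le_smul_add hnn hadd hC hle (f := ‖toEuc v‖ / (2 * s)) (by positivity) v (y + q)
  have h6 : ‖toEuc v - (‖toEuc v‖ / (2 * s)) • toEuc (y + q)‖ ≤ ‖toEuc v‖ / (2 * s) * d := by
    have e1 : toEuc v - (‖toEuc v‖ / (2 * s)) • toEuc (y + q) =
        -(‖toEuc v‖ / (2 * s)) • (toEuc q - ((2 * s) • e - toEuc y)) := by
      have : ‖toEuc v‖ = ‖toEuc v‖ / (2 * s) * (2 * s) := by field_simp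
      rw [toEuc_add]
      nth_rewrite 1 [hve, this]
      module
    rw [e1, norm_smul, norm_neg, Real.norm_of_nonneg (by positivity)]
    gcongr
  -- Near-maximality of `v`, transferred to `y + q` by rescaling with `‖toEuc v‖ / (2 * s)`; this
  -- bounds `asymp h (y + q)` from below.
  have h7 : ‖toEuc v‖ / (2 * s) * (2 * s * A - 2 * s / ‖toEuc v‖ * C₁) ≤
      ‖toEuc v‖ / (2 * s) * (asymp h (y + q) + C * d) := by
    calc _ = A * ‖toEuc v‖ - C₁ := by field_simp
      _ ≤ _ := hv
      _ ≤ _ := h5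
      _ ≤ ‖toEuc v‖ / (2 * s) * asymp h (y + q) + C * (‖toEuc v‖ / (2 * s) * d) := by gcongr
      _ = _ := by ring
  have h8 := le_of_mul_le_mul_left h7 (by positivity)
  have h9 : 2 * s / ‖toEuc v‖ * C₁ ≤ 2 * C₁ := by
    gcongr
    rw [div_le_iff₀ hv0]; linarith
  have h10 : asymp h y ≤ A * (s + p ^ 2 / (2 * s)) := (hmax y).trans (by gcongr)
  have h11 : asymp h q ≤ A * (s + p ^ 2 / (2 * s) + d) := (hmax q).trans (by gcongr)
  have h12 : 0 ≤ C * d := by positivity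
  have h13 : 0 ≤ A * d := by positivity
  rw [abs_le]
  constructor <;> linarith

/-- Carathéodory's theorem, for conical combinations of vectors and costs. -/
lemma exists_caratheodory (h : (Fin d → ℤ) → ℝ) {l : List (Fin d → ℤ)} (hl : l ≠ []) {θ : ℝ}
    (hθ : 0 ≤ θ) :
    ∃ (F : Finset (EuclideanSpace ℝ (Fin d) × ℝ)) (Y : EuclideanSpace ℝ (Fin d) × ℝ → Fin d → ℤ)
      (c : EuclideanSpace ℝ (Fin d) × ℝ → ℝ), F.card ≤ d + 2 ∧ (∀ z ∈ F, Y z ∈ l) ∧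
      (∀ z ∈ F, 0 ≤ c z) ∧ ∑ z ∈ F, c z • toEuc (Y z) = θ • toEuc l.sum ∧
      ∑ z ∈ F, c z * h (Y z) = θ * (l.map h).sum := by
  -- Carathéodory is applied to the graph of `h`, in dimension `d + 1`, so that displacement and
  -- cost are preserved together; hence `d + 2` points.
  let φ : (Fin d → ℤ) → EuclideanSpace ℝ (Fin d) × ℝ := fun y => (toEuc y, h y)
  have hL : (0 : ℝ) < l.length := by exact_mod_cast List.length_pos_iff.2 hl
  have hmem : ∑ i : Fin l.length, (1 / (l.length : ℝ)) • φ l[i.1] ∈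
      convexHull ℝ (φ '' {y | y ∈ l}) := by
    refine (convex_convexHull ℝ _).sum_mem (fun _ _ => by positivity) ?_ ?_
    · simp; field_simp
    · intro i _
      exact subset_convexHull _ _ ⟨_, List.getElem_mem _, rfl⟩
  set t := Caratheodory.minCardFinsetOfMemConvexHull hmem with ht
  have ht1 : ↑t ⊆ φ '' {y | y ∈ l} := Caratheodory.minCardFinsetOfMemConvexHull_subseteq hmem
  have ht2 := Caratheodory.mem_minCardFinsetOfMemConvexHull hmem
  have ht3 := Caratheodory.affineIndependent_minCardFinsetOfMemConvexHull hmem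
  rw [← ht] at ht2 ht3
  have hcard : t.card ≤ d + 2 := by
    have := ht3.card_le_finrank_succ
    rw [Fintype.card_coe] at this
    have h2 := Submodule.finrank_le (vectorSpan ℝ (Set.range ((↑) : t → EuclideanSpace ℝ (Fin d) × ℝ)))
    simp only [Module.finrank_prod, finrank_euclideanSpace, Fintype.card_fin,
      Module.finrank_self] at h2
    omega
  have hY : ∀ z, ∃ y, z ∈ t → y ∈ l ∧ φ y = z := by
    intro z
    by_cases hz : z ∈ t
    · obtain ⟨y, hy, hyz⟩ := ht1 hz
      exact ⟨y, fun _ => ⟨hy, hyz⟩⟩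
    · exact ⟨0, fun h => absurd h hz⟩
  choose Y hY using hY
  rw [Finset.mem_convexHull'] at ht2
  obtain ⟨w, hw0, hw1, hw2⟩ := ht2
  have hw3 : ∑ z ∈ t, w z • φ (Y z) = (1 / (l.length : ℝ)) • (l.map φ).sum := by
    rw [← Fin.sum_univ_fun_getElem, Finset.smul_sum, ← hw2]
    exact Finset.sum_congr rfl fun z hz => by rw [(hY z hz).2]
  have hsum1 : (l.map φ).sum.1 = toEuc l.sum := by
    rw [toEuc_list_sum, ← AddMonoidHom.coe_fst, map_list_sum, List.map_map]; rfl
  have hsum2 : (l.map φ).sum.2 = (l.map h).sum := by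
    rw [← AddMonoidHom.coe_snd, map_list_sum, List.map_map]; rfl
  refine ⟨t, Y, fun z => θ * l.length * w z, hcard, fun z hz => (hY z hz).1,
    fun z hz => mul_nonneg (by positivity) (hw0 z hz), ?_, ?_⟩
  · have := congrArg (fun z => (θ * l.length) • z.1) hw3
    simp only [Prod.fst_sum, Prod.smul_fst, hsum1, smul_smul, Finset.smul_sum] at this
    rw [this]
    congr 1; field_simp
  · have := congrArg (fun z => (θ * l.length) • z.2) hw3
    simp only [Prod.snd_sum, Prod.smul_snd, hsum2, smul_eq_mul, Finset.mul_sum] at this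
    simp only [mul_assoc] at this ⊢
    rw [this]
    field_simp

/-- Half of a decomposition of `2 X` into small steps gives a decomposition of `X` into the same
steps, up to a bounded number of fractional steps. -/
lemma le_half_sum_add (hnn : ∀ x, 0 ≤ h x) (hadd : ∀ x y, h (x + y) ≤ h x + h y) {C : ℝ}
    (hC : 0 ≤ C) (hle : ∀ x, h x ≤ C * ‖toEuc x‖) {ρ E : ℝ} (hE : 0 ≤ E)
    (hρE : ∀ u, ‖toEuc u‖ ≤ ρ + d → h u ≤ asymp h u + E) {X : Fin d → ℤ} {l : List (Fin d → ℤ)}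
    (hl : l ≠ []) (hsum : l.sum = X + X) (hlρ : ∀ y ∈ l, ‖toEuc y‖ ≤ ρ) :
    h X ≤ 1 / 2 * (l.map h).sum + (d + 2) * (E + 2 * C * d) := by
  obtain ⟨F, Y, c, hcard, hY, hc, hs1, hs2⟩ := exists_caratheodory h hl
    (show (0 : ℝ) ≤ 1 / 2 by norm_num)
  have hX : ∑ z ∈ F, c z • toEuc (Y z) = toEuc X := by
    rw [hs1, hsum, toEuc_add]; module
  -- Each coefficient splits into an integer part, used as whole steps at cost `h`, and a fractional
  -- part, replaced by one rounded lattice step.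
  let u : EuclideanSpace ℝ (Fin d) × ℝ → Fin d → ℤ := fun z =>
    nearest (Int.fract (c z) • toEuc (Y z))
  have hu : ∀ z, ‖toEuc (u z) - Int.fract (c z) • toEuc (Y z)‖ ≤ d := fun z =>
    norm_toEuc_nearest_sub_le _
  have hh0 : h 0 = 0 := le_antisymm (by simpa using hle 0) (hnn 0)
  have hfin : ∀ (s : Finset (EuclideanSpace ℝ (Fin d) × ℝ))
      (q : EuclideanSpace ℝ (Fin d) × ℝ → Fin d → ℤ), h (∑ z ∈ s, q z) ≤ ∑ z ∈ s, h (q z) := by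
    classical
    intro s q
    induction s using Finset.induction_on with
    | empty => simp [hh0]
    | insert a s ha ih =>
      rw [Finset.sum_insert ha, Finset.sum_insert ha]
      exact (hadd _ _).trans (by gcongr)
  have hnsmul : ∀ (n : ℕ) (y : Fin d → ℤ), h (n • y) ≤ n * h y := by
    intro n y
    induction n with
    | zero => simp [hh0]
    | succ n ih =>
      rw [succ_nsmul]
      push_cast
      linarith [hadd (n • y) y]
  have hterm : ∀ z ∈ F, h (⌊c z⌋₊ • Y z + u z) ≤ c z * h (Y z) + (E + C * d) := by
    intro z hz
    have hf0 := Int.fract_nonneg (c z)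
    have hf1 := Int.fract_lt_one (c z)
    have e1 : (⌊c z⌋₊ : ℝ) + Int.fract (c z) = c z := by
      rw [natCast_floor_eq_intCast_floor (hc z hz)]
      exact Int.floor_add_fract _
    have h1 : ‖toEuc (u z)‖ ≤ ρ + d := by
      have h2 : ‖Int.fract (c z) • toEuc (Y z)‖ ≤ ρ := by
        rw [norm_smul, Real.norm_of_nonneg hf0]
        nlinarith [hlρ _ (hY z hz), norm_nonneg (toEuc (Y z))]
      have := norm_le_norm_add_norm_sub (Int.fract (c z) • toEuc (Y z)) (toEuc (u z))
      rw [norm_sub_rev] at this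
      linarith [hu z]
    have h2 := hρE _ h1
    have h3 := asymp_le_smul_add hnn hadd hC hle hf0 (u z) (Y z)
    have h4 : C * ‖toEuc (u z) - Int.fract (c z) • toEuc (Y z)‖ ≤ C * d := by
      gcongr; exact hu z
    have h5 : Int.fract (c z) * asymp h (Y z) ≤ Int.fract (c z) * h (Y z) := by
      gcongr; exact asymp_le hnn _
    have h6 := hnsmul ⌊c z⌋₊ (Y z)
    have h7 := hadd (⌊c z⌋₊ • Y z) (u z)
    have h8 : c z * h (Y z) = ⌊c z⌋₊ * h (Y z) + Int.fract (c z) * h (Y z) := by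
      rw [← add_mul, e1]
    linarith
  -- The accumulated rounding error, of bounded norm.
  set R := X - ∑ z ∈ F, (⌊c z⌋₊ • Y z + u z) with hR
  have hcard' : (F.card : ℝ) ≤ d + 2 := by exact_mod_cast hcard
  have hRn : ‖toEuc R‖ ≤ (d + 2) * d := by
    have e : toEuc R = -∑ z ∈ F, (toEuc (u z) - Int.fract (c z) • toEuc (Y z)) := by
      rw [hR, toEuc_sub, toEuc_finset_sum, ← hX, ← Finset.sum_sub_distrib, ← Finset.sum_neg_distrib]
      refine Finset.sum_congr rfl fun z hz => ?_
      have e1 : (⌊c z⌋₊ : ℝ) + Int.fract (c z) = c z := by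
        rw [natCast_floor_eq_intCast_floor (hc z hz)]
        exact Int.floor_add_fract _
      rw [toEuc_add, toEuc_nsmul]
      nth_rewrite 1 [← e1]
      module
    rw [e, norm_neg]
    refine (norm_sum_le _ _).trans ((Finset.sum_le_card_nsmul _ _ _ fun z _ => hu z).trans ?_)
    rw [nsmul_eq_mul]
    gcongr
  have e : X = ∑ z ∈ F, (⌊c z⌋₊ • Y z + u z) + R := by rw [hR]; abel
  calc h X ≤ h (∑ z ∈ F, (⌊c z⌋₊ • Y z + u z)) + h R := by
        nth_rewrite 1 [e]; exact hadd _ _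
    _ ≤ ∑ z ∈ F, (c z * h (Y z) + (E + C * d)) + C * ((d + 2) * d) := by
        refine add_le_add ((hfin _ _).trans (Finset.sum_le_sum hterm)) ((hle R).trans ?_)
        gcongr
    _ = 1 / 2 * (l.map h).sum + F.card * (E + C * d) + C * ((d + 2) * d) := by
        rw [Finset.sum_add_distrib, hs2, Finset.sum_const, nsmul_eq_mul]
    _ ≤ 1 / 2 * (l.map h).sum + (d + 2) * (E + C * d) + C * ((d + 2) * d) := by
        gcongr
    _ = _ := by ring

/-- Summing a doubling inequality over dyadic scales. -/
lemma le_asymp_of_doubling (hnn : ∀ x, 0 ≤ h x) (hadd : ∀ x y, h (x + y) ≤ h x + h y) {c a : ℝ}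
    (hc : 0 ≤ c) (ha : a < 1)
    (hdbl : ∀ X, X ≠ 0 → h X ≤ 1 / 2 * h (X + X) + c * ‖toEuc X‖ ^ a) {X : Fin d → ℤ} (hX : X ≠ 0) :
    h X ≤ asymp h X + c / (1 - 2 ^ (a - 1)) * ‖toEuc X‖ ^ a := by
  have hq1 : (2 : ℝ) ^ (a - 1) < 1 := Real.rpow_lt_one_of_one_lt_of_neg (by norm_num) (by linarith)
  have hq0 : (0 : ℝ) < 2 ^ (a - 1) := by positivity
  set q : ℝ := 2 ^ (a - 1) with hq
  have hX0 : 0 < ‖toEuc X‖ := by linarith [one_le_norm_toEuc hX]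
  -- Applying the doubling inequality at `2 ^ j • X` and dividing by `2 ^ j` leaves an error with
  -- ratio `2 ^ (a - 1) < 1`, hence a convergent geometric series.
  have key : ∀ J : ℕ, h X ≤ h ((2 ^ J) • X) / (2 ^ J : ℕ) +
      c * ‖toEuc X‖ ^ a * ∑ j ∈ Finset.range J, q ^ j := by
    intro J
    induction J with
    | zero => simp
    | succ J ih =>
      have hne : (2 ^ J) • X ≠ 0 := smul_ne_zero (by positivity) hX
      have h1 := hdbl _ hne
      have e1 : (2 ^ J) • X + (2 ^ J) • X = (2 ^ (J + 1)) • X := by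
        rw [← add_smul]; congr 1; ring
      rw [e1] at h1
      have e2 : ‖toEuc ((2 ^ J) • X)‖ ^ a / 2 ^ J = ‖toEuc X‖ ^ a * q ^ J := by
        rw [toEuc_nsmul, norm_smul]
        push_cast
        rw [Real.norm_of_nonneg (by positivity), Real.mul_rpow (by positivity) (by positivity),
          hq, ← Real.rpow_natCast, ← Real.rpow_natCast, ← Real.rpow_mul (by norm_num),
          ← Real.rpow_mul (by norm_num), mul_div_right_comm, ← Real.rpow_sub (by norm_num), mul_comm]
        congr 2; ring
      rw [Finset.sum_range_succ]
      have h2 : h ((2 ^ J) • X) / (2 ^ J : ℕ) ≤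
          h ((2 ^ (J + 1)) • X) / (2 ^ (J + 1) : ℕ) + c * ‖toEuc X‖ ^ a * q ^ J := by
        calc h ((2 ^ J) • X) / (2 ^ J : ℕ)
            ≤ (1 / 2 * h ((2 ^ (J + 1)) • X) + c * ‖toEuc ((2 ^ J) • X)‖ ^ a) / (2 ^ J : ℕ) := by
              gcongr
          _ = h ((2 ^ (J + 1)) • X) / (2 ^ (J + 1) : ℕ) +
              c * (‖toEuc ((2 ^ J) • X)‖ ^ a / 2 ^ J) := by
              push_cast; field_simp; ring
          _ = _ := by rw [e2]; ring
      linarith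
  have hlim : Filter.Tendsto (fun J : ℕ => h ((2 ^ J) • X) / (2 ^ J : ℕ)) Filter.atTop
      (nhds (asymp h X)) :=
    (tendsto_asymp hnn hadd X).comp (tendsto_pow_atTop_atTop_of_one_lt (by norm_num))
  refine ge_of_tendsto (hlim.add_const _) (Filter.Eventually.of_forall fun J => ?_)
  refine (key J).trans (add_le_add_right ?_ _)
  rw [div_mul_eq_mul_div, le_div_iff₀ (by linarith)]
  have hg : (∑ j ∈ Finset.range J, q ^ j) * (1 - q) ≤ 1 := by
    have := geom_sum_mul q J
    nlinarith [pow_pos hq0 J]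
  calc c * ‖toEuc X‖ ^ a * (∑ j ∈ Finset.range J, q ^ j) * (1 - q)
      = c * ‖toEuc X‖ ^ a * ((∑ j ∈ Finset.range J, q ^ j) * (1 - q)) := by ring
    _ ≤ c * ‖toEuc X‖ ^ a * 1 := by gcongr
    _ = _ := by ring

end Subadditive
end FPP

namespace FPP

variable {d : ℕ}

/-! ### Cutting a geodesic into short steps -/

lemma abs_inner_sub_le_one {e : EuclideanSpace ℝ (Fin d)} (he : ‖e‖ = 1) {x y : Fin d → ℤ}
    (h : (lattice d).Adj x y) : |inner ℝ e (toEuc y) - inner ℝ e (toEuc x)| ≤ 1 := by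
  rw [← inner_sub_right]
  refine (abs_real_inner_le_norm _ _).trans ?_
  rw [he, one_mul]
  exact norm_toEuc_sub_le_one_of_adj h

lemma norm_toEuc_sub_le_of_axis {e : EuclideanSpace ℝ (Fin d)} (he : ‖e‖ = 1) {x y : Fin d → ℤ}
    {s ρ : ℝ} (hs : |inner ℝ e (toEuc y) - inner ℝ e (toEuc x)| ≤ s)
    (hx : ‖toEuc x - (inner ℝ e (toEuc x) : ℝ) • e‖ ≤ ρ)
    (hy : ‖toEuc y - (inner ℝ e (toEuc y) : ℝ) • e‖ ≤ ρ) : ‖toEuc (y - x)‖ ≤ s + 2 * ρ := by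
  have e1 : toEuc (y - x) = ((inner ℝ e (toEuc y) : ℝ) - inner ℝ e (toEuc x)) • e +
      (toEuc y - (inner ℝ e (toEuc y) : ℝ) • e) - (toEuc x - (inner ℝ e (toEuc x) : ℝ) • e) := by
    rw [toEuc_sub]; module
  rw [e1]
  refine (norm_sub_le _ _).trans ?_
  have h1 := norm_add_le (((inner ℝ e (toEuc y) : ℝ) - inner ℝ e (toEuc x)) • e)
    (toEuc y - (inner ℝ e (toEuc y) : ℝ) • e)
  rw [norm_smul, he, mul_one, Real.norm_eq_abs] at h1
  linarith

/-- Greedy cutting: from `a`, go to a vertex of the geodesic whose height along `e` has grown by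
between `r` and `r + 1`, then continue from there. Pieces of a geodesic are geodesics, so their
times add up, and each piece costs one error `κ`. The condition that `b` be at most `1` below `a`
allows for the overshoot of the previous cut. -/
lemma IsGeodesic.exists_chain {w : Weights d} (hw : ∀ e, 0 ≤ w e) {h : (Fin d → ℤ) → ℝ}
    {e : EuclideanSpace ℝ (Fin d)} (he : ‖e‖ = 1) {r ρ N κ : ℝ} (hr : 0 ≤ r) (hκ : 0 ≤ κ)
    (hfl : ∀ x y : Fin d → ℤ, ‖toEuc x‖ ≤ N → ‖toEuc y‖ ≤ N → ‖toEuc (y - x)‖ ≤ r + 1 + 2 * ρ →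
      h (y - x) ≤ passageTime w x y + κ) {b : Fin d → ℤ} (n : ℕ) :
    ∀ (a : Fin d → ℤ) (γ : (lattice d).Walk a b), IsGeodesic w γ →
      (∀ z ∈ γ.support, ‖toEuc z - (inner ℝ e (toEuc z) : ℝ) • e‖ ≤ ρ) →
      (∀ z ∈ γ.support, ‖toEuc z‖ ≤ N) →
      (inner ℝ e (toEuc a) : ℝ) - 1 ≤ inner ℝ e (toEuc b) →
      (inner ℝ e (toEuc b) : ℝ) ≤ inner ℝ e (toEuc a) + (n + 1) * r →
      ∃ l : List (Fin d → ℤ), l ≠ [] ∧ l.sum = b - a ∧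
        (∀ y ∈ l, ‖toEuc y‖ ≤ r + 1 + 2 * ρ) ∧
        (l.map h).sum ≤ passageTime w a b + (n + 1) * κ := by
  have hl : ∀ x y, (lattice d).Adj x y → (inner ℝ e (toEuc y) : ℝ) ≤ inner ℝ e (toEuc x) + 1 :=
    fun x y hxy => by linarith [(abs_le.1 (abs_inner_sub_le_one he hxy)).2]
  have hone : ∀ (m : ℕ) (a : Fin d → ℤ) (γ : (lattice d).Walk a b),
      (∀ z ∈ γ.support, ‖toEuc z - (inner ℝ e (toEuc z) : ℝ) • e‖ ≤ ρ) →
      (∀ z ∈ γ.support, ‖toEuc z‖ ≤ N) →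
      (inner ℝ e (toEuc a) : ℝ) - 1 ≤ inner ℝ e (toEuc b) →
      (inner ℝ e (toEuc b) : ℝ) ≤ inner ℝ e (toEuc a) + r →
      ∃ l : List (Fin d → ℤ), l ≠ [] ∧ l.sum = b - a ∧
        (∀ y ∈ l, ‖toEuc y‖ ≤ r + 1 + 2 * ρ) ∧
        (l.map h).sum ≤ passageTime w a b + (m + 1) * κ := by
    intro m a γ hρ hN h1 h2
    have hnorm : ‖toEuc (b - a)‖ ≤ r + 1 + 2 * ρ :=
      norm_toEuc_sub_le_of_axis he (abs_le.2 ⟨by linarith, by linarith⟩)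
        (hρ a γ.start_mem_support) (hρ b γ.end_mem_support)
    refine ⟨[b - a], by simp, by simp, by simpa using hnorm, ?_⟩
    have h3 := hfl a b (hN a γ.start_mem_support) (hN b γ.end_mem_support) hnorm
    have h4 : 0 ≤ (m : ℝ) * κ := by positivity
    simp only [List.map_cons, List.map_nil, List.sum_singleton]
    linarith
  induction n with
  | zero =>
    intro a γ hγ hρ hN h1 h2
    exact hone 0 a γ hρ hN h1 (by simpa using h2)
  | succ n ih =>
    intro a γ hγ hρ hN h1 h2
    by_cases hb : (inner ℝ e (toEuc b) : ℝ) ≤ inner ℝ e (toEuc a) + r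
    · exact hone (n + 1) a γ hρ hN h1 hb
    · rw [not_le] at hb
      obtain ⟨y, hy1, hy2, hy3, hsplit, γ', hγ', hsub⟩ := hγ.exists_split hw hl
        (c := inner ℝ e (toEuc a) + r) (by linarith) hb.le
      push_cast at h2
      obtain ⟨l, _, hl2, hl3, hl4⟩ := ih y γ' hγ' (fun z hz => hρ z (hsub hz))
        (fun z hz => hN z (hsub hz)) (by linarith) (by linarith)
      have hnorm : ‖toEuc (y - a)‖ ≤ r + 1 + 2 * ρ :=
        norm_toEuc_sub_le_of_axis he (abs_le.2 ⟨by linarith, by linarith⟩)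
          (hρ a γ.start_mem_support) (hρ y hy3)
      have h3 := hfl a y (hN a γ.start_mem_support) (hN y hy3) hnorm
      refine ⟨(y - a) :: l, by simp, by simp [hl2], ?_, ?_⟩
      · intro u hu
        rcases List.mem_cons.1 hu with rfl | hu
        · exact hnorm
        · exact hl3 u hu
      · simp only [List.map_cons, List.sum_cons]
        push_cast
        linarith

/-- The distance of a point to the axis of a segment is at most its distance to the segment. -/
lemma norm_sub_axis_le {E : Type*} [NormedAddCommGroup E] [InnerProductSpace ℝ E] {e u : E}
    (he : ‖e‖ = 1) (s : ℝ) : ‖u - (inner ℝ e u : ℝ) • e‖ ≤ ‖u - s • e‖ := by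
  have horth : inner ℝ (u - (inner ℝ e u : ℝ) • e) (((inner ℝ e u : ℝ) - s) • e) = 0 := by
    rw [inner_smul_right, inner_sub_left, inner_smul_left, real_inner_self_eq_norm_sq, he,
      real_inner_comm]
    simp
  have e1 : u - s • e = (u - (inner ℝ e u : ℝ) • e) + ((inner ℝ e u : ℝ) - s) • e := by module
  have h := norm_add_sq_eq_norm_sq_add_norm_sq_real horth
  rw [← e1] at h
  refine abs_le_of_sq_le_sq' ?_ (norm_nonneg _) |>.2
  nlinarith [mul_self_nonneg ‖((inner ℝ e u : ℝ) - s) • e‖]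

/-- The vertices of a geodesic are close to the axis through its endpoints. -/
lemma IsGeodesic.norm_sub_axis_lt {w : Weights d} {a b : Fin d → ℤ} {γ : (lattice d).Walk a b}
    (hγ : IsGeodesic w γ) {ρ : ℝ} (hρ : deviation w a b < ENNReal.ofReal ρ)
    {e : EuclideanSpace ℝ (Fin d)} (he : ‖e‖ = 1) {R : ℝ} (hR : 0 ≤ R)
    (hab : toEuc b - toEuc a = R • e) {z : Fin d → ℤ} (hz : z ∈ γ.support) :
    ‖toEuc (z - a) - (inner ℝ e (toEuc (z - a)) : ℝ) • e‖ < ρ ∧ ‖toEuc (z - a)‖ < R + ρ ∧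
      ∀ f : EuclideanSpace ℝ (Fin d), ‖f‖ = 1 → inner ℝ f e = 0 →
        |inner ℝ f (toEuc (z - a))| < ρ := by
  obtain ⟨q, hq, hd⟩ := hγ.exists_mem_segment hρ hz
  rw [segment_eq_image', Set.mem_image] at hq
  obtain ⟨s, hs, rfl⟩ := hq
  rw [hab, dist_eq_norm, smul_smul] at hd
  have e1 : toEuc z - (toEuc a + (s * R) • e) = toEuc (z - a) - (s * R) • e := by
    rw [toEuc_sub]; abel
  rw [e1] at hd
  refine ⟨(norm_sub_axis_le he _).trans_lt hd, ?_, fun f hf hfe => ?_⟩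
  · have h1 := norm_le_norm_add_norm_sub ((s * R) • e) (toEuc (z - a))
    rw [norm_sub_rev ((s * R) • e), norm_smul, he, mul_one, Real.norm_of_nonneg (mul_nonneg hs.1 hR)] at h1
    nlinarith [hs.2]
  · have h1 := abs_real_inner_le_norm f (toEuc (z - a) - (s * R) • e)
    rw [inner_sub_right, inner_smul_right, hfe, mul_zero, sub_zero, hf, one_mul] at h1
    linarith

/-- A deterministic inequality between means follows from a single good configuration, so it is
enough that the bad events do not have full probability. -/
lemma exists_of_measureReal_lt_one {Ω : Type*} [MeasurableSpace Ω] {P : Measure Ω}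
    [IsProbabilityMeasure P] {p : Ω → Prop} (hp : ∀ᵐ ω ∂P, p ω) {S : Set Ω} (hS : P.real S < 1) :
    ∃ ω, p ω ∧ ω ∉ S := by
  by_contra! h
  have h1 : S =ᵐ[P] Set.univ := by
    rw [Filter.eventuallyEq_univ]
    filter_upwards [hp] with ω hω using h ω hω
  rw [measureReal_congr h1] at hS
  simp at hS

/-! ### Nonrandom fluctuations: the mean passage time against its homogeneous limit. -/

section Exponents

set_option linter.unusedSectionVars false

variable {Ω : Type*} [MeasurableSpace Ω] {P : Measure Ω} {μ : Measure ℝ}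
  {t : (lattice d).edgeSet → Ω → ℝ} {χa χb ξa ξb : ℝ}
variable [IsProbabilityMeasure P] [IsProbabilityMeasure μ]

/-- With high probability, passage times fluctuate little, simultaneously for all pairs of points
in a ball. -/
lemma HasGlobalExponents.fluctuation_union (hexp : HasGlobalExponents P t χa χb ξa ξb)
    (ht : IsIIDWeights P μ t) {χ' : ℝ} (h0 : 0 < χa) (hχ : χa < χ') {K : ℝ} (hK : 0 ≤ K) :
    ∃ C : ℝ, 0 < C ∧ ∀ n : ℝ, 1 ≤ n → ∀ M : ℝ, n ^ (1 / 2 : ℝ) ≤ M →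
      P.real {ω | ∃ a b, ‖toEuc a‖ ≤ 4 * n ∧ ‖toEuc b‖ ≤ 4 * n ∧ ‖toEuc (b - a)‖ ≤ M ∧
        M ^ χ' ≤ |time t a b ω - meanTime P t (b - a)|} ≤ C * n ^ (-K) := by
  obtain ⟨C, hC, h⟩ := hexp.time_tail ht h0 hχ (2 * (K + 2 * d))
  refine ⟨9 ^ (2 * d) * C, by positivity, fun n hn M hM => ?_⟩
  have hn0 : 0 < n := by linarith
  have hM1 : 1 ≤ M := (Real.one_le_rpow hn (by norm_num)).trans hM
  obtain ⟨F, hF, hcard⟩ := exists_finset_ball d (4 * n) (by linarith)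
  have hFc : (F.card : ℝ) ≤ (9 * n) ^ d := hcard.trans (by gcongr; linarith)
  have hsub : {ω | ∃ a b, ‖toEuc a‖ ≤ 4 * n ∧ ‖toEuc b‖ ≤ 4 * n ∧ ‖toEuc (b - a)‖ ≤ M ∧
        M ^ χ' ≤ |time t a b ω - meanTime P t (b - a)|} ⊆
      ⋃ p ∈ (F ×ˢ F).filter (fun p => ‖toEuc (p.2 - p.1)‖ ≤ M),
        {ω | M ^ χ' ≤ |time t p.1 p.2 ω - meanTime P t (p.2 - p.1)|} := by
    rintro ω ⟨a, b, ha, hb, hab, hω⟩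
    refine Set.mem_biUnion (x := (a, b)) ?_ hω
    simp [hF a ha, hF b hb, hab]
  -- As `M ≥ √n`, decay of order `2 * (K + 2 * d)` in `M` beats the at most `(9 * n) ^ (2 * d)`
  -- pairs of points.
  have hMn : M ^ (-(2 * (K + 2 * d))) ≤ n ^ (-K) * n ^ (-(2 * d) : ℝ) := by
    calc M ^ (-(2 * (K + 2 * d))) ≤ (n ^ (1 / 2 : ℝ)) ^ (-(2 * (K + 2 * d))) := by
          apply Real.rpow_le_rpow_of_nonpos (by positivity) hM
          have : 0 ≤ 2 * (K + 2 * d) := by positivity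
          linarith
      _ = n ^ (-K) * n ^ (-(2 * d) : ℝ) := by
          rw [← Real.rpow_mul hn0.le, ← Real.rpow_add hn0]
          congr 1; ring
  calc _ ≤ P.real (⋃ p ∈ (F ×ˢ F).filter (fun p => ‖toEuc (p.2 - p.1)‖ ≤ M),
        {ω | M ^ χ' ≤ |time t p.1 p.2 ω - meanTime P t (p.2 - p.1)|}) :=
      measureReal_mono hsub (measure_ne_top _ _)
    _ ≤ ∑ p ∈ (F ×ˢ F).filter (fun p => ‖toEuc (p.2 - p.1)‖ ≤ M),
        P.real {ω | M ^ χ' ≤ |time t p.1 p.2 ω - meanTime P t (p.2 - p.1)|} :=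
      measureReal_biUnion_finset_le _ _
    _ ≤ ∑ p ∈ (F ×ˢ F).filter (fun p => ‖toEuc (p.2 - p.1)‖ ≤ M),
        C * M ^ (-(2 * (K + 2 * d))) :=
      Finset.sum_le_sum fun p hp => h M hM1 p.1 p.2 (Finset.mem_filter.1 hp).2
    _ ≤ (F.card * F.card) * (C * M ^ (-(2 * (K + 2 * d)))) := by
      rw [Finset.sum_const, nsmul_eq_mul]
      gcongr
      have := Finset.card_filter_le (F ×ˢ F) (fun p => ‖toEuc (p.2 - p.1)‖ ≤ M)
      rw [Finset.card_product] at this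
      exact_mod_cast this
    _ ≤ ((9 * n) ^ d * (9 * n) ^ d) * (C * (n ^ (-K) * n ^ (-(2 * d) : ℝ))) := by
      gcongr
    _ = 9 ^ (2 * d) * C * n ^ (-K) := by
      have : n ^ (-(2 * d) : ℝ) = (n ^ d * n ^ d)⁻¹ := by
        rw [Real.rpow_neg hn0.le, ← pow_add, ← Real.rpow_natCast]
        congr 2; push_cast; ring
      rw [this, mul_pow]
      field_simp
      ring

lemma eventually_scales {ξ' θ : ℝ} (hθ : ξ' < 1 - θ) (hξ : 0 < ξ') (hξ1 : ξ' < 1) (D : ℝ) :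
    ∀ᶠ R : ℝ in Filter.atTop, (2 * R) ^ ξ' ≤ R ^ (1 - θ) ∧ D ≤ R ^ (1 - θ) := by
  have h1 := (tendsto_rpow_atTop (show 0 < 1 - θ - ξ' by linarith)).eventually_ge_atTop 2
  have h2 := (tendsto_rpow_atTop (show 0 < 1 - θ by linarith)).eventually_ge_atTop D
  filter_upwards [h1, h2, Filter.eventually_gt_atTop 0] with R h1 h2 hR
  refine ⟨?_, h2⟩
  rw [Real.rpow_sub hR, le_div_iff₀ (by positivity)] at h1
  rw [Real.mul_rpow (by norm_num) hR.le]
  refine le_trans ?_ h1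
  gcongr
  exact (Real.rpow_le_rpow_of_exponent_le (by norm_num) hξ1.le).trans (by simp)

lemma rpow_const_mul_le {c x a : ℝ} (hc : 1 ≤ c) (hx : 0 ≤ x) (ha : a ≤ 1) :
    (c * x) ^ a ≤ c * x ^ a := by
  rw [Real.mul_rpow (by linarith) hx]
  gcongr
  exact (Real.rpow_le_rpow_of_exponent_le hc ha).trans (by simp)

/-- Doubling inequality for the mean passage time. -/
lemma HasGlobalExponents.doubling (hexp : HasGlobalExponents P t χa χb ξa ξb)
    (ht : IsIIDWeights P μ t)
    (hgeo : ∀ᵐ ω ∂P, ∀ a b, ∃ γ : (lattice d).Walk a b, IsGeodesic (fun e => t e ω) γ)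
    (h0 : 0 < χa) {ν : ℝ} (hν : χa < ν) (hν1 : ν < 1) {ξ' : ℝ} (hξ0 : 0 < ξ') (hξ1 : ξ' < 1)
    (hξ : ξa < ξ') {θ : ℝ} (hθ0 : 0 < θ) (hθ : θ ≤ 1 / 2) (hθξ : ξ' < 1 - θ) {a K : ℝ}
    (ha0 : 0 ≤ a) (ha1 : a ≤ 1) (hK : 0 ≤ K)
    (hKa : ∀ u, u ≠ 0 → meanTime P t u ≤ asymp (meanTime P t) u + K * ‖toEuc u‖ ^ a)
    {a' : ℝ} (h1 : ν + θ * (1 - ν) ≤ a') (h2 : a * (1 - θ) ≤ a') :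
    ∃ c, 0 ≤ c ∧ ∀ X, X ≠ 0 →
      meanTime P t X ≤ 1 / 2 * meanTime P t (X + X) + c * ‖toEuc X‖ ^ a' := by
  set h := meanTime P t with hh
  have hnn : ∀ x, 0 ≤ h x := ht.meanTime_nonneg
  have hadd : ∀ x y, h (x + y) ≤ h x + h y := hexp.meanTime_add_le ht
  obtain ⟨C, hC, hle⟩ := exists_le_mul_norm_of_subadditive ht.meanTime_zero hnn hadd
  have ha' : 0 ≤ a' := le_trans (by nlinarith) h1
  obtain ⟨C₁, hC₁, hfl⟩ := hexp.fluctuation_union ht h0 hν zero_le_one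
  obtain ⟨C₂, hC₂, htail⟩ := hexp.time_tail ht h0 hν 1
  obtain ⟨C₃, hC₃, hdev⟩ := hexp.deviation_tail ht hξ0 hξ 1
  obtain ⟨R₀, hR₀⟩ := Filter.eventually_atTop.1
    (eventually_scales hθξ hξ0 hξ1 (max 1 (d : ℝ)))
  -- Beyond `R₁` the bad events have total probability less than `1`; below it, linear growth of the
  -- mean suffices.
  set R₁ := max (max 1 R₀) (C₁ + C₂ + C₃ + 1) with hR₁
  have hR₁1 : 1 ≤ R₁ := (le_max_left 1 R₀).trans (le_max_left _ _)
  set c := 7 + (d + 2) * (8 * K + 2 * C * d) with hc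
  have hc0 : 0 ≤ c := by positivity
  refine ⟨max c (C * R₁), le_max_of_le_left hc0, fun X hX => ?_⟩
  set R := ‖toEuc X‖ with hR
  have hR1 : 1 ≤ R := one_le_norm_toEuc hX
  have hR0 : 0 < R := by linarith
  by_cases hRR : R < R₁
  · have e1 : C * R ≤ C * R₁ * R ^ a' := by
      calc C * R ≤ C * R₁ * 1 := by rw [mul_one]; gcongr
        _ ≤ C * R₁ * R ^ a' := by
          gcongr
          exact Real.one_le_rpow hR1 ha'
    have e2 : C * R₁ * R ^ a' ≤ max c (C * R₁) * R ^ a' := by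
      gcongr; exact le_max_right _ _
    linarith [hle X, hnn (X + X)]
  rw [not_lt] at hRR
  obtain ⟨hs1, hs2⟩ := hR₀ R (((le_max_right 1 R₀).trans (le_max_left _ _)).trans hRR)
  -- The step length: larger than the deviation `ρ` of the geodesic from its axis, so that steps
  -- have norm at most `4 * r`, and at least `√R`, as the union bound requires.
  set r := R ^ (1 - θ) with hr
  have hr1 : 1 ≤ r := (le_max_left _ _).trans hs2
  have hrd : (d : ℝ) ≤ r := (le_max_right _ _).trans hs2
  have hr0 : 0 < r := by linarith
  have hrR : r ≤ R := by
    calc r ≤ R ^ (1 : ℝ) := Real.rpow_le_rpow_of_exponent_le hR1 (by linarith)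
      _ = R := Real.rpow_one R
  set ρ := (2 * R) ^ ξ' with hρ
  have hne : (0 : Fin d → ℤ) ≠ X + X := by
    intro h'
    apply hX
    funext i
    have := congrFun h' i
    simp only [Pi.zero_apply, Pi.add_apply] at this ⊢
    omega
  have hnorm2 : ‖toEuc (X + X - 0)‖ = 2 * R := by
    rw [sub_zero, toEuc_add, ← two_smul ℝ, norm_smul]; simp [hR]
  have hsq : R ^ (1 / 2 : ℝ) ≤ 4 * r := by
    have : R ^ (1 / 2 : ℝ) ≤ r := Real.rpow_le_rpow_of_exponent_le hR1 (by linarith)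
    linarith
  have b1 := hfl R hR1 (4 * r) hsq
  have b2 := htail (2 * R) (by linarith) 0 (X + X) hnorm2.le
  have b3 := hdev (2 * R) (by linarith) 0 (X + X) hnorm2.le hne
  have hinv : ∀ c, 0 < c → c * (2 * R) ^ (-1 : ℝ) ≤ c * R ^ (-1 : ℝ) := fun c hc => by
    gcongr ?_ * ?_
    exact Real.rpow_le_rpow_of_nonpos hR0 (by linarith) (by norm_num)
  obtain ⟨ω, hω, hbad⟩ := exists_of_measureReal_lt_one hgeo (S := _ ∪ (_ ∪ _))
    ((measureReal_union_le _ _).trans_lt (lt_of_le_of_lt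
      (add_le_add b1 ((measureReal_union_le _ _).trans (add_le_add (b2.trans (hinv _ hC₂))
        (b3.trans (hinv _ hC₃))))) (by
        rw [← add_mul, ← add_mul, Real.rpow_neg_one, ← div_eq_mul_inv, div_lt_one hR0]
        have := (le_max_right (max 1 R₀) (C₁ + C₂ + C₃ + 1)).trans hRR
        linarith)))
  simp only [Set.mem_union, not_or] at hbad
  obtain ⟨hb1, hb2, hb3⟩ := hbad
  simp only [Set.mem_ofPred_eq, not_le] at hb2 hb3
  obtain ⟨γ, hγ⟩ := hω 0 (X + X)
  set e : EuclideanSpace ℝ (Fin d) := R⁻¹ • toEuc X with he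
  have hen : ‖e‖ = 1 := by
    rw [he, norm_smul, norm_inv, norm_norm, ← hR]
    field_simp
  have hab : toEuc (X + X) - toEuc (0 : Fin d → ℤ) = (2 * R) • e := by
    rw [toEuc_zero, sub_zero, toEuc_add, he, smul_smul]
    have : 2 * R * R⁻¹ = 2 := by field_simp
    rw [this, two_smul]
  have haxis := fun z (hz : z ∈ γ.support) =>
    hγ.norm_sub_axis_lt hb3 hen (by positivity) hab hz
  simp only [sub_zero] at haxis
  have hinner : (inner ℝ e (toEuc (X + X)) : ℝ) = 2 * R := by
    rw [toEuc_zero, sub_zero] at hab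
    rw [hab, inner_smul_right, real_inner_self_eq_norm_sq, hen]; ring
  obtain ⟨l, hl1, hl2, hl3, hl4⟩ := IsGeodesic.exists_chain (fun e => ht.nonneg e ω) (h := h) hen
    (r := r) (ρ := ρ) (N := 4 * R) (κ := (4 * r) ^ ν) hr0.le (by positivity) (by
      intro x y hx hy hxy
      by_contra! hcon
      refine hb1 ⟨x, y, hx, hy, hxy.trans (by linarith), ?_⟩
      rw [abs_sub_comm]
      refine le_trans ?_ (le_abs_self _)
      change _ < h (y - x) at hcon
      change _ ≤ h (y - x) - passageTime _ _ _
      linarith) ⌊2 * R / r⌋₊ 0 γ hγ (fun z hz => (haxis z hz).1.le)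
      (fun z hz => (haxis z hz).2.1.le.trans (by linarith)) (by
        rw [hinner, toEuc_zero, inner_zero_right]; linarith) (by
        rw [hinner, toEuc_zero, inner_zero_right, zero_add, ← div_le_iff₀ hr0]
        exact (Nat.lt_floor_add_one _).le)
  rw [sub_zero] at hl2
  have hcount : (⌊2 * R / r⌋₊ : ℝ) + 1 ≤ 3 * (R / r) := by
    have e1 := Nat.floor_le (show 0 ≤ 2 * R / r by positivity)
    have e2 : 1 ≤ R / r := (one_le_div hr0).2 hrR
    have e3 : 2 * R / r = 2 * (R / r) := by ring
    linarith
  have hκ : (4 * r) ^ ν ≤ 4 * r ^ ν := rpow_const_mul_le (by norm_num) hr0.le hν1.le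
  have hRν : (2 * R) ^ ν ≤ 2 * ((R / r) * r ^ ν) := by
    refine (rpow_const_mul_le (by norm_num) hR0.le hν1.le).trans ?_
    gcongr
    have e1 : R = (R / r) * r := by field_simp
    nth_rewrite 1 [e1]
    rw [Real.mul_rpow (by positivity) hr0.le]
    gcongr
    calc (R / r) ^ ν ≤ (R / r) ^ (1 : ℝ) :=
          Real.rpow_le_rpow_of_exponent_le ((one_le_div hr0).2 hrR) hν1.le
      _ = R / r := Real.rpow_one _
  have htime : passageTime (fun e => t e ω) 0 (X + X) ≤ h (X + X) + (2 * R) ^ ν := by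
    have e1 := (abs_lt.1 hb2).2
    rw [sub_zero] at e1
    change time t 0 (X + X) ω ≤ _
    linarith
  have hsum : (l.map h).sum ≤ h (X + X) + 14 * ((R / r) * r ^ ν) := by
    have e1 : ((⌊2 * R / r⌋₊ : ℝ) + 1) * (4 * r) ^ ν ≤ 3 * (R / r) * (4 * r ^ ν) := by
      gcongr
    linarith
  -- The current bound with exponent `a` is only used for the boundedly many fractional steps, all
  -- of length of order `r`.
  have hfin := le_half_sum_add (ρ := 4 * r) (E := 8 * K * r ^ a) hnn hadd hC hle (by positivity)
    (fun u hu => by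
      by_cases hu0 : u = 0
      · subst hu0
        have e1 : h 0 = 0 := ht.meanTime_zero
        rw [e1]
        have := asymp_nonneg hnn hadd 0
        positivity
      · refine (hKa u hu0).trans ?_
        have e1 : ‖toEuc u‖ ^ a ≤ (8 * r) ^ a :=
          Real.rpow_le_rpow (norm_nonneg _) (by linarith) ha0
        have e2 : (8 * r) ^ a ≤ 8 * r ^ a := rpow_const_mul_le (by norm_num) hr0.le ha1
        have e3 : K * ‖toEuc u‖ ^ a ≤ K * (8 * r ^ a) := by
          gcongr; exact e1.trans e2
        linarith) hl1 hl2 (fun y hy => (hl3 y hy).trans (by linarith))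
  -- About `R / r` steps, each with an error `r ^ ν`.
  have hp1 : (R / r) * r ^ ν ≤ R ^ a' := by
    have e1 : (R / r) * r ^ ν = R ^ (ν + θ * (1 - ν)) := by
      rw [hr, ← Real.rpow_mul hR0.le, div_mul_eq_mul_div, eq_comm]
      nth_rewrite 2 [← Real.rpow_one R]
      rw [← Real.rpow_add hR0, ← Real.rpow_sub hR0]
      congr 1; ring
    rw [e1]
    exact Real.rpow_le_rpow_of_exponent_le hR1 h1
  have hp2 : r ^ a ≤ R ^ a' := by
    rw [hr, ← Real.rpow_mul hR0.le]
    exact Real.rpow_le_rpow_of_exponent_le hR1 (by linarith)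
  have hp3 : 1 ≤ R ^ a' := Real.one_le_rpow hR1 ha'
  calc h X ≤ _ := hfin
    _ ≤ 1 / 2 * (h (X + X) + 14 * R ^ a') + (d + 2) * (8 * K * R ^ a' + 2 * C * d * R ^ a') := by
      gcongr ?_ * ?_ + _ * (?_ + ?_)
      · linarith
      · gcongr
      · exact le_mul_of_one_le_right (by positivity) hp3
    _ = 1 / 2 * h (X + X) + c * R ^ a' := by rw [hc]; ring
    _ ≤ 1 / 2 * h (X + X) + max c (C * R₁) * R ^ a' := by
      gcongr; exact le_max_left _ _

/-- The nonrandom fluctuations `E τ(0,x) - lim E τ(0,nx)/n` are at most of the order of the random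
ones. -/
lemma HasGlobalExponents.nonrandom_fluctuation (hexp : HasGlobalExponents P t χa χb ξa ξb)
    (ht : IsIIDWeights P μ t)
    (hgeo : ∀ᵐ ω ∂P, ∀ a b, ∃ γ : (lattice d).Walk a b, IsGeodesic (fun e => t e ω) γ)
    (h0 : 0 < χa) (hξa : ξa < 1) {ν : ℝ} (hν : χa < ν) :
    ∃ K, 0 ≤ K ∧ ∀ u, u ≠ 0 →
      meanTime P t u ≤ asymp (meanTime P t) u + K * ‖toEuc u‖ ^ ν := by
  have hnn : ∀ x, 0 ≤ meanTime P t x := ht.meanTime_nonneg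
  have hadd := hexp.meanTime_add_le ht
  obtain ⟨C, hC, hle⟩ := exists_le_mul_norm_of_subadditive ht.meanTime_zero hnn hadd
  have hmono : ∀ a a' : ℝ, a ≤ a' → (∃ K, 0 ≤ K ∧ ∀ u, u ≠ 0 →
      meanTime P t u ≤ asymp (meanTime P t) u + K * ‖toEuc u‖ ^ a) → ∃ K, 0 ≤ K ∧ ∀ u, u ≠ 0 →
      meanTime P t u ≤ asymp (meanTime P t) u + K * ‖toEuc u‖ ^ a' := by
    rintro a a' haa ⟨K, hK, h⟩
    refine ⟨K, hK, fun u hu => (h u hu).trans ?_⟩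
    gcongr
    exact one_le_norm_toEuc hu
  have hbase : ∃ K, 0 ≤ K ∧ ∀ u, u ≠ 0 →
      meanTime P t u ≤ asymp (meanTime P t) u + K * ‖toEuc u‖ ^ (1 : ℝ) :=
    ⟨C, hC, fun u _ => by rw [Real.rpow_one]; linarith [hle u, asymp_nonneg hnn hadd u]⟩
  by_cases hν1 : 1 ≤ ν
  · exact hmono _ _ hν1 hbase
  rw [not_le] at hν1
  obtain ⟨ν', hν', hνν⟩ := exists_between hν
  obtain ⟨ξ', hξ', hξ1⟩ := exists_between (max_lt zero_lt_one hξa)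
  rw [max_lt_iff] at hξ'
  -- The last constraint gives `ν' + θ (1 - ν') ≤ ν`; the second makes steps of length `R ^ (1 - θ)`
  -- longer than the deviations.
  set θ := min (1 / 2) (min ((1 - ξ') / 2) (ν - ν')) with hθ
  have hθ0 : 0 < θ := lt_min (by norm_num) (lt_min (by linarith) (by linarith))
  have hθ1 : θ ≤ 1 / 2 := min_le_left _ _
  have hθ2 : θ ≤ (1 - ξ') / 2 := (min_le_right _ _).trans (min_le_left _ _)
  have hθ3 : θ ≤ ν - ν' := (min_le_right _ _).trans (min_le_right _ _)
  -- Bootstrap: each round of doubling multiplies the error exponent by `1 - θ`, starting from the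
  -- trivial linear bound and stopping at `ν`.
  have hstep : ∀ k : ℕ, ∃ K, 0 ≤ K ∧ ∀ u, u ≠ 0 → meanTime P t u ≤
      asymp (meanTime P t) u + K * ‖toEuc u‖ ^ (max ν ((1 - θ) ^ k)) := by
    intro k
    induction k with
    | zero => exact hmono _ _ (by simp) hbase
    | succ k ih =>
      obtain ⟨K, hK, hKa⟩ := ih
      have hp : (1 - θ) ^ k ≤ 1 := pow_le_one₀ (by linarith) (by linarith)
      have hp' : (1 - θ) ^ (k + 1) < 1 := pow_lt_one₀ (by linarith) (by linarith) (by simp)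
      have ha' : max ν ((1 - θ) ^ (k + 1)) < 1 := max_lt hν1 hp'
      obtain ⟨c, hc, hdbl⟩ := hexp.doubling ht hgeo h0 hν' (by linarith) hξ'.1 hξ1 hξ'.2 hθ0 hθ1
        (by linarith) (a := max ν ((1 - θ) ^ k)) (K := K) (a' := max ν ((1 - θ) ^ (k + 1)))
        (le_max_of_le_left (by linarith)) (max_le hν1.le hp) hK hKa
        (le_max_of_le_left (by nlinarith)) (by
          rw [max_mul_of_nonneg _ _ (by linarith), pow_succ]
          refine max_le_max ?_ le_rfl
          nlinarith)
      have hq : (2 : ℝ) ^ (max ν ((1 - θ) ^ (k + 1)) - 1) < 1 :=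
        Real.rpow_lt_one_of_one_lt_of_neg (by norm_num) (by linarith)
      exact ⟨_, div_nonneg hc (by linarith), fun u hu => le_asymp_of_doubling hnn hadd hc ha' hdbl hu⟩
  have hlim := tendsto_pow_atTop_nhds_zero_of_lt_one (r := 1 - θ) (by linarith) (by linarith)
  obtain ⟨k, hk⟩ := (hlim.eventually_lt_const (show 0 < ν by linarith)).exists
  exact hmono _ _ (max_le le_rfl hk.le) (hstep k)

end Exponents
end FPP

namespace FPP

variable {d : ℕ}

/-! ### Variance of nearly independent variables -/

/-- Truncation of a real number to `[-L, L]`. -/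
def clamp (L x : ℝ) : ℝ := max (min x L) (-L)

lemma abs_clamp_sub_clamp_le (L x y : ℝ) : |clamp L x - clamp L y| ≤ |x - y| :=
  (abs_max_sub_max_le_abs _ _ _).trans (abs_inf_sub_inf_le_abs _ _ _)

lemma abs_clamp_le {L : ℝ} (hL : 0 ≤ L) (x : ℝ) : |clamp L x| ≤ L :=
  abs_le.2 ⟨le_max_right _ _, max_le (min_le_right _ _) (by linarith)⟩

/-- The error vanishes for `|x| ≤ L`, and otherwise is at most `x² ≤ x⁴ / L²`. -/
lemma sub_clamp_sq_le {L : ℝ} (hL : 0 < L) (x : ℝ) : (x - clamp L x) ^ 2 ≤ x ^ 4 / L ^ 2 := by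
  rw [le_div_iff₀ (by positivity)]
  rcases le_total x (-L) with h | h
  · rw [clamp, min_eq_left (by linarith), max_eq_right h]
    have h1 : (x - -L) ^ 2 ≤ x ^ 2 := by nlinarith
    have h2 : L ^ 2 ≤ x ^ 2 := by nlinarith
    nlinarith [sq_nonneg (x - -L), sq_nonneg x]
  rcases le_total x L with h' | h'
  · rw [clamp, min_eq_left h', max_eq_left h]
    have : 0 ≤ x ^ 4 := by positivity
    nlinarith
  · rw [clamp, min_eq_right h', max_eq_left (by linarith)]
    have h1 : (x - L) ^ 2 ≤ x ^ 2 := by nlinarith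
    have h2 : L ^ 2 ≤ x ^ 2 := by nlinarith
    nlinarith [sq_nonneg (x - L), sq_nonneg x]

lemma measurable_clamp (L : ℝ) : Measurable (clamp L) := by
  unfold clamp; fun_prop

/-- If `X` and `Y` coincide with independent variables and are close to each other outside an
event of small probability, then `X` has small variance. -/
lemma variance_le_of_nearly_indep {Ω : Type*} [MeasurableSpace Ω] {P : Measure Ω}
    [IsProbabilityMeasure P] {X Y X' Y' : Ω → ℝ} (hX : MemLp X 2 P)
    (hX' : Measurable X') (hY' : Measurable Y') (hind : IndepFun X' Y' P)
    (hX4 : Integrable (fun ω => X ω ^ 4) P) {L Δ : ℝ} (hL : 0 < L) {B : Set Ω}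
    (hB : ∀ ω ∉ B, X' ω = X ω ∧ Y' ω = Y ω ∧ |X ω - Y ω| ≤ Δ) :
    variance X P ≤ 2 * Δ ^ 2 + 16 * L ^ 2 * P.real B + 4 * (∫ ω, X ω ^ 4 ∂P) / L ^ 2 := by
  set S : Ω → ℝ := fun ω => clamp L (X' ω) with hS
  set S' : Ω → ℝ := fun ω => clamp L (Y' ω) with hS'
  have hSm : Measurable S := (measurable_clamp L).comp hX'
  have hSm' : Measurable S' := (measurable_clamp L).comp hY'
  have hS2 : MemLp S 2 P := MemLp.of_bound hSm.aestronglyMeasurable L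
    (Filter.Eventually.of_forall fun ω => abs_clamp_le hL.le _)
  have hS2' : MemLp S' 2 P := MemLp.of_bound hSm'.aestronglyMeasurable L
    (Filter.Eventually.of_forall fun ω => abs_clamp_le hL.le _)
  have hSS : IndepFun S S' P := hind.comp (measurable_clamp L) (measurable_clamp L)
  -- `B` need not be measurable; a measurable hull has the same probability.
  set B' := toMeasurable P B with hB'
  have hB'm : MeasurableSet B' := measurableSet_toMeasurable P B
  have hB'P : P.real B' = P.real B := congrArg ENNReal.toReal (measure_toMeasurable B)
  have hBB : ∀ ω ∉ B', ω ∉ B := fun ω hω h => hω (subset_toMeasurable P B h)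
  have hind1 : Integrable (B'.indicator fun _ => (1 : ℝ)) P :=
    (integrable_const 1).indicator hB'm
  have hint1 : ∫ ω, B'.indicator (fun _ => (1 : ℝ)) ω ∂P = P.real B := by
    rw [integral_indicator_const _ hB'm, hB'P]; simp
  have hvar : variance S P ≤ Δ ^ 2 + 4 * L ^ 2 * P.real B := by
    -- By independence `Var (S - S') = Var S + Var S'`. Truncation puts both variables in `L²` and
    -- limits the contribution of `B` to `(2 L)² P(B)`.
    have h1 : variance S P ≤ variance (S - S') P := by
      have hneg : IndepFun S (-S') P := hSS.comp measurable_id measurable_neg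
      rw [sub_eq_add_neg, hneg.variance_add hS2 hS2'.neg, variance_neg]
      linarith [variance_nonneg S' P]
    refine h1.trans ((variance_le_expectation_sq (hS2.sub hS2').1).trans ?_)
    have h2 : ∀ ω, ((S - S') ^ 2) ω ≤ Δ ^ 2 + 4 * L ^ 2 * B'.indicator (fun _ => (1 : ℝ)) ω := by
      intro ω
      simp only [Pi.pow_apply, Pi.sub_apply]
      by_cases hω : ω ∈ B'
      · rw [Set.indicator_of_mem hω]
        have h3 := abs_le.1 (abs_clamp_le hL.le (X' ω))
        have h4 := abs_le.1 (abs_clamp_le hL.le (Y' ω))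
        have h5 : |S ω - S' ω| ≤ 2 * L := abs_le.2 ⟨by simp only [hS, hS']; linarith,
          by simp only [hS, hS']; linarith⟩
        have h6 : (S ω - S' ω) ^ 2 ≤ (2 * L) ^ 2 := sq_le_sq' (abs_le.1 h5).1 (abs_le.1 h5).2
        nlinarith [sq_nonneg Δ]
      · rw [Set.indicator_of_notMem hω]
        obtain ⟨e1, e2, e3⟩ := hB ω (hBB ω hω)
        have h5 : |S ω - S' ω| ≤ Δ :=
          (abs_clamp_sub_clamp_le _ _ _).trans (by rw [e1, e2]; exact e3)
        have h6 : (S ω - S' ω) ^ 2 ≤ Δ ^ 2 := sq_le_sq' (abs_le.1 h5).1 (abs_le.1 h5).2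
        linarith
    refine (integral_mono (hS2.sub hS2').integrable_sq
      ((integrable_const _).add (hind1.const_mul _)) h2).trans (le_of_eq ?_)
    simp only [Pi.add_apply]
    rw [integral_add (integrable_const _) (hind1.const_mul _), integral_const_mul, hint1]
    simp
  have hdiff : ∫ ω, (X ω - S ω) ^ 2 ∂P ≤ 2 * (∫ ω, X ω ^ 4 ∂P) / L ^ 2 + 4 * L ^ 2 * P.real B := by
    have h2 : ∀ ω, (X ω - S ω) ^ 2 ≤
        2 / L ^ 2 * X ω ^ 4 + 4 * L ^ 2 * B'.indicator (fun _ => (1 : ℝ)) ω := by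
      intro ω
      have h0 : 0 ≤ X ω ^ 4 / L ^ 2 := by positivity
      have e0 : 2 / L ^ 2 * X ω ^ 4 = 2 * (X ω ^ 4 / L ^ 2) := by ring
      rw [e0]
      by_cases hω : ω ∈ B'
      · rw [Set.indicator_of_mem hω]
        have h3 := abs_le.1 (abs_clamp_le hL.le (X' ω))
        have h4 : S ω ^ 2 ≤ L ^ 2 := sq_le_sq' h3.1 h3.2
        have h5 : X ω ^ 2 ≤ L ^ 2 + X ω ^ 4 / L ^ 2 := by
          have : X ω ^ 4 / L ^ 2 * L ^ 2 = X ω ^ 4 := by field_simp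
          have hL2 : 0 < L ^ 2 := by positivity
          rw [← sub_nonneg]
          have : 0 ≤ (L ^ 2 + X ω ^ 4 / L ^ 2 - X ω ^ 2) * L ^ 2 := by
            nlinarith [sq_nonneg (L ^ 2 - X ω ^ 2), sq_nonneg (L ^ 2), sq_nonneg (X ω ^ 2)]
          exact nonneg_of_mul_nonneg_left this hL2
        nlinarith [sq_nonneg (X ω + S ω)]
      · rw [Set.indicator_of_notMem hω]
        obtain ⟨e1, -, -⟩ := hB ω (hBB ω hω)
        have := sub_clamp_sq_le hL (X ω)
        simp only [hS, e1]
        linarith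
    refine (integral_mono (hX.sub hS2).integrable_sq
      ((hX4.const_mul _).add (hind1.const_mul _)) h2).trans (le_of_eq ?_)
    simp only [Pi.add_apply]
    rw [integral_add (hX4.const_mul _) (hind1.const_mul _), integral_const_mul, integral_const_mul,
      hint1]
    ring
  set c := ∫ ω, S ω ∂P with hc
  -- The variance is at most the second moment around any constant, here the mean of `S`.
  have hX1 : variance X P ≤ ∫ ω, (X ω - c) ^ 2 ∂P := by
    rw [← variance_sub_const hX.1 c]
    exact variance_le_expectation_sq (hX.1.sub aestronglyMeasurable_const)
  have hS1 : variance S P = ∫ ω, (S ω - c) ^ 2 ∂P := variance_eq_integral hSm.aemeasurable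
  have hXc : Integrable (fun ω => (X ω - S ω) ^ 2) P := (hX.sub hS2).integrable_sq
  have hSc : Integrable (fun ω => (S ω - c) ^ 2) P := (hS2.sub (memLp_const c)).integrable_sq
  have hmid : ∫ ω, (X ω - c) ^ 2 ∂P ≤ 2 * ∫ ω, (X ω - S ω) ^ 2 ∂P + 2 * ∫ ω, (S ω - c) ^ 2 ∂P := by
    rw [← integral_const_mul, ← integral_const_mul, ← integral_add (hXc.const_mul 2)
      (hSc.const_mul 2)]
    refine integral_mono (hX.sub (memLp_const c)).integrable_sq
      ((hXc.const_mul 2).add (hSc.const_mul 2)) fun ω => ?_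
    simp only
    nlinarith [sq_nonneg ((X ω - S ω) - (S ω - c))]
  have e : 4 * (∫ ω, X ω ^ 4 ∂P) / L ^ 2 = 2 * (2 * (∫ ω, X ω ^ 4 ∂P) / L ^ 2) := by ring
  rw [e]
  linarith

/-! ### Comparing passage times between translated pairs of points -/

/-- If the mean passage time varies little under the translation by `p - q` on the hyperplanes at
distance `m`, then the passage times between two translated pairs of points are close. -/
lemma IsGeodesic.passageTime_translate_le {w : Weights d} (hw : ∀ e, 0 ≤ w e)
    {h : (Fin d → ℤ) → ℝ} {e : EuclideanSpace ℝ (Fin d)} (he : ‖e‖ = 1) {R ρ m M N κ Δ : ℝ}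
    {p q v : Fin d → ℤ} {γ : (lattice d).Walk p (p + v)} (hγ : IsGeodesic w γ)
    (hρ : deviation w p (p + v) < ENNReal.ofReal ρ) (hv : toEuc v = R • e) (hm : 1 ≤ m)
    (hmR : 2 * m + 1 ≤ R)
    (hfl : ∀ x y : Fin d → ℤ, ‖toEuc x‖ ≤ N → ‖toEuc y‖ ≤ N → ‖toEuc (y - x)‖ ≤ M →
      |passageTime w x y - h (y - x)| ≤ κ)
    (hM : m + 1 + ρ + ‖toEuc (p - q)‖ ≤ M)
    (hN : max ‖toEuc p‖ ‖toEuc q‖ + R + ρ ≤ N)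
    (hosc : ∀ y u : Fin d → ℤ, |inner ℝ e (toEuc y) - m| ≤ 1 →
      ‖toEuc y - (inner ℝ e (toEuc y) : ℝ) • e‖ ≤ ρ → (u = p - q ∨ u = q - p) →
      h (y + u) ≤ h y + Δ) :
    passageTime w q (q + v) ≤ passageTime w p (p + v) + (2 * Δ + 4 * κ) := by
  have hR : 0 ≤ R := by linarith
  have hl : ∀ x y, (lattice d).Adj x y → (inner ℝ e (toEuc y) : ℝ) ≤ inner ℝ e (toEuc x) + 1 :=
    fun x y hxy => by linarith [(abs_le.1 (abs_inner_sub_le_one he hxy)).2]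
  have hab : toEuc (p + v) - toEuc p = R • e := by rw [toEuc_add, hv]; abel
  have hev : (inner ℝ e (toEuc v) : ℝ) = R := by
    rw [hv, inner_smul_right, real_inner_self_eq_norm_sq, he]; ring
  have hepv : (inner ℝ e (toEuc (p + v)) : ℝ) = inner ℝ e (toEuc p) + R := by
    rw [toEuc_add, inner_add_right, hev]
  -- The geodesic is left at heights `m` and `R - m` above `p`. Since `2 * m + 1 ≤ R`, the second
  -- cut can be made on the part after `y₁` despite the overshoot.
  obtain ⟨y₁, hy1, hy2, hy3, hs1, γ', hγ', hsub⟩ := hγ.exists_split hw hl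
    (c := inner ℝ e (toEuc p) + m) (by linarith) (by rw [hepv]; linarith)
  obtain ⟨y₂, hz1, hz2, hz3, hs2, -⟩ := hγ'.exists_split hw hl
    (c := inner ℝ e (toEuc p) + R - m) (by linarith) (by rw [hepv]; linarith)
  obtain ⟨a1, a2, -⟩ := hγ.norm_sub_axis_lt hρ he hR hab hy3
  obtain ⟨b1, b2, -⟩ := hγ.norm_sub_axis_lt hρ he hR hab (hsub hz3)
  have hpN : ‖toEuc p‖ + R + ρ ≤ N := by linarith [le_max_left ‖toEuc p‖ ‖toEuc q‖]
  have hqN : ‖toEuc q‖ + R + ρ ≤ N := by linarith [le_max_right ‖toEuc p‖ ‖toEuc q‖]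
  have hρ0 : 0 ≤ ρ := (norm_nonneg _).trans a1.le
  have hRv : ‖toEuc v‖ = R := by rw [hv, norm_smul, he, mul_one, Real.norm_of_nonneg hR]
  have npv : ‖toEuc (p + v)‖ ≤ N := by
    rw [toEuc_add]; linarith [norm_add_le (toEuc p) (toEuc v)]
  have nqv : ‖toEuc (q + v)‖ ≤ N := by
    rw [toEuc_add]; linarith [norm_add_le (toEuc q) (toEuc v)]
  have ny : ∀ y, ‖toEuc (y - p)‖ < R + ρ → ‖toEuc y‖ ≤ N := fun y hy => by
    have e1 : toEuc y = toEuc p + toEuc (y - p) := by rw [toEuc_sub]; abel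
    rw [e1]; linarith [norm_add_le (toEuc p) (toEuc (y - p))]
  have inner1 : |inner ℝ e (toEuc (y₁ - p)) - m| ≤ 1 := by
    rw [toEuc_sub, inner_sub_right, abs_le]; constructor <;> linarith
  have inner2 : |inner ℝ e (toEuc (p + v - y₂)) - m| ≤ 1 := by
    rw [toEuc_sub, inner_sub_right, hepv, abs_le]; constructor <;> linarith
  -- The last piece is measured from its end `p + v`, so both ends of the geodesic are treated by
  -- the same oscillation bound.
  have perp2 : ‖toEuc (p + v - y₂) - (inner ℝ e (toEuc (p + v - y₂)) : ℝ) • e‖ ≤ ρ := by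
    have e1 : toEuc (p + v - y₂) - (inner ℝ e (toEuc (p + v - y₂)) : ℝ) • e =
        -(toEuc (y₂ - p) - (inner ℝ e (toEuc (y₂ - p)) : ℝ) • e) := by
      rw [toEuc_sub, inner_sub_right, hepv, toEuc_sub, inner_sub_right, toEuc_add, hv]
      module
    rw [e1, norm_neg]; exact b1.le
  have size : ∀ y : Fin d → ℤ, |inner ℝ e (toEuc y) - m| ≤ 1 →
      ‖toEuc y - (inner ℝ e (toEuc y) : ℝ) • e‖ ≤ ρ → ‖toEuc y‖ ≤ m + 1 + ρ := by
    intro y h1 h2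
    have h3 := norm_le_norm_add_norm_sub ((inner ℝ e (toEuc y) : ℝ) • e) (toEuc y)
    rw [norm_sub_rev ((inner ℝ e (toEuc y) : ℝ) • e), norm_smul, he, mul_one, Real.norm_eq_abs] at h3
    have h4 : |(inner ℝ e (toEuc y) : ℝ)| ≤ m + 1 := by
      rw [abs_le] at h1 ⊢; constructor <;> linarith
    linarith
  have s1 := size _ inner1 a1.le
  have s2 := size _ inner2 perp2
  have hpq := norm_nonneg (toEuc (p - q))
  have hqp : ‖toEuc (q - p)‖ = ‖toEuc (p - q)‖ := by rw [toEuc_sub, toEuc_sub, norm_sub_rev]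
  have f1 := hfl p y₁ (by linarith) (ny _ a2) (by linarith)
  have f2 := hfl y₂ (p + v) (ny _ b2) npv (by linarith)
  have t1 : y₁ - q = y₁ - p + (p - q) := by abel
  have t2 : q + v - y₂ = p + v - y₂ + (q - p) := by abel
  have f3 := hfl q y₁ (by linarith) (ny _ a2) (by
    rw [t1, toEuc_add]; linarith [norm_add_le (toEuc (y₁ - p)) (toEuc (p - q))])
  have f4 := hfl y₂ (q + v) (ny _ b2) nqv (by
    rw [t2, toEuc_add]; linarith [norm_add_le (toEuc (p + v - y₂)) (toEuc (q - p))])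
  have o1 := hosc _ _ inner1 a1.le (Or.inl rfl)
  have o2 := hosc _ _ inner2 perp2 (Or.inr rfl)
  rw [← t1] at o1
  rw [← t2] at o2
  -- The competitor runs from `q` to `y₁`, to `y₂`, to `q + v`; the middle piece cancels, leaving
  -- two oscillations of `h` and four fluctuations.
  have g1 := passageTime_triangle hw q y₁ (q + v)
  have g2 := passageTime_triangle hw y₁ y₂ (q + v)
  rw [abs_le] at f1 f2 f3 f4
  linarith

/-- The only place where the geometry requires `d ≥ 2`: there must be room to translate sideways. -/
lemma exists_unit_orthogonal (hd : 2 ≤ d) (e : EuclideanSpace ℝ (Fin d)) :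
    ∃ f : EuclideanSpace ℝ (Fin d), ‖f‖ = 1 ∧ inner ℝ f e = 0 := by
  have h1 := Submodule.finrank_add_finrank_orthogonal (ℝ ∙ e)
  rw [finrank_euclideanSpace_fin] at h1
  have h2 := finrank_span_le_card (R := ℝ) ({e} : Set (EuclideanSpace ℝ (Fin d)))
  rw [Set.toFinset_singleton, Finset.card_singleton] at h2
  have h3 : 0 < Module.finrank ℝ (ℝ ∙ e)ᗮ := by omega
  have := Module.finrank_pos_iff.1 h3
  obtain ⟨⟨g, hg⟩, hg0⟩ := exists_ne (0 : (ℝ ∙ e)ᗮ)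
  have hg0' : g ≠ 0 := fun h => hg0 (Subtype.ext h)
  rw [Submodule.mem_orthogonal_singleton_iff_inner_left] at hg
  refine ⟨‖g‖⁻¹ • g, ?_, by rw [inner_smul_left, hg, mul_zero]⟩
  rw [norm_smul, norm_inv, norm_norm, inv_mul_cancel₀ (norm_ne_zero_iff.2 hg0')]

/-- Oscillation of a subadditive function near a direction of maximal growth. -/
lemma le_add_of_transverse {h : (Fin d → ℤ) → ℝ} (hnn : ∀ x, 0 ≤ h x)
    (hadd : ∀ x y, h (x + y) ≤ h x + h y) {C : ℝ}
    (hC : 0 ≤ C) (hle : ∀ x, h x ≤ C * ‖toEuc x‖) {A C₁ K ν : ℝ} (hA : 0 ≤ A) (hC₁ : 0 ≤ C₁)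
    (hmax : ∀ x, asymp h x ≤ A * ‖toEuc x‖) (hK : 0 ≤ K) (hν : 0 ≤ ν)
    (hfl : ∀ u, u ≠ 0 → h u ≤ asymp h u + K * ‖toEuc u‖ ^ ν) {v : Fin d → ℤ}
    (hv : A * ‖toEuc v‖ - C₁ ≤ asymp h v) {e : EuclideanSpace ℝ (Fin d)} (he : ‖e‖ = 1)
    (hve : toEuc v = ‖toEuc v‖ • e) {m ρ p M : ℝ} (hm : 2 * (d + 1) ≤ m)
    (hmv : 2 * m ≤ ‖toEuc v‖) {y u : Fin d → ℤ} (hy : |inner ℝ e (toEuc y) - m| ≤ 1)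
    (hyρ : ‖toEuc y - (inner ℝ e (toEuc y) : ℝ) • e‖ ≤ ρ)
    (hu : |(inner ℝ e (toEuc u) : ℝ)| ≤ d) (hp : ρ + ‖toEuc u‖ ≤ p) (hM : m + 1 + ρ + ‖toEuc u‖ ≤ M) :
    h (y + u) ≤ h y + (A * d + 2 * (A * (p ^ 2 / m) + (2 * C₁ + C * d + A * d)) + K * M ^ ν) := by
  have hd0 : (0 : ℝ) ≤ d := Nat.cast_nonneg d
  have hm0 : 0 < m := by linarith
  have hρ0 : 0 ≤ ρ := (norm_nonneg _).trans hyρ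
  have hp0 : 0 ≤ p := by linarith [norm_nonneg (toEuc u)]
  have hM0 : 0 ≤ M := by linarith [norm_nonneg (toEuc u)]
  set s : ℝ := inner ℝ e (toEuc y) with hs
  have hs' : (inner ℝ e (toEuc (y + u)) : ℝ) = s + inner ℝ e (toEuc u) := by
    rw [toEuc_add, inner_add_right]
  rw [abs_le] at hy hu
  set s' : ℝ := s + inner ℝ e (toEuc u) with hs'd
  -- At heights between `m / 2` and `2 * m`, which contain both `y` and `y + u`, the quadratic error
  -- is at most `p ^ 2 / m`.
  have hwin : ∀ z : Fin d → ℤ, ∀ b : ℝ, inner ℝ e (toEuc z) = b → m / 2 ≤ b → b ≤ 2 * m →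
      ‖toEuc z - b • e‖ ≤ p →
      |asymp h z - A * b| ≤ A * (p ^ 2 / m) + (2 * C₁ + C * d + A * d) := by
    intro z b hz h1 h2 h3
    refine (abs_asymp_sub_le hnn hadd hC hle hA hC₁ hmax hv he hve (s := b) (by linarith)
      (by linarith) hz h3).trans ?_
    gcongr
    linarith
  have w1 := hwin y s rfl (by linarith) (by linarith) (hyρ.trans (by linarith [norm_nonneg (toEuc u)]))
  have w2 := hwin (y + u) s' hs' (by linarith) (by linarith) (by
    rw [← hs']
    refine (norm_sub_axis_le he s).trans ?_
    have e1 : toEuc (y + u) - s • e = (toEuc y - s • e) + toEuc u := by rw [toEuc_add]; abel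
    rw [e1]
    exact (norm_add_le _ _).trans (by linarith))
  -- The nonrandom fluctuation bound is needed only for `y + u`; for `y` the inequality `asymp h ≤
  -- h` is enough.
  have h1 : h (y + u) ≤ asymp h (y + u) + K * M ^ ν := by
    by_cases h0 : y + u = 0
    · rw [h0]
      have e1 : h 0 ≤ 0 := by simpa using hle 0
      have := asymp_nonneg hnn hadd 0
      have : 0 ≤ K * M ^ ν := by positivity
      linarith
    · refine (hfl _ h0).trans ?_
      gcongr
      have e1 : toEuc (y + u) = s • e + (toEuc y - s • e) + toEuc u := by rw [toEuc_add]; abel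
      rw [e1]
      have n1 := norm_add_le (s • e + (toEuc y - s • e)) (toEuc u)
      have n2 := norm_add_le (s • e) (toEuc y - s • e)
      rw [norm_smul, he, mul_one, Real.norm_of_nonneg (by linarith)] at n2
      linarith
  have h2 := asymp_le hnn y
  rw [abs_le] at w1 w2
  have h3 : A * s' ≤ A * s + A * d := by
    rw [← mul_add]; gcongr; linarith
  linarith

end FPP

/-! ### The variance upper bound and the contradiction. -/

namespace FPP

variable {d : ℕ}

section Exponents

set_option linter.unusedSectionVars false

variable {Ω : Type*} [MeasurableSpace Ω] {P : Measure Ω} {μ : Measure ℝ}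
  {t : (lattice d).edgeSet → Ω → ℝ} {χa χb ξa ξb : ℝ}
variable [IsProbabilityMeasure P] [IsProbabilityMeasure μ]

lemma eventually_mul_rpow_le {a b : ℝ} (hab : a < b) (D : ℝ) :
    ∀ᶠ n : ℝ in Filter.atTop, D * n ^ a ≤ n ^ b := by
  filter_upwards [(tendsto_rpow_atTop (sub_pos.2 hab)).eventually_ge_atTop D,
    Filter.eventually_gt_atTop 0] with n h hn
  rwa [Real.rpow_sub hn, le_div_iff₀ (by positivity)] at h

/-- If the transversal exponent is small, then in some directions the passage times have smaller
fluctuations than `|v| ^ χa`. -/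
lemma HasGlobalExponents.variance_upper (hexp : HasGlobalExponents P t χa χb ξa ξb)
    (ht : IsIIDWeights P μ t) (hd : 2 ≤ d)
    (hgeo : ∀ᵐ ω ∂P, ∀ a b, ∃ γ : (lattice d).Walk a b, IsGeodesic (fun e => t e ω) γ)
    (h0 : 0 < χa) (hχ1 : χa ≤ 1) (hξχ : 2 * ξa - 1 < χa) :
    ∃ η C : ℝ, η < χa ∧ ∀ᶠ n : ℝ in Filter.atTop, ∃ v : Fin d → ℤ, |‖toEuc v‖ - n| ≤ d ∧
      variance (tau t v) P ≤ C * n ^ (2 * η) := by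
  -- Exponents: deviations `n ^ ξ₁` are below the separation `n ^ ξ₂`, itself below the cutting
  -- height `n ^ β`. The choice `β > 2 ξ₂ - χa`, possible because `ξ₂ < (1 + χa) / 2`, and `ν β <
  -- χa` put `η` below `χa`. Taking `ξ₁ > 1 / 2` also gives `n ^ β ≥ √n` for the union bound.
  obtain ⟨ξ₁, hξ₁, hξ₁'⟩ := exists_between (show max ξa (1 / 2) < (1 + χa) / 2 from
    max_lt (by linarith) (by linarith))
  rw [max_lt_iff] at hξ₁
  obtain ⟨ξ₂, hξ₂, hξ₂'⟩ := exists_between hξ₁'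
  obtain ⟨β, hβ, hβ1⟩ := exists_between (show max ξ₂ (2 * ξ₂ - χa) < 1 from
    max_lt (by linarith) (by linarith))
  rw [max_lt_iff] at hβ
  have hβ0 : 0 < β := by linarith
  obtain ⟨ν, hν, hν'⟩ := exists_between (show χa < χa / β by
    rw [lt_div_iff₀ hβ0]; nlinarith)
  rw [lt_div_iff₀ hβ0] at hν'
  have hν0 : 0 < ν := by linarith
  set η := max (2 * ξ₂ - β) (ν * β) with hη
  have hη0 : 0 < η := lt_max_of_lt_right (by positivity)
  set h := meanTime P t with hh
  have hnn : ∀ x, 0 ≤ h x := ht.meanTime_nonneg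
  have hadd : ∀ x y, h (x + y) ≤ h x + h y := hexp.meanTime_add_le ht
  obtain ⟨C, hC, hle⟩ := exists_le_mul_norm_of_subadditive ht.meanTime_zero hnn hadd
  obtain ⟨A, hA, hmax, C₁, hC₁, hnear⟩ := exists_near_maximal (by omega) hnn hadd hC hle
  obtain ⟨K, hK, hKν⟩ := hexp.nonrandom_fluctuation ht hgeo h0 (by linarith) hν
  -- The decay `n ^ (-4 ν)` is matched to the truncation level `n ^ (2 ν)` used at the end.
  obtain ⟨C₂, hC₂, hfl⟩ := hexp.fluctuation_union ht h0 hν (K := 4 * ν) (by positivity)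
  obtain ⟨C₃, hC₃, hdev⟩ := hexp.deviation_tail ht (ξ' := ξ₁) (by linarith) hξ₁.1 (4 * ν)
  obtain ⟨C₄, hC₄, hmom⟩ := hexp.fourth_moment ht hν
  set D₁ := A * d + (18 * A + 2 * (2 * C₁ + C * d + A * d)) + K * 4 ^ ν with hD₁
  set D := 2 * D₁ + 4 * 4 ^ ν with hD
  refine ⟨η, 2 * D ^ 2 + 16 * (C₂ + 2 * C₃) + 4 * C₄ * 2 ^ (4 * ν),
    max_lt (by linarith) hν', ?_⟩
  filter_upwards [Filter.eventually_ge_atTop 1, eventually_mul_rpow_le hξ₂ 8,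
    eventually_mul_rpow_le (show 0 < ξ₂ by linarith) (8 * (d + 1)), eventually_mul_rpow_le hβ1 4]
    with n hn hE1 hE2 hE3
  rw [Real.rpow_zero, mul_one] at hE2
  rw [Real.rpow_one] at hE3
  have hn0 : 0 < n := by linarith
  have hd0 : (0 : ℝ) ≤ d := Nat.cast_nonneg d
  set m := n ^ β with hm
  set R := n ^ ξ₂ with hR
  set ρ := (2 * n) ^ ξ₁ with hρ
  have hρ0 : 0 ≤ ρ := by positivity
  have hρR : ρ ≤ R / 4 := by
    have : ρ ≤ 2 * n ^ ξ₁ := rpow_const_mul_le (by norm_num) hn0.le (by linarith)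
    linarith
  have hRm : R ≤ m := Real.rpow_le_rpow_of_exponent_le hn hβ.1.le
  have hm0 : 0 < m := by positivity
  have hR0 : 0 < R := by positivity
  obtain ⟨v, hv1, hv2⟩ := hnear n hn
  refine ⟨v, hv1, ?_⟩
  rw [abs_le] at hv1
  have hvm : 2 * m + 1 ≤ ‖toEuc v‖ := by linarith
  have hv0 : 0 < ‖toEuc v‖ := by linarith
  have hvne : v ≠ 0 := by
    rintro rfl
    simp at hv0
  have hv2n : ‖toEuc v‖ ≤ 2 * n := by linarith
  set e : EuclideanSpace ℝ (Fin d) := ‖toEuc v‖⁻¹ • toEuc v with he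
  have hen : ‖e‖ = 1 := by
    rw [he, norm_smul, norm_inv, norm_norm, inv_mul_cancel₀ hv0.ne']
  have hve : toEuc v = ‖toEuc v‖ • e := by
    rw [he, smul_smul, mul_inv_cancel₀ hv0.ne', one_smul]
  obtain ⟨f, hf, hfe⟩ := exists_unit_orthogonal hd e
  -- The lattice translation: length about `R` across the axis, bounded component along it.
  have hz := norm_toEuc_nearest_sub_le (R • f)
  set z := nearest (R • f) with hzd
  have hznorm : ‖toEuc z‖ ≤ R + d := by
    have h1 := norm_le_norm_add_norm_sub (R • f) (toEuc z)
    rw [norm_sub_rev (R • f), norm_smul, hf, mul_one, Real.norm_of_nonneg hR0.le] at h1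
    linarith
  have hze : |(inner ℝ e (toEuc z) : ℝ)| ≤ d := by
    have h1 := abs_real_inner_le_norm e (toEuc z - R • f)
    rw [inner_sub_right, inner_smul_right, real_inner_comm f e, hfe, mul_zero, sub_zero, hen,
      one_mul] at h1
    exact h1.trans hz
  have hzf : R - d ≤ inner ℝ f (toEuc z) := by
    have h1 := abs_real_inner_le_norm f (toEuc z - R • f)
    rw [inner_sub_right, inner_smul_right, real_inner_self_eq_norm_sq, hf, one_mul] at h1
    have := (abs_le.1 (h1.trans hz)).1
    linarith
  have hη1 : 1 ≤ n ^ η := Real.one_le_rpow hn hη0.le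
  have hκ : (4 * m) ^ ν ≤ 4 ^ ν * n ^ η := by
    rw [Real.mul_rpow (by norm_num) hm0.le, hm, ← Real.rpow_mul hn0.le]
    gcongr
    rw [mul_comm]; exact le_max_right _ _
  have hpm : (3 * R) ^ 2 / m ≤ 9 * n ^ η := by
    have e1 : (3 * R) ^ 2 / m = 9 * n ^ (2 * ξ₂ - β) := by
      rw [Real.rpow_sub hn0, hR, mul_pow, ← Real.rpow_natCast (n ^ ξ₂), ← Real.rpow_mul hn0.le]
      push_cast
      rw [mul_comm ξ₂]
      ring
    rw [e1]
    gcongr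
    exact le_max_left _ _
  have hosc : ∀ y u : Fin d → ℤ, |inner ℝ e (toEuc y) - m| ≤ 1 →
      ‖toEuc y - (inner ℝ e (toEuc y) : ℝ) • e‖ ≤ ρ → (u = z ∨ u = -z) →
      h (y + u) ≤ h y + D₁ * n ^ η := by
    intro y u hy hyρ hu
    have hun : ‖toEuc u‖ ≤ R + d ∧ |(inner ℝ e (toEuc u) : ℝ)| ≤ d := by
      rcases hu with rfl | rfl
      · exact ⟨hznorm, hze⟩
      · have : toEuc (-z) = -toEuc z := by rw [← zero_sub, toEuc_sub, toEuc_zero, zero_sub]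
        rw [this, norm_neg, inner_neg_right, abs_neg]
        exact ⟨hznorm, hze⟩
    have h1 := le_add_of_transverse hnn hadd hC hle hA hC₁ hmax hK hν0.le hKν hv2 hen hve
      (m := m) (ρ := ρ) (p := 3 * R) (M := 4 * m) (by linarith) (by linarith) hy hyρ hun.2
      (by linarith [hun.1]) (by linarith [hun.1])
    refine h1.trans ?_
    gcongr
    have c1 : A * d ≤ A * d * n ^ η := le_mul_of_one_le_right (by positivity) hη1
    have c2 : 2 * C₁ + C * d + A * d ≤ (2 * C₁ + C * d + A * d) * n ^ η :=
      le_mul_of_one_le_right (by positivity) hη1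
    have c3 : A * ((3 * R) ^ 2 / m) ≤ A * (9 * n ^ η) := by gcongr
    have c4 : K * (4 * m) ^ ν ≤ K * (4 ^ ν * n ^ η) := by gcongr
    calc _ ≤ A * d * n ^ η + 2 * (A * (9 * n ^ η) + (2 * C₁ + C * d + A * d) * n ^ η) +
          K * (4 ^ ν * n ^ η) := by linarith
      _ = D₁ * n ^ η := by rw [hD₁]; ring
  have hsq : n ^ (1 / 2 : ℝ) ≤ 4 * m := by
    have : n ^ (1 / 2 : ℝ) ≤ m := Real.rpow_le_rpow_of_exponent_le hn (by linarith)
    linarith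
  have hvne' : ∀ p : Fin d → ℤ, p ≠ p + v := fun p hp => hvne (by simpa using hp.symm)
  have b1 := hfl n hn (4 * m) hsq
  have b2 := fun p : Fin d → ℤ => hdev (2 * n) (by linarith) p (p + v)
    (by rw [add_sub_cancel_left]; exact hv2n) (hvne' p)
  have hinv : C₃ * (2 * n) ^ (-(4 * ν)) ≤ C₃ * n ^ (-(4 * ν)) := by
    gcongr ?_ * ?_
    exact Real.rpow_le_rpow_of_nonpos hn0 (by linarith) (by linarith)
  set B₁ := {ω | ∃ a b, ‖toEuc a‖ ≤ 4 * n ∧ ‖toEuc b‖ ≤ 4 * n ∧ ‖toEuc (b - a)‖ ≤ 4 * m ∧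
        (4 * m) ^ ν ≤ |time t a b ω - meanTime P t (b - a)|} with hB₁
  set B₂ := fun p : Fin d → ℤ =>
    {ω | ENNReal.ofReal ρ ≤ deviation (fun e => t e ω) p (p + v)} with hB₂
  set B₃ := {ω | ¬ ∀ a b, ∃ γ : (lattice d).Walk a b, IsGeodesic (fun e => t e ω) γ} with hB₃
  have hPB₃ : P.real B₃ = 0 := by
    rw [measureReal_def, ae_iff.1 hgeo, ENNReal.toReal_zero]
  set B := B₁ ∪ (B₂ 0 ∪ (B₂ z ∪ B₃)) with hB
  have hPB : P.real B ≤ (C₂ + 2 * C₃) * n ^ (-(4 * ν)) := by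
    have u1 := measureReal_union_le (μ := P) B₁ (B₂ 0 ∪ (B₂ z ∪ B₃))
    have u2 := measureReal_union_le (μ := P) (B₂ 0) (B₂ z ∪ B₃)
    have u3 := measureReal_union_le (μ := P) (B₂ z) B₃
    have u4 : P.real (B₂ 0) ≤ _ := b2 0
    have u5 : P.real (B₂ z) ≤ _ := b2 z
    linarith
  -- Half-spaces separated by the hyperplane midway between the segments; strict inequalities make
  -- them disjoint, and `ρ ≤ R / 4` keeps each geodesic on its side.
  set H₁ : Set (Fin d → ℤ) := {x | (inner ℝ f (toEuc x) : ℝ) < R / 2} with hH₁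
  set H₂ : Set (Fin d → ℤ) := {x | R / 2 < (inner ℝ f (toEuc x) : ℝ)} with hH₂
  have hdisj : Disjoint H₁ H₂ := Set.disjoint_left.2 fun x h1 h2 =>
    lt_asymm (show (inner ℝ f (toEuc x) : ℝ) < R / 2 from h1) h2
  have hind := (ht.indepFun_passageTimeIn hdisj 0 (0 + v) z (z + v)).comp
    (measurable_id.sub_const (h v)) (measurable_id.sub_const (h v))
  have hXm := ht.measurable_time 0 v
  obtain ⟨hm4, hm4'⟩ := hmom v hvne
  have hmem : MemLp (fun ω => tau t v ω - h v) 2 P := (hexp.memLp_tau ht v).sub (memLp_const _)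
  have hgood : ∀ ω ∉ B, (passageTimeIn H₁ (fun e => t e ω) 0 (0 + v) - h v = tau t v ω - h v) ∧
      (passageTimeIn H₂ (fun e => t e ω) z (z + v) - h v = time t z (z + v) ω - h v) ∧
      |(tau t v ω - h v) - (time t z (z + v) ω - h v)| ≤ D * n ^ η := by
    intro ω hω
    simp only [hB, hB₁, hB₂, hB₃, Set.mem_union, Set.mem_ofPred_eq, not_or, not_le, not_not] at hω
    obtain ⟨g1, g2, g3, g4⟩ := hω
    obtain ⟨γ, hγ⟩ := g4 0 (0 + v)
    obtain ⟨γ', hγ'⟩ := g4 z (z + v)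
    have hw : ∀ e, 0 ≤ t e ω := fun e => ht.nonneg e ω
    have hsub : ∀ p : Fin d → ℤ, toEuc (p + v) - toEuc p = ‖toEuc v‖ • e := fun p => by
      rw [toEuc_add, ← hve]; abel
    have htau : tau t v ω = passageTime (fun e => t e ω) 0 (0 + v) := by
      rw [zero_add]; rfl
    have hfl' : ∀ x y : Fin d → ℤ, ‖toEuc x‖ ≤ 4 * n → ‖toEuc y‖ ≤ 4 * n →
        ‖toEuc (y - x)‖ ≤ 4 * m →
        |passageTime (fun e => t e ω) x y - h (y - x)| ≤ (4 * m) ^ ν := by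
      intro x y hx hy hxy
      by_contra! hcon
      exact g1 ⟨x, y, hx, hy, hxy, hcon.le⟩
    refine ⟨?_, ?_, ?_⟩
    · rw [hγ.passageTimeIn_eq hw (C := H₁), htau]
      intro x hx
      have := (hγ.norm_sub_axis_lt g2 hen hv0.le (hsub 0) hx).2.2 f hf hfe
      rw [sub_zero, abs_lt] at this
      change (inner ℝ f (toEuc x) : ℝ) < R / 2
      linarith
    · rw [hγ'.passageTimeIn_eq hw (C := H₂)]
      · rfl
      intro x hx
      have := (hγ'.norm_sub_axis_lt g3 hen hv0.le (hsub z) hx).2.2 f hf hfe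
      rw [toEuc_sub, inner_sub_right, abs_lt] at this
      change R / 2 < (inner ℝ f (toEuc x) : ℝ)
      linarith
    · have hzz : ‖toEuc (0 - z)‖ ≤ R + d := by
        rw [toEuc_sub, toEuc_zero, zero_sub, norm_neg]; exact hznorm
      -- The comparison is made in both directions, each time rerouting the geodesic of one pair to
      -- the endpoints of the other.
      have k1 := hγ.passageTime_translate_le hw (h := h) hen g2 hve (m := m) (M := 4 * m)
        (N := 4 * n) (κ := (4 * m) ^ ν) (Δ := D₁ * n ^ η) (q := z) (by linarith) hvm hfl'
        (by linarith) (by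
          rw [toEuc_zero, norm_zero, max_eq_right (norm_nonneg _)]; linarith)
        (fun y u hy hyρ hu => hosc y u hy hyρ (by simpa using hu.symm))
      have k2 := hγ'.passageTime_translate_le hw (h := h) hen g3 hve (m := m) (M := 4 * m)
        (N := 4 * n) (κ := (4 * m) ^ ν) (Δ := D₁ * n ^ η) (q := 0) (by linarith) hvm hfl'
        (by rw [sub_zero]; linarith) (by
          rw [toEuc_zero, norm_zero, max_eq_left (norm_nonneg _)]; linarith)
        (fun y u hy hyρ hu => hosc y u hy hyρ (by simpa using hu))
      have k3 : D * n ^ η = 2 * (D₁ * n ^ η) + 4 * (4 ^ ν * n ^ η) := by rw [hD]; ring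
      rw [htau, time, abs_le]
      constructor <;> linarith
  -- With `L = n ^ (2 ν)`, both `L² P(B)` and the fourth moment, of order `n ^ (4 ν)`, divided by
  -- `L²` are bounded.
  have hvar := variance_le_of_nearly_indep (P := P) (X := fun ω => tau t v ω - h v)
    (Y := fun ω => time t z (z + v) ω - h v)
    (X' := fun ω => passageTimeIn H₁ (fun e => t e ω) 0 (0 + v) - h v)
    (Y' := fun ω => passageTimeIn H₂ (fun e => t e ω) z (z + v) - h v) hmem
    ((ht.measurable_timeIn H₁ _ _).sub_const _) ((ht.measurable_timeIn H₂ _ _).sub_const _)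
    hind hm4 (L := n ^ (2 * ν)) (by positivity) hgood
  rw [variance_sub_const (hexp.memLp_tau ht v).1] at hvar
  have hL : (n ^ (2 * ν)) ^ 2 = n ^ (4 * ν) := by
    rw [← Real.rpow_natCast, ← Real.rpow_mul hn0.le]
    congr 1; push_cast; ring
  have hDη : (D * n ^ η) ^ 2 = D ^ 2 * n ^ (2 * η) := by
    rw [mul_pow, ← Real.rpow_natCast (n ^ η), ← Real.rpow_mul hn0.le]
    congr 2; push_cast; ring
  rw [hL, hDη] at hvar
  have hn4 : 0 < n ^ (4 * ν) := by positivity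
  have v1 : 16 * n ^ (4 * ν) * P.real B ≤ 16 * (C₂ + 2 * C₃) := by
    calc 16 * n ^ (4 * ν) * P.real B ≤ 16 * n ^ (4 * ν) * ((C₂ + 2 * C₃) * n ^ (-(4 * ν))) := by
          gcongr
      _ = 16 * (C₂ + 2 * C₃) := by rw [Real.rpow_neg hn0.le]; field_simp
  have v2 : 4 * (∫ ω, (tau t v ω - h v) ^ 4 ∂P) / n ^ (4 * ν) ≤ 4 * C₄ * 2 ^ (4 * ν) := by
    rw [div_le_iff₀ hn4]
    calc 4 * (∫ ω, (tau t v ω - h v) ^ 4 ∂P) ≤ 4 * (C₄ * ‖toEuc v‖ ^ (4 * ν)) := by gcongr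
      _ ≤ 4 * (C₄ * (2 * n) ^ (4 * ν)) := by gcongr
      _ = _ := by rw [Real.mul_rpow (by norm_num) hn0.le]; ring
  have hη2 : 1 ≤ n ^ (2 * η) := Real.one_le_rpow hn (by positivity)
  have v3 : 16 * (C₂ + 2 * C₃) ≤ 16 * (C₂ + 2 * C₃) * n ^ (2 * η) :=
    le_mul_of_one_le_right (by positivity) hη2
  have v4 : 4 * C₄ * 2 ^ (4 * ν) ≤ 4 * C₄ * 2 ^ (4 * ν) * n ^ (2 * η) :=
    le_mul_of_one_le_right (by positivity) hη2
  calc _ ≤ _ := hvar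
    _ ≤ 2 * (D ^ 2 * n ^ (2 * η)) + 16 * (C₂ + 2 * C₃) * n ^ (2 * η) +
        4 * C₄ * 2 ^ (4 * ν) * n ^ (2 * η) := by linarith
    _ = _ := by ring

end Exponents

lemma IsIIDWeights.isProbabilityMeasure {Ω : Type*} [MeasurableSpace Ω] {P : Measure Ω}
    [IsProbabilityMeasure P] {μ : Measure ℝ} {t : (lattice d).edgeSet → Ω → ℝ}
    (ht : IsIIDWeights P μ t) (hd : 0 < d) : IsProbabilityMeasure μ ∧ μ (Set.Iio 0) = 0 := by
  have hadj := lattice_adj_add_single (0 : Fin d → ℤ) ⟨0, hd⟩ (c := 1) (by simp)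
  let e : (lattice d).edgeSet := ⟨s(_, _), hadj⟩
  rw [← ht.law e]
  refine ⟨Measure.isProbabilityMeasure_map (ht.measurable e).aemeasurable, ?_⟩
  rw [Measure.map_apply (ht.measurable e) measurableSet_Iio]
  have : t e ⁻¹' Set.Iio 0 = ∅ := by
    ext ω
    simpa using ht.nonneg e ω
  rw [this, measure_empty]

end FPP

/-- The scaling inequality `χ ≤ 2 ξ_a - 1` in first-passage percolation on `ℤ^d`. -/
theorem theorem1 {d : ℕ} (hd : 2 ≤ d) {Ω : Type*} [MeasurableSpace Ω] (P : Measure Ω)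
    [IsProbabilityMeasure P] (μ : Measure ℝ) (t : (FPP.lattice d).edgeSet → Ω → ℝ)
    (ht : FPP.IsIIDWeights P μ t)
    (hμ : μ {sInf μ.support} < ENNReal.ofReal (FPP.criticalProb d))
    (χa χb ξa ξb : ℝ) (hexp : FPP.HasGlobalExponents P t χa χb ξa ξb)
    (hχ : χa = χb) (hpos : 0 < χa) :
    χa ≤ 2 * ξa - 1 := by
  obtain ⟨_, hμ0⟩ := ht.isProbabilityMeasure (by omega)
  have hgeo := ht.ae_exists_isGeodesic hμ0 hμ
  by_contra! hlt
  have hχ1 : χa ≤ 1 := hχ ▸ hexp.below_le_one ht (by omega)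
  obtain ⟨η, C, hη, hC⟩ := hexp.variance_upper ht hd hgeo hpos hχ1 hlt
  -- `χ'` lies strictly between `η` and `χa`, so the lower bound `n ^ (2 χ')` eventually exceeds the
  -- upper bound `n ^ (2 η)`; the factor `(1 / 2) ^ (2 χ')` below comes from `‖toEuc v‖ ≥ n / 2`.
  obtain ⟨χ', h1, h2⟩ := exists_between (max_lt hη hpos)
  rw [max_lt_iff] at h1
  obtain ⟨c, hc, hlow⟩ := hexp.variance_lower ht (hχ ▸ h2)
  have hc' : 0 < c * (1 / 2) ^ (2 * χ') := by positivity
  obtain ⟨n, ⟨v, hv, hvar⟩, hn, hn1, hnd⟩ := (hC.and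
    (((tendsto_rpow_atTop (show 0 < 2 * χ' - 2 * η by linarith)).eventually_gt_atTop
      (C / (c * (1 / 2) ^ (2 * χ')))).and
    ((Filter.eventually_ge_atTop 1).and (Filter.eventually_ge_atTop (2 * (d : ℝ)))))).exists
  have hn0 : 0 < n := by linarith
  have hvn : n / 2 ≤ ‖FPP.toEuc v‖ := by linarith [(abs_le.1 hv).1]
  have hv0 : v ≠ 0 := by
    rintro rfl
    simp at hvn
    linarith
  have h3 := (hlow v hv0).trans hvar
  have h4 : c * (1 / 2) ^ (2 * χ') * n ^ (2 * χ') ≤ c * ‖FPP.toEuc v‖ ^ (2 * χ') := by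
    rw [mul_assoc, ← Real.mul_rpow (by norm_num) hn0.le]
    have : 1 / 2 * n ≤ ‖FPP.toEuc v‖ := by linarith
    have h5 : 0 ≤ 2 * χ' := by linarith
    gcongr
  rw [Real.rpow_sub hn0, div_lt_div_iff₀ hc' (by positivity)] at hn
  linarith
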